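/- Setting. Let $\mu>0$, $\lambda+\mu>0$, $\omega>0$, $\Lambda_1,\Lambda_2>0$, let $f:\mathbb R^2\to\mathbb R$ be Lipschitz and periodic with periods $\Lambda_1,\Lambda_2$ in its two variables, let $h>\max f$, $\theta_1\in[0,\pi/2)$, $\theta_2\in[0,2\pi]$. Put $R=(0,\Lambda_1)\times(0,\Lambda_2)$, $\Omega=\{x=(r,x_3): r\in R,\ f(r)<x_3<h\}$, $S=\{(r,f(r)):r\in R\}$, $\Gamma_h=R\times\{h\}$, $\kappa_1=\omega/\sqrt{\lambda+2\mu}$, $\kappa_2=\omega/\sqrt\mu$, $\mathbf q=(\sin\theta_1\cos\theta_2,\sin\theta_1\sin\theta_2,-\cos\theta_1)^\top$, $\mathbf u^{\rm inc}(x)=\mathbf q\,e^{{\rm i}\kappa_1\mathbf q\cdot x}$ and $\alpha_1=\kappa_1\sin\theta_1\cos\theta_2$, $\alpha_2=\kappa_1\sin\theta_1\sin\theta_2$. For $n\in\mathbb Z^2$ let $\alpha_{jn}=\alpha_j+2\pi n_j/\Lambda_j$, $\boldsymbol\alpha_n=(\alpha_{1n},\alpha_{2n})$, $|n|_{\max}=\max(|n_1|,|n_2|)$,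 $$\beta_{jn}=\begin{cases}(\kappa_j^2-|\boldsymbol\alpha_n|^2)^{1/2}&\text{if }|\boldsymbol\alpha_n|\le\kappa_j,\\ {\rm i}(|\boldsymbol\alpha_n|^2-\kappa_j^2)^{1/2}&\text{if }|\boldsymbol\alpha_n|>\kappa_j,\end{cases}\qquad \chi_n=|\boldsymbol\alpha_n|^2+\beta_{1n}\beta_{2n},\qquad \delta_n=\beta_{1n}-\beta_{2n},$$ $$M_n=\frac{{\rm i}\mu}{\chi_n}\begin{bmatrix}\alpha_{1n}^2\delta_n+\beta_{2n}\chi_n&\alpha_{1n}\alpha_{2n}\delta_n&\alpha_{1n}\beta_{2n}\delta_n\\ \alpha_{1n}\alpha_{2n}\delta_n&\alpha_{2n}^2\delta_n+\beta_{2n}\chi_n&\alpha_{2n}\beta_{2n}\delta_n\\ -\alpha_{1n}\beta_{2n}\delta_n&-\alpha_{2n}\beta_{2n}\delta_n&\kappa_2^2\beta_{2n}\end{bmatrix}.$$ Let $H^1_{\rm qp}(\Omega)$ be the space of $u\in H^1(\Omega)$ whose lateral traces satisfy $u(\Lambda_1,x_2,x_3)=e^{{\rm i}\alpha_1\Lambda_1}u(0,x_2,x_3)$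 and $u(x_1,\Lambda_2,x_3)=e^{{\rm i}\alpha_2\Lambda_2}u(x_1,0,x_3)$, and $\mathbf H^1_{\rm qp}(\Omega)=H^1_{\rm qp}(\Omega)^3$. For $\mathbf u\in\mathbf H^1_{\rm qp}(\Omega)$ let $\mathbf u_n(h)=\frac1{\Lambda_1\Lambda_2}\int_R\mathbf u(r,h)e^{-{\rm i}\boldsymbol\alpha_n\cdot r}\,{\rm d}r$ be the Fourier coefficients of its trace on $\Gamma_h$, and put $$T\mathbf u=\sum_{n\in\mathbb Z^2}M_n\mathbf u_n(h)e^{{\rm i}\boldsymbol\alpha_n\cdot r},\qquad T_N\mathbf u=\sum_{|n_1|,|n_2|\le N}M_n\mathbf u_n(h)e^{{\rm i}\boldsymbol\alpha_n\cdot r},$$ where integrals of $T\mathbf u$ against $\overline{\mathbf v}$ over $\Gamma_h$ are understood as the $H^{-1/2}$-$H^{1/2}$ duality pairing, that is, as the sum over $n$ of the integrals of the terms of the series. A solution of the variational problem is a $\mathbf u\in\mathbf H^1_{\rm qp}(\Omega)$ with $\mathbf u=-\mathbf u^{\rm inc}$ on $S$ and $$\mu\int_\Omega\nabla\mathbf u:\nabla\overline{\mathbf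 v}\,{\rm d}x+(\lambda+\mu)\int_\Omega(\nabla\cdot\mathbf u)(\nabla\cdot\overline{\mathbf v})\,{\rm d}x-\omega^2\int_\Omega\mathbf u\cdot\overline{\mathbf v}\,{\rm d}x-\int_{\Gamma_h}T\mathbf u\cdot\overline{\mathbf v}\,{\rm d}s=0$$ for all $\mathbf v\in\mathbf H^1_{\rm qp}(\Omega)$ with $\mathbf v=0$ on $S$. Lemma. There are $C>0$ and $N_0\in\mathbb N$, depending only on $\lambda,\mu,\omega,\Lambda_1,\Lambda_2,f,h,\theta_1,\theta_2$, such that the following holds. Let $\max f<\hat h<h$, let $\mathbf u$ be a solution of the variational problem, and let $C_s$ be any constant in the stability estimate $\|\mathbf u\|_{\mathbf H^1(\Omega)}\le C_s\|\mathbf u^{\rm inc}\|_{\mathbf H^1(\Omega)}$. Then for every integer $N\ge N_0$ the maximum below is attained, and for every $\mathbf v\in\mathbf H^1_{\rm qp}(\Omega)$ the series of the pairing $\int_{\Gamma_h}T\mathbf u\cdot\overline{\mathbf v}\,{\rm d}s$ converges absolutely and $$\left|\int_{\Gamma_h}(T-T_N)\mathbf u\cdot\overline{\mathbf v}\,{\rm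 d}s\right|\le C\,C_s\max_{|n|_{\max}>N}\left(|n|_{\max}e^{-|\beta_{2n}|(h-\hat h)}\right)\|\mathbf u^{\rm inc}\|_{\mathbf H^1(\Omega)}\|\mathbf v\|_{\mathbf H^1(\Omega)}.$$ -/

import Mathlib

open MeasureTheory Filter Topology
open scoped ContDiff

noncomputable section

/-- Points `x = (r, x₃)` of `ℝ³`, with `r = (x₁, x₂)` the horizontal part. The measure `volume` on
this product is three-dimensional Lebesgue measure. -/
abbrev Space3 : Type := (ℝ × ℝ) × ℝ

/-- The coordinate directions `e₁, e₂, e₃` of `ℝ³`. -/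
def unitVec : Fin 3 → Space3 := ![((1, 0), 0), ((0, 1), 0), ((0, 0), 1)]

/-- The classical partial derivatives of a function on `ℝ³`. -/
def classicalGrad (w : Space3 → ℂ) (j : Fin 3) (x : Space3) : ℂ := fderiv ℝ w x (unitVec j)

/-- A member of the Sobolev space `H¹(Ω)` of complex-valued functions: a square-integrable function
together with square-integrable weak first partial derivatives. -/
structure SobolevH1 (Ω : Set Space3) where
  toFun : Space3 → ℂ
  grad : Fin 3 → Space3 → ℂ
  memLp : MemLp toFun 2 (volume.restrict Ω)
  grad_memLp : ∀ j, MemLp (grad j) 2 (volume.restrict Ω)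
  weak_grad : ∀ φ : Space3 → ℂ, ContDiff ℝ ∞ φ → HasCompactSupport φ → tsupport φ ⊆ Ω →
    ∀ j, ∫ x in Ω, toFun x * classicalGrad φ j x = -∫ x in Ω, grad j x * φ x

/-- `∫_Ω (|w|² + |∇w|²)` for a function `w` with gradient `g`. -/
def h1NormSq (Ω : Set Space3) (w : Space3 → ℂ) (g : Fin 3 → Space3 → ℂ) : ℝ :=
  ∫ x in Ω, (‖w x‖ ^ 2 + ∑ j, ‖g j x‖ ^ 2)

/-- The norm of a vector field in `H¹(Ω)³` (the 2-norm of the component norms). -/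
def h1Norm {Ω : Set Space3} (u : Fin 3 → SobolevH1 Ω) : ℝ :=
  Real.sqrt (∑ i, h1NormSq Ω (u i).toFun (u i).grad)

/-- `g` is the trace of `u ∈ H¹(Ω)` on the surface piece parametrized by `p : A → ℝ³`, `A ⊆ ℝ²`:
there are smooth functions on `ℝ³` which converge to `u` in `H¹(Ω)` and whose restrictions to the
surface converge to `g` in `L²`. -/
def HasTrace {Ω : Set Space3} (u : SobolevH1 Ω) (A : Set (ℝ × ℝ)) (p : ℝ × ℝ → Space3)
    (g : ℝ × ℝ → ℂ) : Prop :=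
  MemLp g 2 (volume.restrict A) ∧
  ∃ w : ℕ → Space3 → ℂ, (∀ k, ContDiff ℝ ∞ (w k)) ∧
    Tendsto (fun k => eLpNorm (fun x => w k x - u.toFun x) 2 (volume.restrict Ω)) atTop (𝓝 0) ∧
    (∀ j, Tendsto (fun k => eLpNorm (fun x => classicalGrad (w k) j x - u.grad j x) 2
      (volume.restrict Ω)) atTop (𝓝 0)) ∧
    Tendsto (fun k => eLpNorm (fun y => w k (p y) - g y) 2 (volume.restrict A)) atTop (𝓝 0)

open Classical in
/-- The trace of `u` on a surface piece, as a function of the parameter (it is unique up to null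
sets). -/
def traceOn {Ω : Set Space3} (u : SobolevH1 Ω) (A : Set (ℝ × ℝ)) (p : ℝ × ℝ → Space3) :
    ℝ × ℝ → ℂ :=
  if hu : ∃ g, HasTrace u A p g then hu.choose else 0

/-- The data of the scattering problem: Lamé parameters, angular frequency, periods, surface
profile, height of the artificial boundary and incident angles. -/
structure BiperiodicScattering where
  lam : ℝ
  mu : ℝ
  omega : ℝ
  L₁ : ℝ
  L₂ : ℝ
  f : ℝ × ℝ → ℝ
  h : ℝ
  θ₁ : ℝ
  θ₂ : ℝ
  mu_pos : 0 < mu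
  lam_add_mu_pos : 0 < lam + mu
  omega_pos : 0 < omega
  L₁_pos : 0 < L₁
  L₂_pos : 0 < L₂
  f_lipschitz : ∃ K, LipschitzWith K f
  f_periodic₁ : ∀ x₁ x₂, f (x₁ + L₁, x₂) = f (x₁, x₂)
  f_periodic₂ : ∀ x₁ x₂, f (x₁, x₂ + L₂) = f (x₁, x₂)
  f_lt_h : ∀ r, f r < h
  θ₁_mem : θ₁ ∈ Set.Ico 0 (Real.pi / 2)
  θ₂_mem : θ₂ ∈ Set.Icc 0 (2 * Real.pi)

namespace BiperiodicScattering

variable (P : BiperiodicScattering)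

/-- The horizontal cell `(0, Λ₁) × (0, Λ₂)`. -/
def cell : Set (ℝ × ℝ) := Set.Ioo 0 P.L₁ ×ˢ Set.Ioo 0 P.L₂

/-- The bounded domain between the scattering surface and the plane `x₃ = h`. -/
def domain : Set Space3 := {x | x.1 ∈ P.cell ∧ P.f x.1 < x.2 ∧ x.2 < P.h}

/-- The compressional wavenumber. -/
def kappa₁ : ℝ := P.omega / Real.sqrt (P.lam + 2 * P.mu)

/-- The shear wavenumber. -/
def kappa₂ : ℝ := P.omega / Real.sqrt P.mu

/-- The propagation direction of the incident wave. -/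
def q : Fin 3 → ℝ :=
  ![Real.sin P.θ₁ * Real.cos P.θ₂, Real.sin P.θ₁ * Real.sin P.θ₂, -Real.cos P.θ₁]

/-- The incident compressional plane wave `q exp(i κ₁ q · x)`. -/
def uinc (i : Fin 3) (x : Space3) : ℂ :=
  (P.q i : ℂ) * Complex.exp (Complex.I *
    ((P.kappa₁ * (P.q 0 * x.1.1 + P.q 1 * x.1.2 + P.q 2 * x.2) : ℝ) : ℂ))

/-- The norm of the incident field in `H¹(Ω)³`. -/
def uincNorm : ℝ :=
  Real.sqrt (∑ i, h1NormSq P.domain (P.uinc i) (classicalGrad (P.uinc i)))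

def alpha₁ : ℝ := P.kappa₁ * Real.sin P.θ₁ * Real.cos P.θ₂

def alpha₂ : ℝ := P.kappa₁ * Real.sin P.θ₁ * Real.sin P.θ₂

/-- `α₁ₙ = α₁ + 2πn₁/Λ₁`. -/
def a₁ (n : ℤ × ℤ) : ℝ := P.alpha₁ + 2 * Real.pi * n.1 / P.L₁

/-- `α₂ₙ = α₂ + 2πn₂/Λ₂`. -/
def a₂ (n : ℤ × ℤ) : ℝ := P.alpha₂ + 2 * Real.pi * n.2 / P.L₂

/-- `|αₙ|²`. -/
def aSq (n : ℤ × ℤ) : ℝ := P.a₁ n ^ 2 + P.a₂ n ^ 2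

/-- `(κ² - |αₙ|²)^{1/2}`, on the branch with non-negative real and imaginary parts. -/
def betaOf (κ : ℝ) (n : ℤ × ℤ) : ℂ :=
  if P.aSq n ≤ κ ^ 2 then (Real.sqrt (κ ^ 2 - P.aSq n) : ℂ)
  else Complex.I * (Real.sqrt (P.aSq n - κ ^ 2) : ℂ)

def beta₁ (n : ℤ × ℤ) : ℂ := P.betaOf P.kappa₁ n

def beta₂ (n : ℤ × ℤ) : ℂ := P.betaOf P.kappa₂ n

/-- `χₙ = |αₙ|² + β₁ₙβ₂ₙ`. -/
def chi (n : ℤ × ℤ) : ℂ := (P.aSq n : ℂ) + P.beta₁ n * P.beta₂ n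

/-- The matrix `Mₙ`, the symbol of the DtN operator. -/
def M (n : ℤ × ℤ) : Matrix (Fin 3) (Fin 3) ℂ :=
  let a : ℂ := (P.a₁ n : ℂ)
  let b : ℂ := (P.a₂ n : ℂ)
  let c : ℂ := P.beta₂ n
  let d : ℂ := P.beta₁ n - P.beta₂ n
  (Complex.I * (P.mu : ℂ) / P.chi n) •
    !![a ^ 2 * d + c * P.chi n, a * b * d, a * c * d;
       a * b * d, b ^ 2 * d + c * P.chi n, b * c * d;
       -(a * c * d), -(b * c * d), (P.kappa₂ : ℂ) ^ 2 * c]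

/-- `exp(i αₙ · r)`. -/
def fourierMode (n : ℤ × ℤ) (r : ℝ × ℝ) : ℂ :=
  Complex.exp (Complex.I * ((P.a₁ n * r.1 + P.a₂ n * r.2 : ℝ) : ℂ))

/-- The trace of a vector field on `Γ_h`, as a function of `r` in the cell. -/
def topTrace (u : Fin 3 → SobolevH1 P.domain) (i : Fin 3) : ℝ × ℝ → ℂ :=
  traceOn (u i) P.cell (fun r => (r, P.h))

/-- The Fourier coefficients `uₙ(h)` of the trace of `u` on `Γ_h`. -/
def fourierCoeffTop (u : Fin 3 → SobolevH1 P.domain) (n : ℤ × ℤ) : Fin 3 → ℂ := fun i =>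
  ((P.L₁ * P.L₂ : ℝ) : ℂ)⁻¹ *
    ∫ r in P.cell, P.topTrace u i r * (starRingEnd ℂ) (P.fourierMode n r)

/-- The `n`-th term `Mₙ uₙ(h) exp(i αₙ · r)` of the series defining `T u`. -/
def dtnMode (u : Fin 3 → SobolevH1 P.domain) (n : ℤ × ℤ) (r : ℝ × ℝ) (i : Fin 3) : ℂ :=
  (P.M n).mulVec (P.fourierCoeffTop u n) i * P.fourierMode n r

/-- `∫_{Γ_h} g · v̄ ds`. -/
def topPairing (g : ℝ × ℝ → Fin 3 → ℂ) (v : Fin 3 → SobolevH1 P.domain) : ℂ :=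
  ∫ r in P.cell, ∑ i, g r i * (starRingEnd ℂ) (P.topTrace v i r)

/-- `∫_{Γ_h} T u · v̄ ds`. Since `T u` is only in `H^{-1/2}(Γ_h)³`, the integral is the duality
pairing, that is the series of the pairings of the terms of `T u` with `v`. -/
def dtnForm (u v : Fin 3 → SobolevH1 P.domain) : ℂ :=
  ∑' n : ℤ × ℤ, P.topPairing (P.dtnMode u n) v

/-- The truncated DtN operator: `T_N u` as a function on `Γ_h`. -/
def dtnTrunc (N : ℕ) (u : Fin 3 → SobolevH1 P.domain) (r : ℝ × ℝ) (i : Fin 3) : ℂ :=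
  ∑ n ∈ Finset.Icc (-(N : ℤ)) N ×ˢ Finset.Icc (-(N : ℤ)) N, P.dtnMode u n r i

/-- The traces of `u` on the lateral faces `x₁ = 0` and `x₁ = Λ₁`, and on the faces `x₂ = 0` and
`x₂ = Λ₂`, match up to the factors `exp(i α₁ Λ₁)` and `exp(i α₂ Λ₂)`. -/
def QuasiPeriodic (u : SobolevH1 P.domain) : Prop :=
  (∃ g : ℝ × ℝ → ℂ,
    HasTrace u {y | y.1 ∈ Set.Ioo 0 P.L₂ ∧ P.f (0, y.1) < y.2 ∧ y.2 < P.h}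
      (fun y => ((0, y.1), y.2)) g ∧
    HasTrace u {y | y.1 ∈ Set.Ioo 0 P.L₂ ∧ P.f (P.L₁, y.1) < y.2 ∧ y.2 < P.h}
      (fun y => ((P.L₁, y.1), y.2))
      (fun y => Complex.exp (Complex.I * ((P.alpha₁ * P.L₁ : ℝ) : ℂ)) * g y)) ∧
  (∃ g : ℝ × ℝ → ℂ,
    HasTrace u {y | y.1 ∈ Set.Ioo 0 P.L₁ ∧ P.f (y.1, 0) < y.2 ∧ y.2 < P.h}
      (fun y => ((y.1, 0), y.2)) g ∧
    HasTrace u {y | y.1 ∈ Set.Ioo 0 P.L₁ ∧ P.f (y.1, P.L₂) < y.2 ∧ y.2 < P.h}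
      (fun y => ((y.1, P.L₂), y.2))
      (fun y => Complex.exp (Complex.I * ((P.alpha₂ * P.L₂ : ℝ) : ℂ)) * g y))

/-- Membership in `H¹_qp(Ω)³`. -/
def MemHqp (u : Fin 3 → SobolevH1 P.domain) : Prop := ∀ i, P.QuasiPeriodic (u i)

/-- `u = g` on the scattering surface `S`, in the sense of traces. -/
def EqOnSurface (u : Fin 3 → SobolevH1 P.domain) (g : Fin 3 → Space3 → ℂ) : Prop :=
  ∀ i, HasTrace (u i) P.cell (fun r => (r, P.f r)) (fun r => g i (r, P.f r))

/-- The divergence of a vector field in `H¹(Ω)³`. -/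
def divergence (u : Fin 3 → SobolevH1 P.domain) (x : Space3) : ℂ := ∑ i, (u i).grad i x

/-- The sesquilinear form `a(u, v)` of the variational problem. -/
def sesqForm (u v : Fin 3 → SobolevH1 P.domain) : ℂ :=
  (P.mu : ℂ) * (∫ x in P.domain,
      ∑ i, ∑ j, (u i).grad j x * (starRingEnd ℂ) ((v i).grad j x))
    + ((P.lam + P.mu : ℝ) : ℂ) * (∫ x in P.domain,
      P.divergence u x * (starRingEnd ℂ) (P.divergence v x))
    - (P.omega : ℂ) ^ 2 * (∫ x in P.domain,
      ∑ i, (u i).toFun x * (starRingEnd ℂ) ((v i).toFun x))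
    - P.dtnForm u v

/-- `u` solves the variational problem: `u ∈ H¹_qp(Ω)³`, `u = -u^inc` on `S`, and `a(u, v) = 0` for
all `v ∈ H¹_qp(Ω)³` that vanish on `S`. -/
def IsSolution (u : Fin 3 → SobolevH1 P.domain) : Prop :=
  P.MemHqp u ∧ P.EqOnSurface u (fun i x => -P.uinc i x) ∧
    ∀ v : Fin 3 → SobolevH1 P.domain, P.MemHqp v → P.EqOnSurface v (fun _ _ => 0) →
      P.sesqForm u v = 0

/-- `|n|_max = max(|n₁|, |n₂|)`. -/
def nMax (n : ℤ × ℤ) : ℤ := max |n.1| |n.2|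

/-- The values `|n|_max exp(-|β₂ₙ| (h - ĥ))` over the indices `n` with `|n|_max > N`. -/
def tailValues (N : ℕ) (hhat : ℝ) : Set ℝ :=
  {t | ∃ n : ℤ × ℤ, (N : ℤ) < nMax n ∧
    t = (nMax n : ℝ) * Real.exp (-(‖P.beta₂ n‖ * (P.h - hhat)))}

end BiperiodicScattering

end

/-!
The matrices `Mₙ` grow like `|αₙ|`, so the truncation error is small only because the Fourier
coefficients `uₙ(h)` of a solution decay exponentially, at the rate `|β₂ₙ| (h - max f)`. For this
no representation of the solution as a sum of plane waves is needed, only the variational equation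
tested with one field for each `n` with `|αₙ|` large.

* The test field is `η ψ exp(i αₙ · r)`, where `ψ` is the solution of the Navier equation of the
  `n`-th mode which decays downwards and has the value `c = uₙ(h)` at the level `h` (`wave`), and
  `η` is a cutoff in a layer of thickness `1 / |αₙ|` above the level `max f`. Green's formula, in
  which the quasi-periodicity cancels the lateral terms, moves all derivatives to the test field
  (`IsSolution.sum_modePairing_modeNavier`). There remain the `L²` product of `u` with a
  commutator, which lives in the layer and is of size `|αₙ|³ exp(-γ₂ₙ (h - max f)) |c|`, where
  `|β₂ₙ| = γ₂ₙ`, and a boundary term on `Γ_h`.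
* The boundary term is the pairing with `c` of the difference between the traction of the downward
  decaying wave and `Mₙ c`, the traction of the upward decaying wave with the same value `c`. An
  explicit computation shows that its real part is at least `2 μ γ₂ₙ |c|²`
  (`le_norm_traction_sub`).
* The commutator fields are orthogonal in `L²(Ω)` for different `n`. By Bessel's inequality,
  applied to the horizontal derivatives of `u`, this gives
  `|αₙ|^{1/2} |uₙ(h)| ≤ C |αₙ| exp(-γ₂ₙ (h - max f)) Aₙ` with `∑ Aₙ² ≤ C ‖u‖²` (`exists_fourierCoeffTop_decay`).
* The trace theorem for `v`, proved in the same way with cutoffs near `Γ_h`, gives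
  `|αₙ|^{1/2} |vₙ(h)| ≤ C Bₙ` with `∑ Bₙ² ≤ C ‖v‖²` (`exists_fourierCoeffTop_bound`).

Since `|αₙ|` is comparable to `|n|_max`, the tail of the pairing is at most a constant times the
maximum of the statement times `∑ Aₙ Bₙ`, and the Cauchy–Schwarz inequality concludes. The sum over `|n|_max > N`
is bounded uniformly over finite subsets, which also yields the absolute convergence.
-/

/-! ### Integration over boxes -/

/-- The point of `ℝ³` whose `j`-th coordinate is `x.2` and whose other two coordinates are, in
order, those of `x.1`. -/
def slice : Fin 3 → Space3 → Space3
  | 0, x => ((x.2, x.1.1), x.1.2)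
  | 1, x => ((x.1.1, x.2), x.1.2)
  | 2, x => x

/-- The open box with opposite corners `lo` and `hi`. -/
def openBox (lo hi : Fin 3 → ℝ) : Set Space3 :=
  (Set.Ioo (lo 0) (hi 0) ×ˢ Set.Ioo (lo 1) (hi 1)) ×ˢ Set.Ioo (lo 2) (hi 2)

/-- The face of `openBox lo hi` orthogonal to `e_j`, in the coordinates used by `slice j`. -/
def boxFace : Fin 3 → (Fin 3 → ℝ) → (Fin 3 → ℝ) → Set (ℝ × ℝ)
  | 0, lo, hi => Set.Ioo (lo 1) (hi 1) ×ˢ Set.Ioo (lo 2) (hi 2)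
  | 1, lo, hi => Set.Ioo (lo 0) (hi 0) ×ˢ Set.Ioo (lo 2) (hi 2)
  | 2, lo, hi => Set.Ioo (lo 0) (hi 0) ×ˢ Set.Ioo (lo 1) (hi 1)

theorem measurePreserving_slice (j : Fin 3) : MeasurePreserving (slice j) volume volume := by
  have hA := measurePreserving_prodAssoc (volume : Measure ℝ) (volume : Measure ℝ)
    (volume : Measure ℝ)
  have hA' := hA.symm
  fin_cases j
  · exact hA'.comp Measure.measurePreserving_swap
  · exact hA'.comp (((MeasurePreserving.id _).prod Measure.measurePreserving_swap).comp hA)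
  · exact MeasurePreserving.id _

theorem continuous_slice (j : Fin 3) : Continuous (slice j) := by
  fin_cases j
  · show Continuous fun x : Space3 => (((x.2, x.1.1), x.1.2) : Space3)
    fun_prop
  · show Continuous fun x : Space3 => (((x.1.1, x.2), x.1.2) : Space3)
    fun_prop
  · exact continuous_id

theorem measurableEmbedding_slice (j : Fin 3) : MeasurableEmbedding (slice j) := by
  refine (continuous_slice j).measurableEmbedding ?_
  fin_cases j
  · rintro ⟨⟨a, b⟩, c⟩ ⟨⟨a', b'⟩, c'⟩ h
    simp only [slice, Prod.mk.injEq] at h ⊢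
    tauto
  · rintro ⟨⟨a, b⟩, c⟩ ⟨⟨a', b'⟩, c'⟩ h
    simp only [slice, Prod.mk.injEq] at h ⊢
    tauto
  · exact fun _ _ h => h

theorem slice_preimage_openBox (j : Fin 3) (lo hi : Fin 3 → ℝ) :
    slice j ⁻¹' openBox lo hi = boxFace j lo hi ×ˢ Set.Ioo (lo j) (hi j) := by
  ext ⟨⟨a, b⟩, c⟩
  fin_cases j <;> simp [slice, openBox, boxFace] <;> tauto

theorem hasDerivAt_slice (j : Fin 3) (y : ℝ × ℝ) (t : ℝ) :
    HasDerivAt (fun t => slice j (y, t)) (unitVec j) t := by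
  fin_cases j
  · exact ((hasDerivAt_id t).prodMk (hasDerivAt_const t y.1)).prodMk (hasDerivAt_const t y.2)
  · exact ((hasDerivAt_const t y.1).prodMk (hasDerivAt_id t)).prodMk (hasDerivAt_const t y.2)
  · exact (hasDerivAt_const t y).prodMk (hasDerivAt_id t)

theorem openBox_subset_compact (lo hi : Fin 3 → ℝ) :
    ∃ K : Set Space3, IsCompact K ∧ openBox lo hi ⊆ K :=
  ⟨(Set.Icc (lo 0) (hi 0) ×ˢ Set.Icc (lo 1) (hi 1)) ×ˢ Set.Icc (lo 2) (hi 2),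
    (isCompact_Icc.prod isCompact_Icc).prod isCompact_Icc,
    Set.prod_mono (Set.prod_mono Set.Ioo_subset_Icc_self Set.Ioo_subset_Icc_self)
      Set.Ioo_subset_Icc_self⟩

theorem boxFace_subset_compact (j : Fin 3) (lo hi : Fin 3 → ℝ) :
    ∃ K : Set (ℝ × ℝ), IsCompact K ∧ boxFace j lo hi ⊆ K := by
  have key : ∀ a b c d : ℝ, ∃ K : Set (ℝ × ℝ), IsCompact K ∧ Set.Ioo a b ×ˢ Set.Ioo c d ⊆ K :=
    fun a b c d => ⟨Set.Icc a b ×ˢ Set.Icc c d, isCompact_Icc.prod isCompact_Icc,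
      Set.prod_mono Set.Ioo_subset_Icc_self Set.Ioo_subset_Icc_self⟩
  fin_cases j <;> exact key _ _ _ _

theorem isOpen_openBox (lo hi : Fin 3 → ℝ) : IsOpen (openBox lo hi) :=
  (isOpen_Ioo.prod isOpen_Ioo).prod isOpen_Ioo

/-- A continuous function belongs to every `L^p` of a subset of a compact set. -/
theorem Continuous.memLp_restrict {X : Type*} [TopologicalSpace X] [MeasurableSpace X]
    [OpensMeasurableSpace X] {μ : Measure X}
    [IsFiniteMeasureOnCompacts μ] {H : X → ℂ} (hH : Continuous H) {s K : Set X} (hK : IsCompact K)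
    (hs : s ⊆ K) (p : ENNReal) : MemLp H p (μ.restrict s) := by
  have : IsFiniteMeasure (μ.restrict s) := by
    refine ⟨?_⟩
    rw [Measure.restrict_apply_univ]
    exact (measure_mono hs).trans_lt hK.measure_lt_top
  obtain ⟨C, hC⟩ := hK.exists_bound_of_continuousOn hH.continuousOn
  refine MemLp.of_bound hH.aestronglyMeasurable C ?_
  -- `s` need not be measurable; its measurable hull has the same restricted measure.
  refine ae_restrict_of_ae_restrict_of_subset (t := toMeasurable μ s) (subset_toMeasurable μ s) ?_
  rw [Measure.restrict_toMeasurable ((measure_mono hs).trans_lt hK.measure_lt_top).ne]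
  have h2 : (μ.restrict s) {x | ‖H x‖ ≤ C}ᶜ = 0 := by
    have hm : MeasurableSet {x | ‖H x‖ ≤ C} := (isClosed_le hH.norm continuous_const).measurableSet
    rw [Measure.restrict_apply hm.compl]
    have : {x | ‖H x‖ ≤ C}ᶜ ∩ s = ∅ := by
      ext x
      simp only [Set.mem_inter_iff, Set.mem_compl_iff, Set.mem_ofPred_eq, Set.mem_empty_iff_false,
        iff_false, not_and]
      exact fun h hx => h (hC x (hs hx))
    rw [this, measure_empty]
  exact h2

theorem Continuous.integrableOn_of_subset_compact {X : Type*} [TopologicalSpace X]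
    [MeasurableSpace X] [OpensMeasurableSpace X] {μ : Measure X}
    [IsFiniteMeasureOnCompacts μ] {H : X → ℂ} (hH : Continuous H) {s K : Set X} (hK : IsCompact K)
    (hs : s ⊆ K) : IntegrableOn H s μ :=
  memLp_one_iff_integrable.1 (hH.memLp_restrict hK hs 1)

theorem continuous_classicalGrad {w : Space3 → ℂ} (hw : ContDiff ℝ 1 w) (j : Fin 3) :
    Continuous (classicalGrad w j) :=
  (hw.continuous_fderiv one_ne_zero).clm_apply continuous_const

theorem integral_openBox_eq {lo hi : Fin 3 → ℝ} (j : Fin 3) {F : Space3 → ℂ} (hF : Continuous F) :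
    ∫ x in openBox lo hi, F x =
      ∫ y in boxFace j lo hi, ∫ t in Set.Ioo (lo j) (hi j), F (slice j (y, t)) := by
  obtain ⟨K, hK, hs⟩ := boxFace_subset_compact j lo hi
  rw [← (measurePreserving_slice j).setIntegral_preimage_emb (measurableEmbedding_slice j),
    slice_preimage_openBox]
  refine setIntegral_prod (fun z : Space3 => F (slice j z)) ?_
  exact (hF.comp (continuous_slice j)).integrableOn_of_subset_compact
    (hK.prod (isCompact_Icc (a := lo j) (b := hi j)))
    (Set.prod_mono hs Set.Ioo_subset_Icc_self)

/-- The fundamental theorem of calculus in the direction `e_j` on a box. -/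
theorem integral_openBox_classicalGrad {lo hi : Fin 3 → ℝ} (j : Fin 3) (hle : lo j ≤ hi j)
    {W : Space3 → ℂ} (hW : ContDiff ℝ 1 W) :
    ∫ x in openBox lo hi, classicalGrad W j x =
      ∫ y in boxFace j lo hi, (W (slice j (y, hi j)) - W (slice j (y, lo j))) := by
  have hc := continuous_classicalGrad hW j
  rw [integral_openBox_eq j hc]
  congr 1
  ext y
  rw [← integral_Ioc_eq_integral_Ioo, ← intervalIntegral.integral_of_le hle]
  refine intervalIntegral.integral_eq_sub_of_hasDerivAt (f := fun t => W (slice j (y, t)))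
    (fun t _ => ?_) ?_
  · exact ((hW.differentiable one_ne_zero).differentiableAt.hasFDerivAt).comp_hasDerivAt t
      (hasDerivAt_slice j y t)
  · exact (hc.comp ((continuous_slice j).comp (by fun_prop))).intervalIntegrable _ _

/-! ### Passing to the limit in integrals -/

theorem tendsto_integral_mul_of_tendsto_eLpNorm {X : Type*} [MeasurableSpace X] {μ : Measure X}
    {F : ℕ → X → ℂ} {f H : X → ℂ} (hF : ∀ k, AEStronglyMeasurable (F k) μ) (hf : MemLp f 2 μ)
    (hH : MemLp H 2 μ) (hlim : Tendsto (fun k => eLpNorm (fun x => F k x - f x) 2 μ) atTop (𝓝 0)) :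
    (∀ᶠ k in atTop, MemLp (F k) 2 μ) ∧
    Tendsto (fun k => ∫ x, F k x * H x ∂μ) atTop (𝓝 (∫ x, f x * H x ∂μ)) := by
  have hev : ∀ᶠ k in atTop, MemLp (F k) 2 μ := by
    filter_upwards [hlim.eventually_lt_const (u := 1) (by simp)] with k hk
    have : MemLp (fun x => F k x - f x) 2 μ :=
      ⟨(hF k).sub hf.1, hk.trans ENNReal.one_lt_top⟩
    have h2 := this.add hf
    rwa [show (fun x => F k x - f x) + f = F k by ext x; simp] at h2
  refine ⟨hev, tendsto_integral_of_L1' _ (hf.1.mul hH.1) ?_ ?_⟩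
  · filter_upwards [hev] with k hk using hk.integrable_mul hH
  · have hb : ∀ k, eLpNorm ((fun x => F k x * H x) - fun x => f x * H x) 1 μ ≤
        eLpNorm (fun x => F k x - f x) 2 μ * eLpNorm H 2 μ := by
      intro k
      have := eLpNorm_smul_le_mul_eLpNorm (p := 2) (q := 2) (r := 1) hH.1 ((hF k).sub hf.1)
      refine le_trans (le_of_eq ?_) this
      congr 1
      ext x
      simp [sub_mul]
    refine tendsto_of_tendsto_of_tendsto_of_le_of_le tendsto_const_nhds ?_ (fun _ => zero_le) hb
    simpa using ENNReal.Tendsto.mul_const hlim (Or.inr hH.2.ne)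

/-- An integration by parts formula which holds for all smooth functions holds for `u ∈ H¹(Ω)`,
with the boundary values replaced by the trace. -/
theorem HasTrace.integral_by_parts {Ω : Set Space3} {u : SobolevH1 Ω} {A : Set (ℝ × ℝ)}
    {p : ℝ × ℝ → Space3} {g : ℝ × ℝ → ℂ} (hu : HasTrace u A p g) (hp : Continuous p)
    {Q : Set Space3} (hQ : Q ⊆ Ω) {B : Set (ℝ × ℝ)} (hB : B ⊆ A) (j : Fin 3)
    {H K : Space3 → ℂ} {k : ℝ × ℝ → ℂ} (hH : MemLp H 2 (volume.restrict Q))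
    (hK : MemLp K 2 (volume.restrict Q)) (hk : MemLp k 2 (volume.restrict B))
    (hw : ∀ w : Space3 → ℂ, ContDiff ℝ ∞ w →
      (∫ x in Q, classicalGrad w j x * H x) + ∫ x in Q, w x * K x = ∫ y in B, w (p y) * k y) :
    (∫ x in Q, u.grad j x * H x) + ∫ x in Q, u.toFun x * K x = ∫ y in B, g y * k y := by
  obtain ⟨hg, w, hws, h0, h1, h2⟩ := hu
  have hle : (volume.restrict Q : Measure Space3) ≤ volume.restrict Ω :=
    Measure.restrict_mono hQ le_rfl
  have hleB : (volume.restrict B : Measure (ℝ × ℝ)) ≤ volume.restrict A :=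
    Measure.restrict_mono hB le_rfl
  have mono : ∀ {X : Type} [MeasurableSpace X] {μ ν : Measure X} {F : ℕ → X → ℂ}, μ ≤ ν →
      Tendsto (fun k => eLpNorm (F k) 2 ν) atTop (𝓝 0) →
      Tendsto (fun k => eLpNorm (F k) 2 μ) atTop (𝓝 0) := fun hμ h =>
    tendsto_of_tendsto_of_tendsto_of_le_of_le tendsto_const_nhds h (fun _ => zero_le)
      (fun k => eLpNorm_mono_measure _ hμ)
  have l1 := (tendsto_integral_mul_of_tendsto_eLpNorm (μ := volume.restrict Q)
    (F := fun k => classicalGrad (w k) j)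
    (fun k => (continuous_classicalGrad ((hws k).of_le (by simp)) j).aestronglyMeasurable)
    ((u.grad_memLp j).mono_measure hle) hH (mono hle (h1 j))).2
  have l2 := (tendsto_integral_mul_of_tendsto_eLpNorm (μ := volume.restrict Q) (F := w)
    (fun k => (hws k).continuous.aestronglyMeasurable) (u.memLp.mono_measure hle) hK
    (mono hle h0)).2
  have l3 := (tendsto_integral_mul_of_tendsto_eLpNorm (μ := volume.restrict B)
    (F := fun k y => w k (p y)) (fun k => ((hws k).continuous.comp hp).aestronglyMeasurable)
    (hg.mono_measure hleB) hk (mono hleB h2)).2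
  exact tendsto_nhds_unique ((l1.add l2).congr fun k => hw _ (hws k)) l3

namespace BiperiodicScattering

variable (P : BiperiodicScattering)

/-! ### The box above the scattering surface -/

/-- The highest level of the scattering surface. -/
noncomputable def fmax : ℝ := ⨆ r, P.f r

theorem continuous_f : Continuous P.f := P.f_lipschitz.choose_spec.continuous

theorem exists_f_eq (r : ℝ × ℝ) :
    ∃ r' ∈ Set.Icc 0 P.L₁ ×ˢ Set.Icc 0 P.L₂, P.f r = P.f r' := by
  have p1 : ∀ x₂, Function.Periodic (fun x₁ => P.f (x₁, x₂)) P.L₁ := fun x₂ x₁ =>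
    P.f_periodic₁ x₁ x₂
  have p2 : ∀ x₁, Function.Periodic (fun x₂ => P.f (x₁, x₂)) P.L₂ := fun x₁ x₂ =>
    P.f_periodic₂ x₁ x₂
  obtain ⟨y₁, hy₁, e₁⟩ := (p1 r.2).exists_mem_Ico₀ P.L₁_pos r.1
  obtain ⟨y₂, hy₂, e₂⟩ := (p2 y₁).exists_mem_Ico₀ P.L₂_pos r.2
  exact ⟨(y₁, y₂), Set.mk_mem_prod (Set.Ico_subset_Icc_self hy₁) (Set.Ico_subset_Icc_self hy₂),
    e₁.trans e₂⟩

theorem exists_f_max : ∃ r₀, ∀ r, P.f r ≤ P.f r₀ := by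
  obtain ⟨r₀, -, h₀⟩ := (isCompact_Icc.prod isCompact_Icc :
    IsCompact (Set.Icc 0 P.L₁ ×ˢ Set.Icc 0 P.L₂)).exists_isMaxOn
    ⟨(0, 0), by simp [P.L₁_pos.le, P.L₂_pos.le]⟩ P.continuous_f.continuousOn
  refine ⟨r₀, fun r => ?_⟩
  obtain ⟨r', hr', e⟩ := P.exists_f_eq r
  exact e.trans_le (h₀ hr')

theorem exists_f_lowerBound : ∃ m, ∀ r, m ≤ P.f r := by
  obtain ⟨m, hm⟩ := ((isCompact_Icc.prod isCompact_Icc :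
    IsCompact (Set.Icc 0 P.L₁ ×ˢ Set.Icc 0 P.L₂)).image P.continuous_f).bddBelow
  refine ⟨m, fun r => ?_⟩
  obtain ⟨r', hr', e⟩ := P.exists_f_eq r
  exact (hm (Set.mem_image_of_mem _ hr')).trans_eq e.symm

theorem f_le_fmax (r : ℝ × ℝ) : P.f r ≤ P.fmax := by
  obtain ⟨r₀, h₀⟩ := P.exists_f_max
  exact le_ciSup (f := P.f) ⟨P.f r₀, by rintro _ ⟨r, rfl⟩; exact h₀ r⟩ r

theorem fmax_lt_h : P.fmax < P.h := by
  obtain ⟨r₀, h₀⟩ := P.exists_f_max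
  exact (ciSup_le h₀).trans_lt (P.f_lt_h r₀)

/-- The lower corner of the part of the domain which lies above the level `fmax`. -/
noncomputable def lo : Fin 3 → ℝ := ![0, 0, P.fmax]

/-- The upper corner of the part of the domain which lies above the level `fmax`. -/
noncomputable def hi : Fin 3 → ℝ := ![P.L₁, P.L₂, P.h]

theorem lo_le_hi (j : Fin 3) : P.lo j ≤ P.hi j := by
  fin_cases j
  · exact P.L₁_pos.le
  · exact P.L₂_pos.le
  · exact P.fmax_lt_h.le

theorem mem_box {x : Space3} : x ∈ openBox P.lo P.hi ↔ x.1 ∈ P.cell ∧ P.fmax < x.2 ∧ x.2 < P.h := by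
  simp [openBox, lo, hi, cell]

theorem box_subset_domain : openBox P.lo P.hi ⊆ P.domain := fun x hx => by
  obtain ⟨h1, h2, h3⟩ := P.mem_box.1 hx
  exact ⟨h1, (P.f_le_fmax _).trans_lt h2, h3⟩

theorem isOpen_cell : IsOpen P.cell := isOpen_Ioo.prod isOpen_Ioo

theorem isOpen_domain : IsOpen P.domain := by
  have := P.continuous_f
  exact (P.isOpen_cell.preimage continuous_fst).inter
    ((isOpen_lt (by fun_prop) continuous_snd).inter (isOpen_lt continuous_snd continuous_const))

theorem domain_subset_compact : ∃ K : Set Space3, IsCompact K ∧ P.domain ⊆ K := by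
  obtain ⟨m, hm⟩ := P.exists_f_lowerBound
  refine ⟨(Set.Icc 0 P.L₁ ×ˢ Set.Icc 0 P.L₂) ×ˢ Set.Icc m P.h,
    (isCompact_Icc.prod isCompact_Icc).prod isCompact_Icc, ?_⟩
  rintro x ⟨h1, h2, h3⟩
  exact ⟨Set.prod_mono Set.Ioo_subset_Icc_self Set.Ioo_subset_Icc_self h1, (hm _).trans h2.le,
    h3.le⟩

theorem memLp_domain {H : Space3 → ℂ} (hH : Continuous H) : MemLp H 2 (volume.restrict P.domain) :=
  let ⟨_, hK, hs⟩ := P.domain_subset_compact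
  hH.memLp_restrict hK hs 2

theorem memLp_box {H : Space3 → ℂ} (hH : Continuous H) :
    MemLp H 2 (volume.restrict (openBox P.lo P.hi)) :=
  (P.memLp_domain hH).mono_measure (Measure.restrict_mono P.box_subset_domain le_rfl)

theorem integral_domain_eq_box {F : Space3 → ℂ} (hF : ∀ x, x.2 ≤ P.fmax → F x = 0) :
    ∫ x in P.domain, F x = ∫ x in openBox P.lo P.hi, F x := by
  refine setIntegral_eq_of_subset_of_forall_sdiff_eq_zero P.isOpen_domain.measurableSet
    P.box_subset_domain fun x hx => hF x ?_
  by_contra! h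
  exact hx.2 (P.mem_box.2 ⟨hx.1.1, h, hx.1.2.2⟩)

/-! ### Modes -/

/-- The function `g(x₃) exp(i αₙ · r)`. -/
noncomputable def mode (n : ℤ × ℤ) (g : ℝ → ℂ) (x : Space3) : ℂ := g x.2 * P.fourierMode n x.1

/-- The partial derivative `∂ⱼ` acting on the factor `g` of `g(x₃) exp(i αₙ · r)`. -/
noncomputable def modeDeriv (n : ℤ × ℤ) (j : Fin 3) (g : ℝ → ℂ) : ℝ → ℂ :=
  ![fun t => Complex.I * P.a₁ n * g t, fun t => Complex.I * P.a₂ n * g t, deriv g] j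

theorem contDiff_fourierMode (n : ℤ × ℤ) : ContDiff ℝ ∞ (P.fourierMode n) := by
  unfold fourierMode
  have h : ContDiff ℝ ∞ fun r : ℝ × ℝ => ((P.a₁ n * r.1 + P.a₂ n * r.2 : ℝ) : ℂ) :=
    Complex.ofRealCLM.contDiff.comp
      ((contDiff_const.mul contDiff_fst).add (contDiff_const.mul contDiff_snd))
  fun_prop

theorem contDiff_mode (n : ℤ × ℤ) {g : ℝ → ℂ} (hg : ContDiff ℝ ∞ g) :
    ContDiff ℝ ∞ (P.mode n g) :=
  (hg.comp contDiff_snd).mul ((P.contDiff_fourierMode n).comp contDiff_fst)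

theorem contDiff_modeDeriv (n : ℤ × ℤ) (j : Fin 3) {g : ℝ → ℂ} (hg : ContDiff ℝ ∞ g) :
    ContDiff ℝ ∞ (P.modeDeriv n j g) := by
  fin_cases j
  · exact contDiff_const.mul hg
  · exact contDiff_const.mul hg
  · exact (contDiff_infty_iff_deriv.1 hg).2

theorem modeDeriv_eq_zero (n : ℤ × ℤ) (j : Fin 3) {g : ℝ → ℂ} (hg : ContDiff ℝ ∞ g) {b : ℝ}
    (h0 : ∀ t ≤ b, g t = 0) : ∀ t ≤ b, P.modeDeriv n j g t = 0 := by
  intro t ht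
  fin_cases j
  · simp [modeDeriv, h0 t ht]
  · simp [modeDeriv, h0 t ht]
  · show deriv g t = 0
    have hd := (hg.differentiable (by simp)).differentiableAt (x := t)
    have h1 : derivWithin g (Set.Iic t) t = deriv g t :=
      hd.derivWithin (uniqueDiffOn_Iic t t Set.self_mem_Iic)
    have h2 : derivWithin g (Set.Iic t) t = derivWithin (fun _ => (0 : ℂ)) (Set.Iic t) t :=
      derivWithin_congr (fun y hy => h0 y (le_trans hy ht)) (h0 t ht)
    rw [← h1, h2]
    simp

theorem classicalGrad_eq_deriv {w : Space3 → ℂ} (hw : Differentiable ℝ w) (j : Fin 3) (y : ℝ × ℝ)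
    (t : ℝ) : classicalGrad w j (slice j (y, t)) = deriv (fun t => w (slice j (y, t))) t :=
  (((hw _).hasFDerivAt).comp_hasDerivAt t (hasDerivAt_slice j y t)).deriv.symm

theorem exp_I_mul_hasDerivAt (a c t : ℝ) :
    HasDerivAt (fun t : ℝ => Complex.exp (Complex.I * ((a * t + c : ℝ) : ℂ)))
      (Complex.I * a * Complex.exp (Complex.I * ((a * t + c : ℝ) : ℂ))) t := by
  have h : HasDerivAt (fun t : ℝ => a * t + c) a t := by
    simpa using ((hasDerivAt_id t).const_mul a).add_const c
  convert (h.ofReal_comp.const_mul Complex.I).cexp using 1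
  ring

theorem classicalGrad_mode (n : ℤ × ℤ) {g : ℝ → ℂ} (hg : ContDiff ℝ ∞ g) (j : Fin 3)
    (x : Space3) : classicalGrad (P.mode n g) j x = P.mode n (P.modeDeriv n j g) x := by
  have hw := (P.contDiff_mode n hg).differentiable (by simp)
  obtain ⟨⟨x₁, x₂⟩, x₃⟩ := x
  fin_cases j
  · refine (classicalGrad_eq_deriv hw 0 (x₂, x₃) x₁).trans (HasDerivAt.deriv ?_)
    show HasDerivAt (fun t => g x₃ * P.fourierMode n (t, x₂))
      (Complex.I * P.a₁ n * g x₃ * P.fourierMode n (x₁, x₂)) x₁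
    refine ((exp_I_mul_hasDerivAt (P.a₁ n) (P.a₂ n * x₂) x₁).const_mul (g x₃)).congr_deriv ?_
    simp only [fourierMode]
    ring
  · refine (classicalGrad_eq_deriv hw 1 (x₁, x₃) x₂).trans (HasDerivAt.deriv ?_)
    show HasDerivAt (fun t => g x₃ * P.fourierMode n (x₁, t))
      (Complex.I * P.a₂ n * g x₃ * P.fourierMode n (x₁, x₂)) x₂
    simp only [fourierMode, add_comm (P.a₁ n * x₁)]
    refine ((exp_I_mul_hasDerivAt (P.a₂ n) (P.a₁ n * x₁) x₂).const_mul (g x₃)).congr_deriv ?_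
    ring
  · refine (classicalGrad_eq_deriv hw 2 (x₁, x₂) x₃).trans (HasDerivAt.deriv ?_)
    show HasDerivAt (fun t => g t * P.fourierMode n (x₁, x₂))
      (deriv g x₃ * P.fourierMode n (x₁, x₂)) x₃
    exact ((hg.differentiable (by simp) x₃).hasDerivAt).mul_const _

theorem exp_two_pi_int (k : ℤ) {L : ℝ} (hL : L ≠ 0) (a : ℝ) (c : ℝ) :
    Complex.exp (Complex.I * (((a + 2 * Real.pi * k / L) * L + c : ℝ) : ℂ)) =
      Complex.exp (Complex.I * ((a * L : ℝ) : ℂ)) * Complex.exp (Complex.I * ((c : ℝ) : ℂ)) := by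
  rw [show Complex.I * (((a + 2 * Real.pi * k / L) * L + c : ℝ) : ℂ) =
    (Complex.I * ((a * L : ℝ) : ℂ) + Complex.I * (c : ℂ)) + k * (2 * Real.pi * Complex.I) by
      have : (L : ℂ) ≠ 0 := by exact_mod_cast hL
      push_cast
      field_simp
      ring, Complex.exp_periodic.int_mul k, Complex.exp_add]

theorem fourierMode_shift₁ (n : ℤ × ℤ) (x₂ : ℝ) : P.fourierMode n (P.L₁, x₂) =
    Complex.exp (Complex.I * ((P.alpha₁ * P.L₁ : ℝ) : ℂ)) * P.fourierMode n (0, x₂) := by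
  simp only [fourierMode, a₁, mul_zero, zero_add]
  exact exp_two_pi_int n.1 P.L₁_pos.ne' _ _

theorem fourierMode_shift₂ (n : ℤ × ℤ) (x₁ : ℝ) : P.fourierMode n (x₁, P.L₂) =
    Complex.exp (Complex.I * ((P.alpha₂ * P.L₂ : ℝ) : ℂ)) * P.fourierMode n (x₁, 0) := by
  simp only [fourierMode, a₂, mul_zero, add_zero]
  rw [add_comm]
  exact exp_two_pi_int n.2 P.L₂_pos.ne' _ _

end BiperiodicScattering

/-! ### Integration by parts in `H¹(Ω)` -/

/-- The `j`-th coordinate of a point of `ℝ³`. -/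
def coord (j : Fin 3) (x : Space3) : ℝ := ![x.1.1, x.1.2, x.2] j

theorem contDiff_coord (j : Fin 3) : ContDiff ℝ ∞ (coord j) := by
  fin_cases j
  · exact contDiff_fst.comp contDiff_fst
  · exact contDiff_snd.comp contDiff_fst
  · exact contDiff_snd

theorem coord_slice (j : Fin 3) (y : ℝ × ℝ) (t : ℝ) : coord j (slice j (y, t)) = t := by
  fin_cases j <;> rfl

theorem contDiff_infty_classicalGrad {w : Space3 → ℂ} (hw : ContDiff ℝ ∞ w) (j : Fin 3) :
    ContDiff ℝ ∞ (classicalGrad w j) :=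
  (hw.fderiv_right (m := ∞) (by simp)).clm_apply contDiff_const

theorem classicalGrad_mul {w G : Space3 → ℂ} (hw : Differentiable ℝ w) (hG : Differentiable ℝ G)
    (j : Fin 3) (x : Space3) : classicalGrad (fun x => w x * G x) j x =
      classicalGrad w j x * G x + w x * classicalGrad G j x := by
  unfold classicalGrad
  rw [fderiv_fun_mul (hw x) (hG x)]
  simp
  ring

theorem classicalGrad_conj (w : Space3 → ℂ) (j : Fin 3) (x : Space3) :
    classicalGrad (fun x => (starRingEnd ℂ) (w x)) j x = (starRingEnd ℂ) (classicalGrad w j x) := by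
  unfold classicalGrad
  have := Complex.conjCLE.comp_fderiv (f := w) (x := x)
  have h2 : (fun x => (starRingEnd ℂ) (w x)) = Complex.conjCLE ∘ w := rfl
  rw [h2, this]
  rfl

theorem contDiff_conj {E : Type*} [NormedAddCommGroup E] [NormedSpace ℝ E] {w : E → ℂ}
    (hw : ContDiff ℝ ∞ w) : ContDiff ℝ ∞ (fun x => (starRingEnd ℂ) (w x)) :=
  Complex.conjCLE.contDiff.comp hw

theorem Continuous.integrableOn_openBox {H : Space3 → ℂ} (hH : Continuous H) (lo hi : Fin 3 → ℝ) :
    IntegrableOn H (openBox lo hi) :=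
  let ⟨_, hK, hs⟩ := openBox_subset_compact lo hi
  hH.integrableOn_of_subset_compact hK hs

theorem Continuous.memLp_openBox {H : Space3 → ℂ} (hH : Continuous H) (lo hi : Fin 3 → ℝ) :
    MemLp H 2 (volume.restrict (openBox lo hi)) :=
  let ⟨_, hK, hs⟩ := openBox_subset_compact lo hi
  hH.memLp_restrict hK hs 2

theorem Continuous.memLp_boxFace {H : ℝ × ℝ → ℂ} (hH : Continuous H) (j : Fin 3)
    (lo hi : Fin 3 → ℝ) : MemLp H 2 (volume.restrict (boxFace j lo hi)) :=
  let ⟨_, hK, hs⟩ := boxFace_subset_compact j lo hi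
  hH.memLp_restrict hK hs 2

theorem integral_openBox_by_parts {lo hi : Fin 3 → ℝ} (j : Fin 3) (hle : lo j ≤ hi j)
    {w G : Space3 → ℂ} (hw : ContDiff ℝ ∞ w) (hG : ContDiff ℝ ∞ G) :
    (∫ x in openBox lo hi, classicalGrad w j x * G x) +
      ∫ x in openBox lo hi, w x * classicalGrad G j x =
      ∫ y in boxFace j lo hi, (w (slice j (y, hi j)) * G (slice j (y, hi j)) -
        w (slice j (y, lo j)) * G (slice j (y, lo j))) := by
  have hw' := (contDiff_infty_classicalGrad hw j).continuous
  have hG' := (contDiff_infty_classicalGrad hG j).continuous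
  rw [← integral_openBox_classicalGrad j hle ((hw.mul hG).of_le (by simp)), ← integral_add]
  · congr 1
    ext x
    exact (classicalGrad_mul (hw.differentiable (by simp)) (hG.differentiable (by simp)) j x).symm
  · exact (hw'.mul hG.continuous).integrableOn_openBox lo hi
  · exact (hw.continuous.mul hG').integrableOn_openBox lo hi

/-- Integration by parts in the direction `e_j` on a box in `Ω`, against a function which vanishes
on the lower face. -/
theorem HasTrace.integral_by_parts_hi {Ω : Set Space3} {u : SobolevH1 Ω} {A : Set (ℝ × ℝ)}
    {g : ℝ × ℝ → ℂ} {lo hi : Fin 3 → ℝ} {j : Fin 3}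
    (hu : HasTrace u A (fun y => slice j (y, hi j)) g)
    (hle : lo j ≤ hi j) (hQ : openBox lo hi ⊆ Ω) (hA : boxFace j lo hi ⊆ A) {G : Space3 → ℂ}
    (hG : ContDiff ℝ ∞ G) (h0 : ∀ y, G (slice j (y, lo j)) = 0) :
    (∫ x in openBox lo hi, u.grad j x * G x) +
      ∫ x in openBox lo hi, u.toFun x * classicalGrad G j x =
      ∫ y in boxFace j lo hi, g y * G (slice j (y, hi j)) := by
  have hs : Continuous fun y : ℝ × ℝ => slice j (y, hi j) := (continuous_slice j).comp (by fun_prop)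
  refine hu.integral_by_parts hs hQ hA j (hG.continuous.memLp_openBox lo hi)
    ((contDiff_infty_classicalGrad hG j).continuous.memLp_openBox lo hi)
    ((hG.continuous.comp hs).memLp_boxFace j lo hi) fun w hw => ?_
  rw [integral_openBox_by_parts j hle hw hG]
  simp [h0]

/-- Integration by parts in the direction `e_j` on a box in `Ω`, against a function which vanishes
on the upper face. -/
theorem HasTrace.integral_by_parts_lo {Ω : Set Space3} {u : SobolevH1 Ω} {A : Set (ℝ × ℝ)}
    {g : ℝ × ℝ → ℂ} {lo hi : Fin 3 → ℝ} {j : Fin 3}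
    (hu : HasTrace u A (fun y => slice j (y, lo j)) g)
    (hle : lo j ≤ hi j) (hQ : openBox lo hi ⊆ Ω) (hA : boxFace j lo hi ⊆ A) {G : Space3 → ℂ}
    (hG : ContDiff ℝ ∞ G) (h0 : ∀ y, G (slice j (y, hi j)) = 0) :
    (∫ x in openBox lo hi, u.grad j x * G x) +
      ∫ x in openBox lo hi, u.toFun x * classicalGrad G j x =
      ∫ y in boxFace j lo hi, g y * -G (slice j (y, lo j)) := by
  have hs : Continuous fun y : ℝ × ℝ => slice j (y, lo j) := (continuous_slice j).comp (by fun_prop)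
  refine hu.integral_by_parts hs hQ hA j (hG.continuous.memLp_openBox lo hi)
    ((contDiff_infty_classicalGrad hG j).continuous.memLp_openBox lo hi)
    ((hG.continuous.comp hs).neg.memLp_boxFace j lo hi) fun w hw => ?_
  rw [integral_openBox_by_parts j hle hw hG]
  simp [h0]

/-- If the traces of `u` on two opposite faces agree up to the factor `c`, then there is no boundary
term against functions whose values on the faces agree up to `c⁻¹`. -/
theorem integral_by_parts_quasiPeriodic {Ω : Set Space3} {u : SobolevH1 Ω} {A A' : Set (ℝ × ℝ)}
    {g : ℝ × ℝ → ℂ} {c : ℂ} {lo hi : Fin 3 → ℝ} {j : Fin 3}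
    (hu : HasTrace u A (fun y => slice j (y, lo j)) g)
    (hu' : HasTrace u A' (fun y => slice j (y, hi j)) (fun y => c * g y))
    (hlt : lo j < hi j) (hQ : openBox lo hi ⊆ Ω) (hA : boxFace j lo hi ⊆ A)
    (hA' : boxFace j lo hi ⊆ A') {G : Space3 → ℂ} (hG : ContDiff ℝ ∞ G)
    (hc : ∀ y, c * G (slice j (y, hi j)) = G (slice j (y, lo j))) :
    (∫ x in openBox lo hi, u.grad j x * G x) +
      ∫ x in openBox lo hi, u.toFun x * classicalGrad G j x = 0 := by
  -- The traces on the two faces may come from different approximating sequences, so `G` is split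
  -- into two parts, each of which vanishes on one of the faces.
  set ρ : Space3 → ℂ := fun x => (((coord j x - lo j) / (hi j - lo j) : ℝ) : ℂ) with hρ
  have hρs : ContDiff ℝ ∞ ρ :=
    Complex.ofRealCLM.contDiff.comp (((contDiff_coord j).sub contDiff_const).div_const _)
  have hd : hi j - lo j ≠ 0 := (sub_pos.2 hlt).ne'
  have hρhi : ∀ y, ρ (slice j (y, hi j)) = 1 := fun y => by
    simp only [hρ, coord_slice, div_self hd, Complex.ofReal_one]
  have hρlo : ∀ y, ρ (slice j (y, lo j)) = 0 := fun y => by simp [hρ, coord_slice]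
  have hG1 : ContDiff ℝ ∞ (fun x => ρ x * G x) := hρs.mul hG
  have hG0 : ContDiff ℝ ∞ (fun x => (1 - ρ x) * G x) := (contDiff_const.sub hρs).mul hG
  have e1 := hu'.integral_by_parts_hi hlt.le hQ hA' hG1 (fun y => by simp [hρlo])
  have e0 := hu.integral_by_parts_lo hlt.le hQ hA hG0 (fun y => by simp [hρhi])
  have hsum : G = fun x => ρ x * G x + (1 - ρ x) * G x := by ext x; ring
  have hgrad : ∀ x, classicalGrad G j x =
      classicalGrad (fun x => ρ x * G x) j x + classicalGrad (fun x => (1 - ρ x) * G x) j x := by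
    intro x
    conv_lhs => rw [hsum]
    unfold classicalGrad
    rw [fderiv_fun_add ((hG1.differentiable (by simp)) x) ((hG0.differentiable (by simp)) x)]
    rfl
  have hle : (volume.restrict (openBox lo hi) : Measure Space3) ≤ volume.restrict Ω :=
    Measure.restrict_mono hQ le_rfl
  have int1 : ∀ {H : Space3 → ℂ}, Continuous H →
      Integrable (fun x => u.grad j x * H x) (volume.restrict (openBox lo hi)) := fun hH =>
    ((u.grad_memLp j).mono_measure hle).integrable_mul (hH.memLp_openBox lo hi)
  have int0 : ∀ {H : Space3 → ℂ}, Continuous H →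
      Integrable (fun x => u.toFun x * H x) (volume.restrict (openBox lo hi)) := fun hH =>
    (u.memLp.mono_measure hle).integrable_mul (hH.memLp_openBox lo hi)
  have s1 : ∫ x in openBox lo hi, u.grad j x * G x =
      (∫ x in openBox lo hi, u.grad j x * (ρ x * G x)) +
        ∫ x in openBox lo hi, u.grad j x * ((1 - ρ x) * G x) := by
    rw [← integral_add (int1 hG1.continuous) (int1 hG0.continuous)]
    congr 1; ext x; ring
  have s0 : ∫ x in openBox lo hi, u.toFun x * classicalGrad G j x =
      (∫ x in openBox lo hi, u.toFun x * classicalGrad (fun x => ρ x * G x) j x) +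
        ∫ x in openBox lo hi, u.toFun x * classicalGrad (fun x => (1 - ρ x) * G x) j x := by
    rw [← integral_add (int0 (contDiff_infty_classicalGrad hG1 j).continuous)
      (int0 (contDiff_infty_classicalGrad hG0 j).continuous)]
    congr 1; ext x; rw [hgrad]; ring
  have sb : (∫ y in boxFace j lo hi, c * g y * (ρ (slice j (y, hi j)) * G (slice j (y, hi j)))) +
      ∫ y in boxFace j lo hi, g y * -((1 - ρ (slice j (y, lo j))) * G (slice j (y, lo j))) = 0 := by
    have : ∀ y, g y * -((1 - ρ (slice j (y, lo j))) * G (slice j (y, lo j))) =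
        -(c * g y * (ρ (slice j (y, hi j)) * G (slice j (y, hi j)))) := by
      intro y
      rw [hρlo, hρhi, ← hc]
      ring
    simp_rw [this]
    rw [integral_neg, add_neg_cancel]
  rw [s1, s0]
  linear_combination e1 + e0 + sb

namespace BiperiodicScattering

variable (P : BiperiodicScattering)

/-- The `L²(Ω)` product of `F` with `g(x₃) exp(i αₙ · r)`. -/
noncomputable def modePairing (F : Space3 → ℂ) (n : ℤ × ℤ) (g : ℝ → ℂ) : ℂ :=
  ∫ x in P.domain, F x * (starRingEnd ℂ) (P.mode n g x)

theorem modePairing_eq_box (F : Space3 → ℂ) (n : ℤ × ℤ) {g : ℝ → ℂ} (h0 : ∀ t ≤ P.fmax, g t = 0) :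
    P.modePairing F n g = ∫ x in openBox P.lo P.hi, F x * (starRingEnd ℂ) (P.mode n g x) :=
  P.integral_domain_eq_box fun x hx => by simp [mode, h0 _ hx]

theorem by_parts_eq_modePairing (u : SobolevH1 P.domain) (n : ℤ × ℤ) (j : Fin 3) {g : ℝ → ℂ}
    (hg : ContDiff ℝ ∞ g) (h0 : ∀ t ≤ P.fmax, g t = 0) :
    (∫ x in openBox P.lo P.hi, u.grad j x * (starRingEnd ℂ) (P.mode n g x)) +
      ∫ x in openBox P.lo P.hi, u.toFun x *
        classicalGrad (fun x => (starRingEnd ℂ) (P.mode n g x)) j x =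
      P.modePairing (u.grad j) n g + P.modePairing u.toFun n (P.modeDeriv n j g) := by
  rw [modePairing_eq_box P _ n h0, modePairing_eq_box P _ n (P.modeDeriv_eq_zero n j hg h0)]
  simp_rw [classicalGrad_conj, P.classicalGrad_mode n hg]

/-- Green's formula in the vertical direction. -/
theorem modePairing_grad_two_of_hasTrace {P : BiperiodicScattering} {u : SobolevH1 P.domain}
    {γ : ℝ × ℝ → ℂ} (hu : HasTrace u P.cell (fun r => (r, P.h)) γ) (n : ℤ × ℤ) {g : ℝ → ℂ}
    (hg : ContDiff ℝ ∞ g) (h0 : ∀ t ≤ P.fmax, g t = 0) :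
    P.modePairing (u.grad 2) n g + P.modePairing u.toFun n (deriv g) =
      (starRingEnd ℂ) (g P.h) * ∫ r in P.cell, γ r * (starRingEnd ℂ) (P.fourierMode n r) := by
  have hu' : HasTrace u P.cell (fun y => slice 2 (y, P.hi 2)) γ := hu
  have := hu'.integral_by_parts_hi (lo := P.lo) (P.lo_le_hi 2) P.box_subset_domain
    (le_refl _) (contDiff_conj (P.contDiff_mode n hg))
    (fun y => by
      have : P.mode n g (y, P.lo 2) = 0 := by simp [mode, h0 _ (le_refl P.fmax), lo]
      simp [slice, this])
  rw [P.by_parts_eq_modePairing u n 2 hg h0] at this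
  refine this.trans ?_
  rw [← integral_const_mul]
  show ∫ y in P.cell, _ = _
  congr 1
  ext y
  show γ y * (starRingEnd ℂ) (P.mode n g (y, P.h)) = _
  simp [mode]
  ring

theorem QuasiPeriodic.modePairing_grad_zero {P : BiperiodicScattering} {u : SobolevH1 P.domain}
    (hu : P.QuasiPeriodic u) (n : ℤ × ℤ) {g : ℝ → ℂ}
    (hg : ContDiff ℝ ∞ g) (h0 : ∀ t ≤ P.fmax, g t = 0) :
    P.modePairing (u.grad 0) n g + P.modePairing u.toFun n (P.modeDeriv n 0 g) = 0 := by
  obtain ⟨⟨γ, h1, h2⟩, -⟩ := hu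
  rw [← P.by_parts_eq_modePairing u n 0 hg h0]
  refine integral_by_parts_quasiPeriodic (j := 0) (lo := P.lo) (hi := P.hi) h1 h2 P.L₁_pos
    P.box_subset_domain ?_ ?_ (contDiff_conj (P.contDiff_mode n hg)) fun y => ?_
  · exact fun y hy => ⟨hy.1, (P.f_le_fmax _).trans_lt hy.2.1, hy.2.2⟩
  · exact fun y hy => ⟨hy.1, (P.f_le_fmax _).trans_lt hy.2.1, hy.2.2⟩
  · show _ * (starRingEnd ℂ) (g y.2 * P.fourierMode n (P.L₁, y.1)) =
      (starRingEnd ℂ) (g y.2 * P.fourierMode n (0, y.1))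
    rw [fourierMode_shift₁, map_mul, map_mul, map_mul, ← Complex.exp_conj]
    have : Complex.exp (Complex.I * ((P.alpha₁ * P.L₁ : ℝ) : ℂ)) *
        Complex.exp ((starRingEnd ℂ) (Complex.I * ((P.alpha₁ * P.L₁ : ℝ) : ℂ))) = 1 := by
      rw [← Complex.exp_add, map_mul, Complex.conj_I, Complex.conj_ofReal]
      simp
    linear_combination ((starRingEnd ℂ) (g y.2) * (starRingEnd ℂ) (P.fourierMode n (0, y.1))) * this

theorem QuasiPeriodic.modePairing_grad_one {P : BiperiodicScattering} {u : SobolevH1 P.domain}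
    (hu : P.QuasiPeriodic u) (n : ℤ × ℤ) {g : ℝ → ℂ}
    (hg : ContDiff ℝ ∞ g) (h0 : ∀ t ≤ P.fmax, g t = 0) :
    P.modePairing (u.grad 1) n g + P.modePairing u.toFun n (P.modeDeriv n 1 g) = 0 := by
  obtain ⟨-, γ, h1, h2⟩ := hu
  rw [← P.by_parts_eq_modePairing u n 1 hg h0]
  refine integral_by_parts_quasiPeriodic (j := 1) (lo := P.lo) (hi := P.hi) h1 h2 P.L₂_pos
    P.box_subset_domain ?_ ?_ (contDiff_conj (P.contDiff_mode n hg)) fun y => ?_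
  · exact fun y hy => ⟨hy.1, (P.f_le_fmax _).trans_lt hy.2.1, hy.2.2⟩
  · exact fun y hy => ⟨hy.1, (P.f_le_fmax _).trans_lt hy.2.1, hy.2.2⟩
  · show _ * (starRingEnd ℂ) (g y.2 * P.fourierMode n (y.1, P.L₂)) =
      (starRingEnd ℂ) (g y.2 * P.fourierMode n (y.1, 0))
    rw [fourierMode_shift₂, map_mul, map_mul, map_mul, ← Complex.exp_conj]
    have : Complex.exp (Complex.I * ((P.alpha₂ * P.L₂ : ℝ) : ℂ)) *
        Complex.exp ((starRingEnd ℂ) (Complex.I * ((P.alpha₂ * P.L₂ : ℝ) : ℂ))) = 1 := by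
      rw [← Complex.exp_add, map_mul, Complex.conj_I, Complex.conj_ofReal]
      simp
    linear_combination ((starRingEnd ℂ) (g y.2) * (starRingEnd ℂ) (P.fourierMode n (y.1, 0))) * this

end BiperiodicScattering

/-! ### Existence of the trace on `Γ_h` -/

theorem MeasureTheory.MemLp.eLpNorm_two_eq {X : Type*} [MeasurableSpace X] {μ : Measure X}
    {F : X → ℂ} (hF : MemLp F 2 μ) :
    eLpNorm F 2 μ = ENNReal.ofReal (Real.sqrt (∫ x, ‖F x‖ ^ 2 ∂μ)) := by
  rw [hF.eLpNorm_eq_integral_rpow_norm (by simp) (by simp), Real.sqrt_eq_rpow]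
  simp

theorem MeasureTheory.MemLp.integrable_norm_sq {X : Type*} [MeasurableSpace X] {μ : Measure X}
    {F : X → ℂ} (hF : MemLp F 2 μ) : Integrable (fun x => ‖F x‖ ^ 2) μ :=
  (memLp_two_iff_integrable_sq_norm hF.1).1 hF

namespace BiperiodicScattering

variable (P : BiperiodicScattering)

theorem memLp_cell {H : ℝ × ℝ → ℂ} (hH : Continuous H) : MemLp H 2 (volume.restrict P.cell) :=
  hH.memLp_boxFace 2 P.lo P.hi

theorem continuous_top : Continuous fun r : ℝ × ℝ => ((r, P.h) : Space3) := by fun_prop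

/-- The trace inequality for smooth functions, from the identity
`|w|² = ∂₃ (ρ |w|²)` integrated in `x₃`, with `ρ` linear from `0` at `fmax` to `1` at `h`. -/
theorem integral_top_sq_le {w : Space3 → ℂ} (hw : ContDiff ℝ ∞ w) :
    ∫ r in P.cell, ‖w (r, P.h)‖ ^ 2 ≤ (1 + (P.h - P.fmax)⁻¹) *
      ((∫ x in P.domain, ‖w x‖ ^ 2) + ∫ x in P.domain, ‖classicalGrad w 2 x‖ ^ 2) := by
  have hd : 0 < P.h - P.fmax := sub_pos.2 P.fmax_lt_h
  set d := P.h - P.fmax with hd_def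
  set ρ : Space3 → ℂ := fun x => (((x.2 - P.fmax) / d : ℝ) : ℂ) with hρ
  have hρs : ContDiff ℝ ∞ ρ :=
    Complex.ofRealCLM.contDiff.comp ((contDiff_snd.sub contDiff_const).div_const _)
  have hρ' : ∀ x, classicalGrad ρ 2 x = ((d⁻¹ : ℝ) : ℂ) := by
    rintro ⟨y, t⟩
    refine (classicalGrad_eq_deriv (hρs.differentiable (by simp)) 2 y t).trans (HasDerivAt.deriv ?_)
    have : HasDerivAt (fun t : ℝ => (t - P.fmax) / d) d⁻¹ t := by
      simpa using ((hasDerivAt_id t).sub_const P.fmax).div_const d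
    exact this.ofReal_comp
  have hcw := contDiff_conj hw
  have hG : ContDiff ℝ ∞ (fun x => ρ x * (starRingEnd ℂ) (w x)) := hρs.mul hcw
  have key := integral_openBox_by_parts (lo := P.lo) (hi := P.hi) 2 (P.lo_le_hi 2) hw hG
  have hb : (∫ y in boxFace 2 P.lo P.hi,
      (w (slice 2 (y, P.hi 2)) * (ρ (slice 2 (y, P.hi 2)) *
        (starRingEnd ℂ) (w (slice 2 (y, P.hi 2)))) -
        w (slice 2 (y, P.lo 2)) * (ρ (slice 2 (y, P.lo 2)) *
        (starRingEnd ℂ) (w (slice 2 (y, P.lo 2)))))) =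
      ((∫ r in P.cell, ‖w (r, P.h)‖ ^ 2 : ℝ) : ℂ) := by
    rw [← integral_complex_ofReal]
    show ∫ y in P.cell, _ = _
    congr 1
    ext y
    have e1 : ρ (y, P.hi 2) = 1 := by
      show (((P.h - P.fmax) / d : ℝ) : ℂ) = 1
      rw [← hd_def, div_self hd.ne']; simp
    have e0 : ρ (y, P.lo 2) = 0 := by
      show (((P.fmax - P.fmax) / d : ℝ) : ℂ) = 0
      simp
    simp only [slice]
    rw [e1, e0, zero_mul, mul_zero, sub_zero, one_mul, Complex.mul_conj, Complex.normSq_eq_norm_sq]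
    rfl
  have hw0 := P.memLp_box hw.continuous
  have hw1 := P.memLp_box (contDiff_infty_classicalGrad hw 2).continuous
  have hint : Integrable (fun x => ‖w x‖ ^ 2 + ‖classicalGrad w 2 x‖ ^ 2)
      (volume.restrict (openBox P.lo P.hi)) := hw0.integrable_norm_sq.add hw1.integrable_norm_sq
  have hI : ∀ {F : Space3 → ℂ}, MemLp F 2 (volume.restrict P.domain) →
      ∫ x in openBox P.lo P.hi, ‖F x‖ ^ 2 ≤ ∫ x in P.domain, ‖F x‖ ^ 2 := fun hF =>
    setIntegral_mono_set hF.integrable_norm_sq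
      (Eventually.of_forall fun x => by positivity) P.box_subset_domain.eventuallyLE
  have i1 : IntegrableOn (fun x => classicalGrad w 2 x * (ρ x * (starRingEnd ℂ) (w x)))
      (openBox P.lo P.hi) :=
    ((contDiff_infty_classicalGrad hw 2).continuous.mul hG.continuous).integrableOn_openBox _ _
  have i0 : IntegrableOn
      (fun x => w x * classicalGrad (fun x => ρ x * (starRingEnd ℂ) (w x)) 2 x)
      (openBox P.lo P.hi) :=
    (hw.continuous.mul (contDiff_infty_classicalGrad hG 2).continuous).integrableOn_openBox _ _
  rw [hb, ← integral_add i1 i0] at key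
  calc ∫ r in P.cell, ‖w (r, P.h)‖ ^ 2
      ≤ ‖((∫ r in P.cell, ‖w (r, P.h)‖ ^ 2 : ℝ) : ℂ)‖ := by
        rw [Complex.norm_real]; exact le_abs_self _
    _ ≤ ∫ x in openBox P.lo P.hi, (1 + d⁻¹) * (‖w x‖ ^ 2 + ‖classicalGrad w 2 x‖ ^ 2) := by
        rw [← key]
        refine norm_integral_le_of_norm_le (hint.const_mul _) ?_
        refine (ae_restrict_mem (isOpen_openBox _ _).measurableSet).mono fun x hx => ?_
        obtain ⟨-, h1, h2⟩ := P.mem_box.1 hx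
        rw [classicalGrad_mul (hρs.differentiable (by simp)) (hcw.differentiable (by simp)),
          classicalGrad_conj, hρ']
        have hρ1 : ‖ρ x‖ ≤ 1 := by
          rw [hρ, Complex.norm_real, Real.norm_eq_abs,
            abs_of_nonneg (div_nonneg (by linarith) hd.le), div_le_one hd]
          linarith
        set a := ‖w x‖
        set b := ‖classicalGrad w 2 x‖
        have ha : 0 ≤ a := norm_nonneg _
        have hb : 0 ≤ b := norm_nonneg _
        have hdi : 0 ≤ d⁻¹ := by positivity
        have n1 : ‖classicalGrad w 2 x * (ρ x * (starRingEnd ℂ) (w x))‖ ≤ b * a := by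
          rw [norm_mul, norm_mul, RCLike.norm_conj]
          have : ‖ρ x‖ * a ≤ 1 * a := by gcongr
          calc b * (‖ρ x‖ * a) ≤ b * (1 * a) := by gcongr
            _ = b * a := by ring
        have n2 : ‖w x * (((d⁻¹ : ℝ) : ℂ) * (starRingEnd ℂ) (w x) +
            ρ x * (starRingEnd ℂ) (classicalGrad w 2 x))‖ ≤ a * (d⁻¹ * a + b) := by
          rw [norm_mul]
          gcongr
          refine (norm_add_le _ _).trans ?_
          rw [norm_mul, norm_mul, RCLike.norm_conj, RCLike.norm_conj, Complex.norm_real,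
            Real.norm_eq_abs, abs_of_nonneg hdi]
          have : ‖ρ x‖ * b ≤ 1 * b := by gcongr
          linarith
        refine (norm_add_le _ _).trans ((add_le_add n1 n2).trans ?_)
        nlinarith [sq_nonneg (a - b), mul_nonneg hdi (sq_nonneg b)]
    _ = (1 + d⁻¹) * ((∫ x in openBox P.lo P.hi, ‖w x‖ ^ 2) +
          ∫ x in openBox P.lo P.hi, ‖classicalGrad w 2 x‖ ^ 2) := by
        rw [integral_const_mul, integral_add hw0.integrable_norm_sq hw1.integrable_norm_sq]
    _ ≤ _ := by
        have := hI (P.memLp_domain hw.continuous)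
        have := hI (P.memLp_domain (contDiff_infty_classicalGrad hw 2).continuous)
        gcongr

theorem exists_eLpNorm_top_le : ∃ C : NNReal, ∀ w : Space3 → ℂ, ContDiff ℝ ∞ w →
    eLpNorm (fun r => w (r, P.h)) 2 (volume.restrict P.cell) ≤
      C * (eLpNorm w 2 (volume.restrict P.domain) +
        eLpNorm (classicalGrad w 2) 2 (volume.restrict P.domain)) := by
  have hd : 0 < P.h - P.fmax := sub_pos.2 P.fmax_lt_h
  have hC : 0 ≤ 1 + (P.h - P.fmax)⁻¹ := by positivity
  refine ⟨Real.toNNReal (Real.sqrt (1 + (P.h - P.fmax)⁻¹)), fun w hw => ?_⟩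
  have ht : MemLp (fun r => w (r, P.h)) 2 (volume.restrict P.cell) :=
    P.memLp_cell (hw.continuous.comp P.continuous_top)
  rw [ht.eLpNorm_two_eq, (P.memLp_domain hw.continuous).eLpNorm_two_eq,
    (P.memLp_domain (contDiff_infty_classicalGrad hw 2).continuous).eLpNorm_two_eq,
    ← ENNReal.ofReal_add (Real.sqrt_nonneg _) (Real.sqrt_nonneg _)]
  change _ ≤ ENNReal.ofReal _ * _
  rw [← ENNReal.ofReal_mul (Real.sqrt_nonneg _)]
  refine ENNReal.ofReal_le_ofReal ?_
  refine (Real.sqrt_le_sqrt (P.integral_top_sq_le hw)).trans ?_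
  rw [Real.sqrt_mul hC]
  gcongr
  have h0 : 0 ≤ ∫ x in P.domain, ‖w x‖ ^ 2 := integral_nonneg fun x => by positivity
  have h1 : 0 ≤ ∫ x in P.domain, ‖classicalGrad w 2 x‖ ^ 2 := integral_nonneg fun x => by positivity
  refine Real.sqrt_le_iff.2 ⟨by positivity, ?_⟩
  nlinarith [Real.sq_sqrt h0, Real.sq_sqrt h1, Real.sqrt_nonneg (∫ x in P.domain, ‖w x‖ ^ 2),
    Real.sqrt_nonneg (∫ x in P.domain, ‖classicalGrad w 2 x‖ ^ 2),
    mul_nonneg (Real.sqrt_nonneg (∫ x in P.domain, ‖w x‖ ^ 2))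
      (Real.sqrt_nonneg (∫ x in P.domain, ‖classicalGrad w 2 x‖ ^ 2))]

/-- A function that is a limit of smooth functions in `H¹(Ω)` has a trace on `Γ_h`. -/
theorem exists_hasTrace_top {u : SobolevH1 P.domain} {A : Set (ℝ × ℝ)} {p : ℝ × ℝ → Space3}
    {g : ℝ × ℝ → ℂ} (hu : HasTrace u A p g) :
    ∃ γ, HasTrace u P.cell (fun r => (r, P.h)) γ := by
  obtain ⟨-, w, hw, h0, h1, -⟩ := hu
  obtain ⟨C, hC⟩ := P.exists_eLpNorm_top_le
  set e : ℕ → ENNReal := fun k =>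
    eLpNorm (fun x => w k x - u.toFun x) 2 (volume.restrict P.domain) +
    eLpNorm (fun x => classicalGrad (w k) 2 x - u.grad 2 x) 2 (volume.restrict P.domain) with he
  have hlim : Tendsto (fun k => (C : ENNReal) * (e k + e k)) atTop (𝓝 0) := by
    have h2 : Tendsto e atTop (𝓝 0) := by simpa using h0.add (h1 2)
    have h3 : Tendsto (fun k => e k + e k) atTop (𝓝 0) := by simpa using h2.add h2
    simpa using ENNReal.Tendsto.const_mul (a := C) h3 (Or.inr ENNReal.coe_ne_top)
  have hm : ∀ k, MemLp (fun r => w k (r, P.h)) 2 (volume.restrict P.cell) := fun k =>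
    P.memLp_cell ((hw k).continuous.comp P.continuous_top)
  have tri : ∀ {F G H : Space3 → ℂ}, AEStronglyMeasurable F (volume.restrict P.domain) →
      AEStronglyMeasurable G (volume.restrict P.domain) →
      AEStronglyMeasurable H (volume.restrict P.domain) →
      eLpNorm (fun x => F x - G x) 2 (volume.restrict P.domain) ≤
        eLpNorm (fun x => F x - H x) 2 (volume.restrict P.domain) +
        eLpNorm (fun x => G x - H x) 2 (volume.restrict P.domain) := by
    intro F G H hF hG hH
    have := eLpNorm_sub_le (p := 2) (hF.sub hH) (hG.sub hH) (by norm_num)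
    refine le_trans (le_of_eq ?_) this
    congr 1
    ext x
    simp
  have hbound : ∀ k l, eLpNorm ((fun r => w k (r, P.h)) - fun r => w l (r, P.h)) 2
      (volume.restrict P.cell) ≤ C * (e k + e l) := by
    intro k l
    refine (hC (fun x => w k x - w l x) ((hw k).sub (hw l))).trans (mul_le_mul' le_rfl ?_)
    have hgr : classicalGrad (fun x => w k x - w l x) 2 =
        fun x => classicalGrad (w k) 2 x - classicalGrad (w l) 2 x := by
      ext x
      unfold classicalGrad
      rw [fderiv_fun_sub ((hw k).differentiable (by simp) x) ((hw l).differentiable (by simp) x)]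
      rfl
    rw [hgr]
    have t0 := tri (hw k).continuous.aestronglyMeasurable (hw l).continuous.aestronglyMeasurable
      u.memLp.1
    have t1 := tri (contDiff_infty_classicalGrad (hw k) 2).continuous.aestronglyMeasurable
      (contDiff_infty_classicalGrad (hw l) 2).continuous.aestronglyMeasurable (u.grad_memLp 2).1
    refine (add_le_add t0 t1).trans (le_of_eq ?_)
    simp only [he]
    ring
  have hcau : CauchySeq fun k => (hm k).toLp := by
    refine EMetric.cauchySeq_iff.2 fun ε hε => ?_
    have hlim' : Tendsto (fun k => (C : ENNReal) * e k) atTop (𝓝 0) :=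
      tendsto_of_tendsto_of_tendsto_of_le_of_le tendsto_const_nhds hlim (fun _ => zero_le)
        fun k => by gcongr; exact le_self_add
    obtain ⟨N, hN⟩ := eventually_atTop.1 (hlim'.eventually_lt_const (ENNReal.half_pos hε.ne'))
    refine ⟨N, fun m hm' n hn' => ?_⟩
    rw [Lp.edist_toLp_toLp]
    refine (hbound m n).trans_lt ?_
    rw [mul_add, ← ENNReal.add_halves ε]
    exact ENNReal.add_lt_add (hN m hm') (hN n hn')
  obtain ⟨γ, hγ⟩ := cauchySeq_tendsto_of_complete hcau
  refine ⟨γ, Lp.memLp γ, w, hw, h0, h1, ?_⟩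
  have := (Lp.tendsto_Lp_iff_tendsto_eLpNorm' _ _).1 hγ
  refine this.congr fun k => eLpNorm_congr_ae ?_
  filter_upwards [(hm k).coeFn_toLp] with r hr
  simp [hr]

/-- The chosen trace `topTrace` is a trace, not the junk value taken where there is none. -/
theorem hasTrace_topTrace {u : Fin 3 → SobolevH1 P.domain} (hu : P.MemHqp u) (i : Fin 3) :
    HasTrace (u i) P.cell (fun r => (r, P.h)) (P.topTrace u i) := by
  obtain ⟨⟨g, hg, -⟩, -⟩ := hu i
  have h := P.exists_hasTrace_top hg
  unfold topTrace traceOn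
  rw [dif_pos h]
  exact h.choose_spec

end BiperiodicScattering

/-! ### Bessel's inequality -/

/-- Bessel's inequality for an orthogonal family of vectors which are bounded but not normalised. -/
theorem sum_norm_inner_sq_le {E ι : Type*} [SeminormedAddCommGroup E] [InnerProductSpace ℂ E]
    (x : E) (v : ι → E) (s : Finset ι) {B : ℝ} (hB : 0 ≤ B) (hv : ∀ i ∈ s, ‖v i‖ ^ 2 ≤ B)
    (ho : ∀ i ∈ s, ∀ k ∈ s, i ≠ k → inner ℂ (v i) (v k) = 0) :
    ∑ i ∈ s, ‖inner ℂ (v i) x‖ ^ 2 ≤ B * ‖x‖ ^ 2 := by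
  set S := ∑ i ∈ s, ‖inner ℂ (v i) x‖ ^ 2 with hS
  set y := ∑ i ∈ s, inner ℂ (v i) x • v i with hy
  have hS0 : 0 ≤ S := Finset.sum_nonneg fun i _ => by positivity
  have h1 : inner ℂ y x = (S : ℂ) := by
    rw [hy, sum_inner, hS]
    push_cast
    refine Finset.sum_congr rfl fun i _ => ?_
    rw [inner_smul_left, mul_comm, Complex.mul_conj, Complex.normSq_eq_norm_sq]
    simp
  have h2 : ‖y‖ ^ 2 ≤ B * S := by
    have h3 : inner ℂ y y = ((∑ i ∈ s, ‖inner ℂ (v i) x‖ ^ 2 * ‖v i‖ ^ 2 : ℝ) : ℂ) := by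
      conv_lhs => rw [hy, sum_inner]
      push_cast
      refine Finset.sum_congr rfl fun i hi => ?_
      rw [inner_smul_left, inner_sum, Finset.sum_eq_single i]
      · rw [inner_smul_right, ← mul_assoc, mul_comm ((starRingEnd ℂ) _), Complex.mul_conj,
          Complex.normSq_eq_norm_sq, inner_self_eq_norm_sq_to_K]
        simp
      · intro k hk hki
        rw [inner_smul_right, ho i hi k hk hki.symm, mul_zero]
      · exact fun h => absurd hi h
    have h4 : ‖y‖ ^ 2 = ∑ i ∈ s, ‖inner ℂ (v i) x‖ ^ 2 * ‖v i‖ ^ 2 := by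
      rw [← inner_self_eq_norm_sq (𝕜 := ℂ), h3]
      exact Complex.ofReal_re _
    rw [h4, hS, Finset.mul_sum]
    refine Finset.sum_le_sum fun i hi => ?_
    rw [mul_comm B]
    gcongr
    exact hv i hi
  have h5 : S ≤ ‖y‖ * ‖x‖ := by
    have := norm_inner_le_norm (𝕜 := ℂ) y x
    rwa [h1, Complex.norm_real, Real.norm_eq_abs, abs_of_nonneg hS0] at this
  rcases hS0.eq_or_lt with h | h
  · rw [← h]
    positivity
  · have h6 : S ^ 2 ≤ B * S * ‖x‖ ^ 2 := by
      calc S ^ 2 ≤ (‖y‖ * ‖x‖) ^ 2 := by gcongr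
        _ = ‖y‖ ^ 2 * ‖x‖ ^ 2 := by ring
        _ ≤ _ := by gcongr
    nlinarith

theorem sum_norm_integral_mul_conj_sq_le {X ι : Type*} [MeasurableSpace X] {μ : Measure X}
    {F : X → ℂ} (hF : MemLp F 2 μ) {G : ι → X → ℂ} (hG : ∀ i, MemLp (G i) 2 μ) (s : Finset ι)
    {B : ℝ} (hB : 0 ≤ B) (hGB : ∀ i ∈ s, ∫ x, ‖G i x‖ ^ 2 ∂μ ≤ B)
    (ho : ∀ i ∈ s, ∀ k ∈ s, i ≠ k → ∫ x, G k x * (starRingEnd ℂ) (G i x) ∂μ = 0) :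
    ∑ i ∈ s, ‖∫ x, F x * (starRingEnd ℂ) (G i x) ∂μ‖ ^ 2 ≤ B * ∫ x, ‖F x‖ ^ 2 ∂μ := by
  have hin : ∀ {f g : X → ℂ} (hf : MemLp f 2 μ) (hg : MemLp g 2 μ),
      inner ℂ (hg.toLp g) (hf.toLp f) = ∫ x, f x * (starRingEnd ℂ) (g x) ∂μ := by
    intro f g hf hg
    rw [L2.inner_def]
    refine integral_congr_ae ?_
    filter_upwards [hf.coeFn_toLp, hg.coeFn_toLp] with x h1 h2
    rw [h1, h2, RCLike.inner_apply]
  have hn : ∀ {f : X → ℂ} (hf : MemLp f 2 μ), ‖hf.toLp f‖ ^ 2 = ∫ x, ‖f x‖ ^ 2 ∂μ := by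
    intro f hf
    rw [Lp.norm_toLp, hf.eLpNorm_two_eq, ENNReal.toReal_ofReal (Real.sqrt_nonneg _),
      Real.sq_sqrt (integral_nonneg fun x => by positivity)]
  have := sum_norm_inner_sq_le (hF.toLp F) (fun i => (hG i).toLp (G i)) s hB
    (fun i hi => by rw [hn]; exact hGB i hi)
    (fun i hi k hk hik => by rw [hin]; exact ho i hi k hk hik)
  simpa only [hin, hn] using this

theorem integral_Ioo_exp_eq_zero {L : ℝ} (hL : 0 < L) {k : ℤ} (hk : k ≠ 0) :
    ∫ t in Set.Ioo 0 L, Complex.exp (Complex.I * ((2 * Real.pi * k / L : ℝ) : ℂ) * t) = 0 := by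
  have hL' : (L : ℂ) ≠ 0 := by exact_mod_cast hL.ne'
  rw [← integral_Ioc_eq_integral_Ioo, ← intervalIntegral.integral_of_le hL.le,
    integral_exp_mul_complex]
  · have : Complex.I * ((2 * Real.pi * k / L : ℝ) : ℂ) * L = k * (2 * Real.pi * Complex.I) := by
      push_cast
      field_simp
    rw [this, Complex.exp_int_mul_two_pi_mul_I]
    simp
  · have hk' : (k : ℝ) ≠ 0 := by exact_mod_cast hk
    exact mul_ne_zero Complex.I_ne_zero
      (Complex.ofReal_ne_zero.2 (div_ne_zero (mul_ne_zero (by positivity) hk') hL.ne'))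

namespace BiperiodicScattering

variable (P : BiperiodicScattering)

/-! ### Orthogonality of the modes -/

theorem integral_fourierMode_mul_conj (m n : ℤ × ℤ) :
    ∫ r in P.cell, P.fourierMode m r * (starRingEnd ℂ) (P.fourierMode n r) =
      if m = n then ((P.L₁ * P.L₂ : ℝ) : ℂ) else 0 := by
  have h1 := P.L₁_pos
  have h2 := P.L₂_pos
  have hprod : ∀ r : ℝ × ℝ, P.fourierMode m r * (starRingEnd ℂ) (P.fourierMode n r) =
      Complex.exp (Complex.I * ((2 * Real.pi * (m.1 - n.1 : ℤ) / P.L₁ : ℝ) : ℂ) * r.1) *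
      Complex.exp (Complex.I * ((2 * Real.pi * (m.2 - n.2 : ℤ) / P.L₂ : ℝ) : ℂ) * r.2) := by
    intro r
    simp only [fourierMode]
    rw [← Complex.exp_conj, ← Complex.exp_add, ← Complex.exp_add, map_mul, Complex.conj_I,
      Complex.conj_ofReal]
    congr 1
    simp only [a₁, a₂]
    push_cast
    ring
  simp_rw [hprod]
  show ∫ z in Set.Ioo 0 P.L₁ ×ˢ Set.Ioo 0 P.L₂, _ = _
  rw [Measure.volume_eq_prod, setIntegral_prod_mul
    (fun t : ℝ => Complex.exp (Complex.I * ((2 * Real.pi * (m.1 - n.1 : ℤ) / P.L₁ : ℝ) : ℂ) * t))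
    (fun t : ℝ => Complex.exp (Complex.I * ((2 * Real.pi * (m.2 - n.2 : ℤ) / P.L₂ : ℝ) : ℂ) * t))]
  by_cases e1 : m.1 = n.1
  · by_cases e2 : m.2 = n.2
    · rw [if_pos (Prod.ext e1 e2)]
      simp [e1, e2, h1.le, h2.le]
    · rw [if_neg fun h => e2 (congrArg Prod.snd h), integral_Ioo_exp_eq_zero h2 (sub_ne_zero.2 e2),
        mul_zero]
  · rw [if_neg fun h => e1 (congrArg Prod.fst h), integral_Ioo_exp_eq_zero h1 (sub_ne_zero.2 e1),
      zero_mul]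

theorem integral_mode_mul_conj (m n : ℤ × ℤ) {g g' : ℝ → ℂ} (h0 : ∀ t ≤ P.fmax, g t = 0) :
    ∫ x in P.domain, P.mode m g x * (starRingEnd ℂ) (P.mode n g' x) =
      if m = n then ((P.L₁ * P.L₂ : ℝ) : ℂ) *
        ∫ t in Set.Ioo P.fmax P.h, g t * (starRingEnd ℂ) (g' t) else 0 := by
  rw [P.integral_domain_eq_box fun x hx => by simp [mode, h0 _ hx]]
  have e : ∀ x : Space3, P.mode m g x * (starRingEnd ℂ) (P.mode n g' x) =
      (P.fourierMode m x.1 * (starRingEnd ℂ) (P.fourierMode n x.1)) *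
        (g x.2 * (starRingEnd ℂ) (g' x.2)) := by
    intro x
    simp only [mode, map_mul]
    ring
  simp_rw [e]
  show ∫ z in P.cell ×ˢ Set.Ioo P.fmax P.h, _ = _
  rw [Measure.volume_eq_prod, setIntegral_prod_mul
    (fun r => P.fourierMode m r * (starRingEnd ℂ) (P.fourierMode n r))
    (fun t => g t * (starRingEnd ℂ) (g' t)), integral_fourierMode_mul_conj]
  split_ifs <;> simp

theorem integral_norm_mode_sq (n : ℤ × ℤ) {g : ℝ → ℂ} (h0 : ∀ t ≤ P.fmax, g t = 0) :
    ∫ x in P.domain, ‖P.mode n g x‖ ^ 2 =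
      P.L₁ * P.L₂ * ∫ t in Set.Ioo P.fmax P.h, ‖g t‖ ^ 2 := by
  have h := P.integral_mode_mul_conj n n (g' := g) h0
  rw [if_pos rfl] at h
  simp_rw [Complex.mul_conj, Complex.normSq_eq_norm_sq] at h
  rw [integral_complex_ofReal, integral_complex_ofReal] at h
  exact_mod_cast h

/-- Bessel's inequality for the orthogonal functions `gₙ(x₃) exp(i αₙ · r)`. -/
theorem sum_norm_modePairing_sq_le {F : Space3 → ℂ} (hF : MemLp F 2 (volume.restrict P.domain))
    {g : ℤ × ℤ → ℝ → ℂ} (hg : ∀ n, Continuous (g n)) (h0 : ∀ n, ∀ t ≤ P.fmax, g n t = 0)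
    {B : ℝ} (hB : 0 ≤ B) (s : Finset (ℤ × ℤ))
    (hgB : ∀ n ∈ s, ∫ t in Set.Ioo P.fmax P.h, ‖g n t‖ ^ 2 ≤ B) :
    ∑ n ∈ s, ‖P.modePairing F n (g n)‖ ^ 2 ≤
      P.L₁ * P.L₂ * B * ∫ x in P.domain, ‖F x‖ ^ 2 := by
  have hV : 0 < P.L₁ * P.L₂ := mul_pos P.L₁_pos P.L₂_pos
  refine sum_norm_integral_mul_conj_sq_le hF (G := fun n => P.mode n (g n)) (fun n => ?_) s
    (by positivity) (fun n hn => ?_) fun n _ m _ hnm => ?_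
  · exact P.memLp_domain (((hg n).comp continuous_snd).mul
      ((P.contDiff_fourierMode n).continuous.comp continuous_fst))
  · rw [P.integral_norm_mode_sq n (h0 n)]
    have := hgB n hn
    gcongr
  · rw [P.integral_mode_mul_conj m n (h0 m), if_neg hnm.symm]

/-! ### Smooth elements of the Sobolev space -/

/-- A smooth function on `ℝ³` as an element of `H¹(Ω)`. -/
noncomputable def ofSmooth (w : Space3 → ℂ) (hw : ContDiff ℝ ∞ w) : SobolevH1 P.domain where
  toFun := w
  grad := classicalGrad w
  memLp := P.memLp_domain hw.continuous
  grad_memLp j := P.memLp_domain (contDiff_infty_classicalGrad hw j).continuous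
  weak_grad φ hφ hc hs j := by
    have hφ0 : ∀ x ∉ P.domain, φ x = 0 := fun x hx =>
      image_eq_zero_of_notMem_tsupport fun h => hx (hs h)
    have hφ1 : ∀ x ∉ P.domain, classicalGrad φ j x = 0 := fun x hx => by
      have : fderiv ℝ φ x = 0 := by
        by_contra h
        exact hx (hs (support_fderiv_subset ℝ h))
      simp [classicalGrad, this]
    rw [setIntegral_eq_integral_of_forall_compl_eq_zero fun x hx => by rw [hφ1 x hx, mul_zero],
      setIntegral_eq_integral_of_forall_compl_eq_zero fun x hx => by rw [hφ0 x hx, mul_zero]]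
    have hcφ' : HasCompactSupport (classicalGrad φ j) := hc.fderiv_apply ℝ (unitVec j)
    have c1 := (contDiff_infty_classicalGrad hw j).continuous
    have c2 := (contDiff_infty_classicalGrad hφ j).continuous
    have : (volume : Measure (ℝ × ℝ)).IsAddHaarMeasure :=
      inferInstanceAs ((volume : Measure ℝ).prod volume).IsAddHaarMeasure
    have : (volume : Measure Space3).IsAddHaarMeasure :=
      inferInstanceAs ((volume : Measure (ℝ × ℝ)).prod volume).IsAddHaarMeasure
    exact integral_mul_fderiv_eq_neg_fderiv_mul_of_integrable
      ((c1.mul hφ.continuous).integrable_of_hasCompactSupport hc.mul_left)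
      ((hw.continuous.mul c2).integrable_of_hasCompactSupport hcφ'.mul_left)
      ((hw.continuous.mul hφ.continuous).integrable_of_hasCompactSupport hc.mul_left)
      (fun x _ => hw.differentiable (by simp) x) (fun x _ => hφ.differentiable (by simp) x)

theorem hasTrace_ofSmooth {w : Space3 → ℂ} (hw : ContDiff ℝ ∞ w) {A K : Set (ℝ × ℝ)}
    (hK : IsCompact K) (hA : A ⊆ K) {p : ℝ × ℝ → Space3} (hp : Continuous p) :
    HasTrace (P.ofSmooth w hw) A p (fun y => w (p y)) := by
  refine ⟨(hw.continuous.comp hp).memLp_restrict hK hA 2, fun _ => w, fun _ => hw, ?_⟩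
  simp [ofSmooth]

theorem quasiPeriodic_ofSmooth_mode (n : ℤ × ℤ) {g : ℝ → ℂ} (hg : ContDiff ℝ ∞ g) :
    P.QuasiPeriodic (P.ofSmooth (P.mode n g) (P.contDiff_mode n hg)) := by
  obtain ⟨m, hm⟩ := P.exists_f_lowerBound
  have hw := P.contDiff_mode n hg
  have face : ∀ (L : ℝ) (q : ℝ → ℝ × ℝ), ∃ K : Set (ℝ × ℝ), IsCompact K ∧
      {y : ℝ × ℝ | y.1 ∈ Set.Ioo 0 L ∧ P.f (q y.1) < y.2 ∧ y.2 < P.h} ⊆ K := fun L q =>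
    ⟨Set.Icc 0 L ×ˢ Set.Icc m P.h, isCompact_Icc.prod isCompact_Icc, fun y hy =>
      ⟨Set.Ioo_subset_Icc_self hy.1, (hm _).trans hy.2.1.le, hy.2.2.le⟩⟩
  refine ⟨⟨fun y => P.mode n g ((0, y.1), y.2), ?_, ?_⟩,
    ⟨fun y => P.mode n g ((y.1, 0), y.2), ?_, ?_⟩⟩
  · obtain ⟨K, hK, hs⟩ := face P.L₂ fun t => (0, t)
    exact P.hasTrace_ofSmooth hw hK hs (by fun_prop)
  · obtain ⟨K, hK, hs⟩ := face P.L₂ fun t => (P.L₁, t)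
    convert P.hasTrace_ofSmooth hw hK hs (p := fun y => ((P.L₁, y.1), y.2)) (by fun_prop) using 2
    simp only [mode, fourierMode_shift₁]
    ring
  · obtain ⟨K, hK, hs⟩ := face P.L₁ fun t => (t, 0)
    exact P.hasTrace_ofSmooth hw hK hs (by fun_prop)
  · obtain ⟨K, hK, hs⟩ := face P.L₁ fun t => (t, P.L₂)
    convert P.hasTrace_ofSmooth hw hK hs (p := fun y => ((y.1, P.L₂), y.2)) (by fun_prop) using 2
    simp only [mode, fourierMode_shift₂]
    ring

theorem cell_subset_compact : ∃ K : Set (ℝ × ℝ), IsCompact K ∧ P.cell ⊆ K :=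
  boxFace_subset_compact 2 P.lo P.hi

/-! ### Fourier coefficients of traces -/

/-- A smooth function which vanishes up to the level `fmax` and equals `1` at the level `h`. -/
theorem exists_cutoff : ∃ g : ℝ → ℂ, ContDiff ℝ ∞ g ∧ (∀ t ≤ P.fmax, g t = 0) ∧ g P.h = 1 := by
  have hd : 0 < P.h - P.fmax := sub_pos.2 P.fmax_lt_h
  refine ⟨fun t => (Real.smoothTransition ((t - P.fmax) / (P.h - P.fmax)) : ℂ), ?_, ?_, ?_⟩
  · exact Complex.ofRealCLM.contDiff.comp
      (Real.smoothTransition.contDiff.comp ((contDiff_id.sub contDiff_const).div_const _))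
  · intro t ht
    show ((Real.smoothTransition ((t - P.fmax) / (P.h - P.fmax)) : ℝ) : ℂ) = 0
    rw [Real.smoothTransition.zero_of_nonpos, Complex.ofReal_zero]
    exact div_nonpos_of_nonpos_of_nonneg (by linarith) hd.le
  · simp [div_self hd.ne']

/-- All traces of `u` on `Γ_h` have the same Fourier coefficients, since Green's formula expresses
these by integrals over `Ω`. -/
theorem integral_trace_mul_conj_unique {u : SobolevH1 P.domain} {γ γ' : ℝ × ℝ → ℂ}
    (h : HasTrace u P.cell (fun r => (r, P.h)) γ) (h' : HasTrace u P.cell (fun r => (r, P.h)) γ')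
    (n : ℤ × ℤ) : ∫ r in P.cell, γ r * (starRingEnd ℂ) (P.fourierMode n r) =
      ∫ r in P.cell, γ' r * (starRingEnd ℂ) (P.fourierMode n r) := by
  obtain ⟨g, hg, h0, h1⟩ := P.exists_cutoff
  have e := (modePairing_grad_two_of_hasTrace h n hg h0).symm.trans
    (modePairing_grad_two_of_hasTrace h' n hg h0)
  simpa [h1] using e

theorem cellArea_ne_zero : ((P.L₁ * P.L₂ : ℝ) : ℂ) ≠ 0 :=
  Complex.ofReal_ne_zero.2 (mul_pos P.L₁_pos P.L₂_pos).ne'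

theorem integral_topTrace_mul_conj (u : Fin 3 → SobolevH1 P.domain) (n : ℤ × ℤ) (i : Fin 3) :
    ∫ r in P.cell, P.topTrace u i r * (starRingEnd ℂ) (P.fourierMode n r) =
      ((P.L₁ * P.L₂ : ℝ) : ℂ) * P.fourierCoeffTop u n i := by
  rw [fourierCoeffTop, mul_inv_cancel_left₀ P.cellArea_ne_zero]

theorem memLp_fourierMode (n : ℤ × ℤ) : MemLp (P.fourierMode n) 2 (volume.restrict P.cell) :=
  P.memLp_cell (P.contDiff_fourierMode n).continuous

theorem integrable_topPairing {v : Fin 3 → SobolevH1 P.domain} (hv : P.MemHqp v)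
    (u : Fin 3 → SobolevH1 P.domain) (n : ℤ × ℤ) (i : Fin 3) :
    Integrable (fun r => P.dtnMode u n r i * (starRingEnd ℂ) (P.topTrace v i r))
      (volume.restrict P.cell) := by
  have h1 : MemLp (fun r => P.dtnMode u n r i) 2 (volume.restrict P.cell) :=
    (P.memLp_fourierMode n).const_mul _
  exact h1.integrable_mul (P.hasTrace_topTrace hv i).1.star

theorem topPairing_dtnMode {v : Fin 3 → SobolevH1 P.domain} (hv : P.MemHqp v)
    (u : Fin 3 → SobolevH1 P.domain) (n : ℤ × ℤ) :
    P.topPairing (P.dtnMode u n) v = ((P.L₁ * P.L₂ : ℝ) : ℂ) *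
      ∑ i, (P.M n).mulVec (P.fourierCoeffTop u n) i *
        (starRingEnd ℂ) (P.fourierCoeffTop v n i) := by
  rw [topPairing, integral_finsetSum _ fun i _ => P.integrable_topPairing hv u n i,
    Finset.mul_sum]
  refine Finset.sum_congr rfl fun i _ => ?_
  have e : ∀ r, P.dtnMode u n r i * (starRingEnd ℂ) (P.topTrace v i r) =
      (P.M n).mulVec (P.fourierCoeffTop u n) i *
        (starRingEnd ℂ) (P.topTrace v i r * (starRingEnd ℂ) (P.fourierMode n r)) := by
    intro r
    rw [dtnMode, map_mul, Complex.conj_conj]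
    ring
  simp_rw [e]
  rw [integral_const_mul, integral_conj, integral_topTrace_mul_conj, map_mul, Complex.conj_ofReal]
  ring

theorem topPairing_dtnTrunc {v : Fin 3 → SobolevH1 P.domain} (hv : P.MemHqp v)
    (u : Fin 3 → SobolevH1 P.domain) (N : ℕ) :
    P.topPairing (P.dtnTrunc N u) v =
      ∑ n ∈ Finset.Icc (-(N : ℤ)) N ×ˢ Finset.Icc (-(N : ℤ)) N,
        P.topPairing (P.dtnMode u n) v := by
  simp only [topPairing]
  rw [← integral_finsetSum _ fun n _ =>
    integrable_finsetSum _ fun i _ => P.integrable_topPairing hv u n i]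
  congr 1
  ext r
  simp only [dtnTrunc]
  rw [Finset.sum_comm]
  exact Finset.sum_congr rfl fun i _ => Finset.sum_mul _ _ _

/-- Green's formula for the `n`-th Fourier coefficients. -/
theorem modePairing_grad {u : Fin 3 → SobolevH1 P.domain} (hu : P.MemHqp u) (n : ℤ × ℤ)
    (i j : Fin 3) {g : ℝ → ℂ} (hg : ContDiff ℝ ∞ g) (h0 : ∀ t ≤ P.fmax, g t = 0) :
    P.modePairing ((u i).grad j) n g = -P.modePairing (u i).toFun n (P.modeDeriv n j g) +
      if j = 2 then (starRingEnd ℂ) (g P.h) * (((P.L₁ * P.L₂ : ℝ) : ℂ) * P.fourierCoeffTop u n i)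
      else 0 := by
  fin_cases j
  · exact (eq_neg_of_add_eq_zero_left ((hu i).modePairing_grad_zero n hg h0)).trans (by simp)
  · exact (eq_neg_of_add_eq_zero_left ((hu i).modePairing_grad_one n hg h0)).trans (by simp)
  · have := modePairing_grad_two_of_hasTrace (P.hasTrace_topTrace hu i) n hg h0
    rw [integral_topTrace_mul_conj] at this
    show _ = -P.modePairing (u i).toFun n (deriv g) + if (2 : Fin 3) = 2 then _ else _
    rw [if_pos rfl, ← this]
    show P.modePairing ((u i).grad 2) n g = _
    ring

/-! ### The variational equation tested with a single mode -/

/-- The divergence of the vector field with components `φᵢ(x₃) exp(i αₙ · r)`, divided by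
`exp(i αₙ · r)`. -/
noncomputable def modeDiv (n : ℤ × ℤ) (φ : Fin 3 → ℝ → ℂ) (t : ℝ) : ℂ :=
  ∑ k, P.modeDeriv n k (φ k) t

/-- The Navier operator `μ Δ + (λ + μ) ∇ ∇· + ω²` applied to the vector field with components
`φᵢ(x₃) exp(i αₙ · r)`, divided by `exp(i αₙ · r)`. -/
noncomputable def modeNavier (n : ℤ × ℤ) (φ : Fin 3 → ℝ → ℂ) (i : Fin 3) (t : ℝ) : ℂ :=
  P.mu * (∑ j, P.modeDeriv n j (P.modeDeriv n j (φ i)) t) +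
    ((P.lam + P.mu : ℝ) : ℂ) * P.modeDeriv n i (P.modeDiv n φ) t + (P.omega : ℂ) ^ 2 * φ i t

/-- The conormal derivative `μ ∂₃ + (λ + μ) (∇·) e₃` of the vector field with components
`φᵢ(x₃) exp(i αₙ · r)` on a horizontal plane, divided by `exp(i αₙ · r)`. -/
noncomputable def modeTraction (n : ℤ × ℤ) (φ : Fin 3 → ℝ → ℂ) (i : Fin 3) (t : ℝ) : ℂ :=
  P.mu * deriv (φ i) t + if i = 2 then ((P.lam + P.mu : ℝ) : ℂ) * P.modeDiv n φ t else 0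

theorem integrable_mul_conj_mode {F : Space3 → ℂ} (hF : MemLp F 2 (volume.restrict P.domain))
    (n : ℤ × ℤ) {g : ℝ → ℂ} (hg : Continuous g) :
    Integrable (fun x => F x * (starRingEnd ℂ) (P.mode n g x)) (volume.restrict P.domain) :=
  hF.integrable_mul (P.memLp_domain ((hg.comp continuous_snd).mul
    ((P.contDiff_fourierMode n).continuous.comp continuous_fst))).star

theorem modePairing_const_mul (F : Space3 → ℂ) (n : ℤ × ℤ) (c : ℂ) (g : ℝ → ℂ) :
    P.modePairing F n (fun t => c * g t) = (starRingEnd ℂ) c * P.modePairing F n g := by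
  simp only [modePairing, mode]
  rw [← integral_const_mul]
  congr 1
  ext x
  simp only [map_mul]
  ring

theorem modePairing_add {F : Space3 → ℂ} (hF : MemLp F 2 (volume.restrict P.domain))
    (n : ℤ × ℤ) {g g' : ℝ → ℂ} (hg : Continuous g) (hg' : Continuous g') :
    P.modePairing F n (fun t => g t + g' t) = P.modePairing F n g + P.modePairing F n g' := by
  simp only [modePairing]
  rw [← integral_add (P.integrable_mul_conj_mode hF n hg) (P.integrable_mul_conj_mode hF n hg')]
  congr 1
  ext x
  simp only [mode, map_mul, map_add]
  ring

theorem modePairing_sum {F : Space3 → ℂ} (hF : MemLp F 2 (volume.restrict P.domain))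
    (n : ℤ × ℤ) {g : Fin 3 → ℝ → ℂ} (hg : ∀ j, Continuous (g j)) :
    P.modePairing F n (fun t => ∑ j, g j t) = ∑ j, P.modePairing F n (g j) := by
  simp only [modePairing]
  rw [← integral_finsetSum _ fun j _ => P.integrable_mul_conj_mode hF n (hg j)]
  congr 1
  ext x
  simp only [mode, map_mul, map_sum, Finset.sum_mul, Finset.mul_sum]

theorem modePairing_modeNavier {F : Space3 → ℂ} (hF : MemLp F 2 (volume.restrict P.domain))
    (n : ℤ × ℤ) {φ : Fin 3 → ℝ → ℂ} (hφ : ∀ i, ContDiff ℝ ∞ (φ i))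
    (hdiv : ContDiff ℝ ∞ (P.modeDiv n φ)) (i : Fin 3) :
    P.modePairing F n (P.modeNavier n φ i) =
      P.mu * (∑ j, P.modePairing F n (P.modeDeriv n j (P.modeDeriv n j (φ i)))) +
      ((P.lam + P.mu : ℝ) : ℂ) * P.modePairing F n (P.modeDeriv n i (P.modeDiv n φ)) +
      (P.omega : ℂ) ^ 2 * P.modePairing F n (φ i) := by
  have c1 : ∀ j, Continuous (P.modeDeriv n j (P.modeDeriv n j (φ i))) := fun j =>
    (P.contDiff_modeDeriv n j (P.contDiff_modeDeriv n j (hφ i))).continuous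
  have c2 : Continuous (P.modeDeriv n i (P.modeDiv n φ)) :=
    (P.contDiff_modeDeriv n i hdiv).continuous
  have c3 := (hφ i).continuous
  have c1' : Continuous fun t => ∑ j, P.modeDeriv n j (P.modeDeriv n j (φ i)) t :=
    continuous_finsetSum _ fun j _ => c1 j
  have cm : ∀ (c : ℂ) {g : ℝ → ℂ}, Continuous g → Continuous fun t => c * g t :=
    fun c _ hg => continuous_const.mul hg
  have cs : Continuous fun t => P.mu * (∑ j, P.modeDeriv n j (P.modeDeriv n j (φ i)) t) +
      ((P.lam + P.mu : ℝ) : ℂ) * P.modeDeriv n i (P.modeDiv n φ) t := (cm _ c1').add (cm _ c2)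
  unfold modeNavier
  rw [P.modePairing_add hF n cs (cm _ c3), P.modePairing_add hF n (cm _ c1') (cm _ c2),
    modePairing_const_mul, modePairing_const_mul, modePairing_const_mul, P.modePairing_sum hF n c1]
  simp

theorem contDiff_modeDiv (n : ℤ × ℤ) {φ : Fin 3 → ℝ → ℂ} (hφ : ∀ i, ContDiff ℝ ∞ (φ i)) :
    ContDiff ℝ ∞ (P.modeDiv n φ) :=
  ContDiff.sum fun k _ => P.contDiff_modeDeriv n k (hφ k)

/-- The vector field with components `φᵢ(x₃) exp(i αₙ · r)`. -/
noncomputable def modeField (n : ℤ × ℤ) {φ : Fin 3 → ℝ → ℂ} (hφ : ∀ i, ContDiff ℝ ∞ (φ i))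
    (i : Fin 3) : SobolevH1 P.domain :=
  P.ofSmooth (P.mode n (φ i)) (P.contDiff_mode n (hφ i))

theorem fourierCoeffTop_modeField (m n : ℤ × ℤ) {φ : Fin 3 → ℝ → ℂ}
    (hφ : ∀ i, ContDiff ℝ ∞ (φ i)) (i : Fin 3) :
    P.fourierCoeffTop (P.modeField n hφ) m i = if m = n then φ i P.h else 0 := by
  have hv : P.MemHqp (P.modeField n hφ) := fun i => P.quasiPeriodic_ofSmooth_mode n (hφ i)
  obtain ⟨K, hK, hs⟩ := P.cell_subset_compact
  have h := P.integral_trace_mul_conj_unique (P.hasTrace_topTrace hv i)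
    (P.hasTrace_ofSmooth (P.contDiff_mode n (hφ i)) hK hs P.continuous_top) m
  have e : ∀ r, P.mode n (φ i) (r, P.h) * (starRingEnd ℂ) (P.fourierMode m r) =
      φ i P.h * (P.fourierMode n r * (starRingEnd ℂ) (P.fourierMode m r)) := fun r => by
    simp only [mode]; ring
  simp_rw [e] at h
  rw [integral_const_mul, integral_fourierMode_mul_conj, integral_topTrace_mul_conj] at h
  have hV := P.cellArea_ne_zero
  split_ifs with hmn
  · rw [if_pos hmn.symm, mul_comm] at h
    exact mul_right_cancel₀ hV h
  · rw [if_neg (Ne.symm hmn), mul_zero] at h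
    exact (mul_eq_zero.1 h).resolve_left hV

theorem dtnForm_modeField (u : Fin 3 → SobolevH1 P.domain) (n : ℤ × ℤ) {φ : Fin 3 → ℝ → ℂ}
    (hφ : ∀ i, ContDiff ℝ ∞ (φ i)) :
    P.dtnForm u (P.modeField n hφ) = ((P.L₁ * P.L₂ : ℝ) : ℂ) *
      ∑ i, (P.M n).mulVec (P.fourierCoeffTop u n) i * (starRingEnd ℂ) (φ i P.h) := by
  have hv : P.MemHqp (P.modeField n hφ) := fun i => P.quasiPeriodic_ofSmooth_mode n (hφ i)
  rw [dtnForm, tsum_eq_single n]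
  · rw [P.topPairing_dtnMode hv]
    simp [fourierCoeffTop_modeField]
  · intro m hm
    rw [P.topPairing_dtnMode hv]
    simp [fourierCoeffTop_modeField, hm]

/-- The variational equation with the test field `φᵢ(x₃) exp(i αₙ · r)`, after all derivatives have
been moved from the solution to the test field. -/
theorem IsSolution.sum_modePairing_modeNavier {P : BiperiodicScattering}
    {u : Fin 3 → SobolevH1 P.domain} (hu : P.IsSolution u)
    (n : ℤ × ℤ) {φ : Fin 3 → ℝ → ℂ} (hφ : ∀ i, ContDiff ℝ ∞ (φ i))
    (h0 : ∀ i, ∀ t ≤ P.fmax, φ i t = 0) :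
    ∑ i, P.modePairing (u i).toFun n (P.modeNavier n φ i) =
      ((P.L₁ * P.L₂ : ℝ) : ℂ) * ((∑ i, P.fourierCoeffTop u n i *
        (starRingEnd ℂ) (P.modeTraction n φ i P.h)) -
        ∑ i, (P.M n).mulVec (P.fourierCoeffTop u n) i * (starRingEnd ℂ) (φ i P.h)) := by
  obtain ⟨hqp, -, hvar⟩ := hu
  have hv : P.MemHqp (P.modeField n hφ) := fun i => P.quasiPeriodic_ofSmooth_mode n (hφ i)
  have hS : P.EqOnSurface (P.modeField n hφ) (fun _ _ => 0) := by
    intro i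
    obtain ⟨K, hK, hs⟩ := P.cell_subset_compact
    have hc := P.continuous_f
    have := P.hasTrace_ofSmooth (P.contDiff_mode n (hφ i)) hK hs (p := fun r => (r, P.f r))
      (by fun_prop)
    simp only [mode, h0 i _ (P.f_le_fmax _), zero_mul] at this
    exact this
  have hdiv := P.contDiff_modeDiv n hφ
  have hdiv0 : ∀ t ≤ P.fmax, P.modeDiv n φ t = 0 := fun t ht =>
    Finset.sum_eq_zero fun k _ => P.modeDeriv_eq_zero n k (hφ k) (h0 k) t ht
  have key := hvar _ hv hS
  rw [sesqForm, dtnForm_modeField] at key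
  have hgrad : ∀ i j x, (P.modeField n hφ i).grad j x = P.mode n (P.modeDeriv n j (φ i)) x :=
    fun i j x => P.classicalGrad_mode n (hφ i) j x
  have hcD : ∀ i j, Continuous (P.modeDeriv n j (φ i)) := fun i j =>
    (P.contDiff_modeDeriv n j (hφ i)).continuous
  have t1 : (∫ x in P.domain, ∑ i, ∑ j, (u i).grad j x *
      (starRingEnd ℂ) ((P.modeField n hφ i).grad j x)) =
      ∑ i, ∑ j, P.modePairing ((u i).grad j) n (P.modeDeriv n j (φ i)) := by
    simp_rw [hgrad]
    rw [integral_finsetSum _ fun i _ => integrable_finsetSum _ fun j _ =>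
      P.integrable_mul_conj_mode ((u i).grad_memLp j) n (hcD i j)]
    refine Finset.sum_congr rfl fun i _ => ?_
    exact integral_finsetSum _ fun j _ =>
      P.integrable_mul_conj_mode ((u i).grad_memLp j) n (hcD i j)
  have t2 : (∫ x in P.domain, P.divergence u x *
      (starRingEnd ℂ) (P.divergence (P.modeField n hφ) x)) =
      ∑ i, P.modePairing ((u i).grad i) n (P.modeDiv n φ) := by
    have e : ∀ x, P.divergence u x * (starRingEnd ℂ) (P.divergence (P.modeField n hφ) x) =
        ∑ i, (u i).grad i x * (starRingEnd ℂ) (P.mode n (P.modeDiv n φ) x) := by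
      intro x
      simp only [divergence, hgrad, ← Finset.sum_mul]
      simp only [mode, modeDiv, Finset.sum_mul]
    simp_rw [e]
    exact integral_finsetSum _ fun i _ =>
      P.integrable_mul_conj_mode ((u i).grad_memLp i) n hdiv.continuous
  have t3 : (∫ x in P.domain, ∑ i, (u i).toFun x *
      (starRingEnd ℂ) ((P.modeField n hφ i).toFun x)) =
      ∑ i, P.modePairing (u i).toFun n (φ i) :=
    integral_finsetSum _ fun i _ =>
      P.integrable_mul_conj_mode (u i).memLp n (hφ i).continuous
  rw [t1, t2, t3] at key
  have g1 : ∀ i j, P.modePairing ((u i).grad j) n (P.modeDeriv n j (φ i)) = _ := fun i j =>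
    P.modePairing_grad hqp n i j (P.contDiff_modeDeriv n j (hφ i))
      (P.modeDeriv_eq_zero n j (hφ i) (h0 i))
  have g2 : ∀ i, P.modePairing ((u i).grad i) n (P.modeDiv n φ) = _ := fun i =>
    P.modePairing_grad hqp n i i hdiv hdiv0
  simp_rw [g1, g2] at key
  simp_rw [P.modePairing_modeNavier (u _).memLp n hφ hdiv]
  have hd : ∀ i, P.modeDeriv n 2 (φ i) P.h = deriv (φ i) P.h := fun i => rfl
  simp only [Finset.sum_add_distrib, Finset.sum_ite_eq', Finset.mem_univ, if_true,
    Finset.sum_neg_distrib, ← Finset.mul_sum, hd] at key ⊢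
  simp only [modeTraction, map_add, map_mul, Complex.conj_ofReal, mul_add, Finset.sum_add_distrib,
    apply_ite (starRingEnd ℂ), map_zero, mul_ite, mul_zero, Finset.sum_ite_eq', Finset.mem_univ,
    if_true]
  simp only [Fin.sum_univ_three] at key ⊢
  linear_combination -key

/-! ### The wave that decays downwards -/

theorem lam_add_two_mu_mul_kappa₁_sq : (P.lam + 2 * P.mu) * P.kappa₁ ^ 2 = P.omega ^ 2 := by
  have h : 0 < P.lam + 2 * P.mu := by linarith [P.lam_add_mu_pos, P.mu_pos]
  rw [kappa₁, div_pow, Real.sq_sqrt h.le]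
  field_simp

theorem mu_mul_kappa₂_sq : P.mu * P.kappa₂ ^ 2 = P.omega ^ 2 := by
  have h := P.mu_pos
  rw [kappa₂, div_pow, Real.sq_sqrt h.le]
  field_simp

theorem kappa₂_pos : 0 < P.kappa₂ := div_pos P.omega_pos (Real.sqrt_pos.2 P.mu_pos)

theorem kappa₁_sq_lt : P.kappa₁ ^ 2 < P.kappa₂ ^ 2 := by
  have h1 := P.lam_add_two_mu_mul_kappa₁_sq
  have h2 := P.mu_mul_kappa₂_sq
  have h3 := P.lam_add_mu_pos
  have h4 := P.mu_pos
  have h5 := P.omega_pos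
  by_contra! h
  nlinarith [mul_le_mul_of_nonneg_left h h4.le, pow_pos h5 2, pow_pos P.kappa₂_pos 2,
    mul_le_mul_of_nonneg_left h h3.le, mul_pos h3 (pow_pos P.kappa₂_pos 2)]

/-- The decay rate of the compressional part of the `n`-th mode: `β₁ₙ = i γ₁ₙ`. -/
noncomputable def γ₁ (n : ℤ × ℤ) : ℝ := Real.sqrt (P.aSq n - P.kappa₁ ^ 2)

/-- The decay rate of the shear part of the `n`-th mode: `β₂ₙ = i γ₂ₙ`. -/
noncomputable def γ₂ (n : ℤ × ℤ) : ℝ := Real.sqrt (P.aSq n - P.kappa₂ ^ 2)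

/-- The real value of `χₙ` for evanescent modes. -/
noncomputable def χr (n : ℤ × ℤ) : ℝ := P.aSq n - P.γ₁ n * P.γ₂ n

section Evanescent

variable {P} {n : ℤ × ℤ} (hn : P.kappa₂ ^ 2 < P.aSq n)

include hn

theorem γ₂_sq : P.γ₂ n ^ 2 = P.aSq n - P.kappa₂ ^ 2 := Real.sq_sqrt (by linarith)

theorem γ₁_sq : P.γ₁ n ^ 2 = P.aSq n - P.kappa₁ ^ 2 :=
  Real.sq_sqrt (by linarith [P.kappa₁_sq_lt])

theorem γ₂_pos : 0 < P.γ₂ n := Real.sqrt_pos.2 (by linarith)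

omit hn in
theorem γ₂_le_γ₁ : P.γ₂ n ≤ P.γ₁ n := Real.sqrt_le_sqrt (by linarith [P.kappa₁_sq_lt])

theorem beta₁_eq : P.beta₁ n = Complex.I * (P.γ₁ n : ℂ) := by
  rw [beta₁, betaOf, if_neg (by linarith [P.kappa₁_sq_lt])]
  rfl

theorem beta₂_eq : P.beta₂ n = Complex.I * (P.γ₂ n : ℂ) := by
  rw [beta₂, betaOf, if_neg (by linarith)]
  rfl

theorem chi_eq : P.chi n = (P.χr n : ℂ) := by
  rw [chi, beta₁_eq hn, beta₂_eq hn, χr]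
  push_cast
  linear_combination (P.γ₁ n * P.γ₂ n : ℂ) * Complex.I_sq

/-- `2 χₙ = κ₁² + κ₂² + (γ₁ - γ₂)²`; in particular `χₙ` does not vanish, although it is the
difference of two large numbers. -/
theorem χr_ge : (P.kappa₁ ^ 2 + P.kappa₂ ^ 2) / 2 ≤ P.χr n := by
  have := sq_nonneg (P.γ₁ n - P.γ₂ n)
  have h1 := γ₁_sq hn
  have h2 := γ₂_sq hn
  rw [χr]
  nlinarith

theorem χr_pos : 0 < P.χr n :=
  lt_of_lt_of_le (by nlinarith [P.kappa₂_pos, sq_nonneg P.kappa₁]) (χr_ge hn)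

theorem χr_le : P.χr n ≤ P.kappa₂ ^ 2 := by
  have h1 := γ₂_le_γ₁ (P := P) (n := n)
  have h2 := γ₂_sq hn
  have h3 := γ₂_pos hn
  rw [χr]
  nlinarith

end Evanescent

/-- The amplitude of the compressional part of the downward decaying wave with value `c` at the
level `h`. -/
noncomputable def waveAmp (n : ℤ × ℤ) (c : Fin 3 → ℂ) : ℂ :=
  -(P.γ₂ n * c 2 + Complex.I * (P.a₁ n * c 0 + P.a₂ n * c 1)) / P.χr n

/-- The coefficient vector of the compressional part of the downward decaying wave. -/
noncomputable def waveVec (n : ℤ × ℤ) (c : Fin 3 → ℂ) : Fin 3 → ℂ :=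
  ![Complex.I * P.a₁ n * P.waveAmp n c, Complex.I * P.a₂ n * P.waveAmp n c,
    P.γ₁ n * P.waveAmp n c]

/-- The exponential `exp(γ (t - h))`. -/
noncomputable def expAt (γ : ℝ) (t : ℝ) : ℂ := (Real.exp (γ * (t - P.h)) : ℂ)

/-- The downward decaying solution of the Navier equation with value `c` at the level `h`: the sum
of a shear wave with rate `γ₂` and a compressional wave with rate `γ₁`. -/
noncomputable def wave (n : ℤ × ℤ) (c : Fin 3 → ℂ) (i : Fin 3) (t : ℝ) : ℂ :=
  (c i - P.waveVec n c i) * P.expAt (P.γ₂ n) t + P.waveVec n c i * P.expAt (P.γ₁ n) t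

/-- The derivative of `wave`. -/
noncomputable def waveDeriv (n : ℤ × ℤ) (c : Fin 3 → ℂ) (i : Fin 3) (t : ℝ) : ℂ :=
  P.γ₂ n * (c i - P.waveVec n c i) * P.expAt (P.γ₂ n) t +
    P.γ₁ n * P.waveVec n c i * P.expAt (P.γ₁ n) t

theorem hasDerivAt_expAt (γ t : ℝ) : HasDerivAt (P.expAt γ) (γ * P.expAt γ t) t := by
  have h : HasDerivAt (fun t : ℝ => γ * (t - P.h)) γ t := by
    simpa using ((hasDerivAt_id t).sub_const P.h).const_mul γ
  refine (h.exp.ofReal_comp).congr_deriv ?_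
  simp only [expAt]
  push_cast
  ring

theorem contDiff_expAt (γ : ℝ) : ContDiff ℝ ∞ (P.expAt γ) :=
  Complex.ofRealCLM.contDiff.comp
    (Real.contDiff_exp.comp (contDiff_const.mul (contDiff_id.sub contDiff_const)))

theorem contDiff_wave (n : ℤ × ℤ) (c : Fin 3 → ℂ) (i : Fin 3) : ContDiff ℝ ∞ (P.wave n c i) :=
  (contDiff_const.mul (P.contDiff_expAt _)).add (contDiff_const.mul (P.contDiff_expAt _))

theorem deriv_wave (n : ℤ × ℤ) (c : Fin 3 → ℂ) (i : Fin 3) :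
    deriv (P.wave n c i) = P.waveDeriv n c i := by
  ext t
  refine ((((P.hasDerivAt_expAt (P.γ₂ n) t).const_mul _).add
    ((P.hasDerivAt_expAt (P.γ₁ n) t).const_mul _)).congr_deriv ?_).deriv
  simp only [waveDeriv]
  ring

theorem deriv_waveDeriv (n : ℤ × ℤ) (c : Fin 3 → ℂ) (i : Fin 3) (t : ℝ) :
    deriv (P.waveDeriv n c i) t =
      P.γ₂ n ^ 2 * (c i - P.waveVec n c i) * P.expAt (P.γ₂ n) t +
        P.γ₁ n ^ 2 * P.waveVec n c i * P.expAt (P.γ₁ n) t := by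
  refine ((((P.hasDerivAt_expAt (P.γ₂ n) t).const_mul _).add
    ((P.hasDerivAt_expAt (P.γ₁ n) t).const_mul _)).congr_deriv ?_).deriv
  ring

theorem expAt_h (γ : ℝ) : P.expAt γ P.h = 1 := by simp [expAt]

theorem wave_h (n : ℤ × ℤ) (c : Fin 3 → ℂ) (i : Fin 3) : P.wave n c i P.h = c i := by
  simp [wave, expAt_h]

section Evanescent

variable {P} {n : ℤ × ℤ} (hn : P.kappa₂ ^ 2 < P.aSq n)

include hn

theorem modeDiv_wave (c : Fin 3 → ℂ) :
    P.modeDiv n (P.wave n c) =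
      fun t => -(P.kappa₁ : ℂ) ^ 2 * P.waveAmp n c * P.expAt (P.γ₁ n) t := by
  ext t
  have hχ : (P.χr n : ℂ) ≠ 0 := Complex.ofReal_ne_zero.2 (χr_pos hn).ne'
  have hp : P.waveAmp n c * P.χr n =
      -(P.γ₂ n * c 2 + Complex.I * (P.a₁ n * c 0 + P.a₂ n * c 1)) := by
    rw [waveAmp, div_mul_cancel₀ _ hχ]
  have h1 : (P.γ₁ n : ℂ) ^ 2 = (P.a₁ n : ℂ) ^ 2 + (P.a₂ n : ℂ) ^ 2 - (P.kappa₁ : ℂ) ^ 2 := by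
    exact_mod_cast γ₁_sq hn
  have hχ' : (P.χr n : ℂ) = (P.a₁ n : ℂ) ^ 2 + (P.a₂ n : ℂ) ^ 2 - P.γ₁ n * P.γ₂ n := by
    simp [χr, aSq]
  rw [modeDiv, Fin.sum_univ_three]
  show Complex.I * P.a₁ n * P.wave n c 0 t + Complex.I * P.a₂ n * P.wave n c 1 t +
    deriv (P.wave n c 2) t = _
  rw [deriv_wave]
  simp only [wave, waveDeriv]
  have v0 : P.waveVec n c 0 = Complex.I * P.a₁ n * P.waveAmp n c := rfl
  have v1 : P.waveVec n c 1 = Complex.I * P.a₂ n * P.waveAmp n c := rfl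
  have v2 : P.waveVec n c 2 = P.γ₁ n * P.waveAmp n c := rfl
  rw [v0, v1, v2]
  rw [hχ'] at hp
  set E2 := P.expAt (P.γ₂ n) t
  set E1 := P.expAt (P.γ₁ n) t
  set p := P.waveAmp n c
  linear_combination E2 * hp + p * E1 * h1 +
    ((P.a₁ n : ℂ) ^ 2 + (P.a₂ n : ℂ) ^ 2) * p * (E1 - E2) * Complex.I_sq

theorem modeNavier_wave (c : Fin 3 → ℂ) (i : Fin 3) (t : ℝ) :
    P.modeNavier n (P.wave n c) i t = 0 := by
  have h1 : (P.γ₁ n : ℂ) ^ 2 = (P.a₁ n : ℂ) ^ 2 + (P.a₂ n : ℂ) ^ 2 - (P.kappa₁ : ℂ) ^ 2 := by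
    exact_mod_cast γ₁_sq hn
  have h2 : (P.γ₂ n : ℂ) ^ 2 = (P.a₁ n : ℂ) ^ 2 + (P.a₂ n : ℂ) ^ 2 - (P.kappa₂ : ℂ) ^ 2 := by
    exact_mod_cast γ₂_sq hn
  have k1 : ((P.lam : ℂ) + 2 * P.mu) * (P.kappa₁ : ℂ) ^ 2 = (P.omega : ℂ) ^ 2 := by
    exact_mod_cast P.lam_add_two_mu_mul_kappa₁_sq
  have k2 : (P.mu : ℂ) * (P.kappa₂ : ℂ) ^ 2 = (P.omega : ℂ) ^ 2 := by
    exact_mod_cast P.mu_mul_kappa₂_sq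
  have hdd : deriv (fun t => -(P.kappa₁ : ℂ) ^ 2 * P.waveAmp n c * P.expAt (P.γ₁ n) t) t =
      -(P.kappa₁ : ℂ) ^ 2 * P.waveAmp n c * (P.γ₁ n * P.expAt (P.γ₁ n) t) :=
    ((P.hasDerivAt_expAt (P.γ₁ n) t).const_mul _).deriv
  have lap : (∑ j, P.modeDeriv n j (P.modeDeriv n j (P.wave n c i)) t) =
      -(P.kappa₂ : ℂ) ^ 2 * (c i - P.waveVec n c i) * P.expAt (P.γ₂ n) t -
        (P.kappa₁ : ℂ) ^ 2 * P.waveVec n c i * P.expAt (P.γ₁ n) t := by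
    rw [Fin.sum_univ_three]
    show Complex.I * P.a₁ n * (Complex.I * P.a₁ n * P.wave n c i t) +
      Complex.I * P.a₂ n * (Complex.I * P.a₂ n * P.wave n c i t) +
      deriv (deriv (P.wave n c i)) t = _
    rw [deriv_wave, deriv_waveDeriv]
    simp only [wave]
    set E2 := P.expAt (P.γ₂ n) t
    set E1 := P.expAt (P.γ₁ n) t
    set w := P.waveVec n c i
    linear_combination (c i - w) * E2 * h2 + w * E1 * h1 +
      ((P.a₁ n : ℂ) ^ 2 + (P.a₂ n : ℂ) ^ 2) * ((c i - w) * E2 + w * E1) * Complex.I_sq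
  have gd : P.modeDeriv n i (P.modeDiv n (P.wave n c)) t =
      -(P.kappa₁ : ℂ) ^ 2 * P.waveVec n c i * P.expAt (P.γ₁ n) t := by
    rw [modeDiv_wave hn]
    fin_cases i
    · simp only [modeDeriv, waveVec]
      simp
      ring
    · simp only [modeDeriv, waveVec]
      simp
      ring
    · show deriv (fun t => -(P.kappa₁ : ℂ) ^ 2 * P.waveAmp n c * P.expAt (P.γ₁ n) t) t =
        -(P.kappa₁ : ℂ) ^ 2 * (P.γ₁ n * P.waveAmp n c) * P.expAt (P.γ₁ n) t
      rw [hdd]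
      ring
  rw [modeNavier, lap, gd]
  simp only [wave]
  push_cast
  set E2 := P.expAt (P.γ₂ n) t
  set E1 := P.expAt (P.γ₁ n) t
  set w := P.waveVec n c i
  linear_combination -(c i - w) * E2 * k2 - w * E1 * k1

/-- On the level `h`, the conormal derivatives of the downward decaying wave and of the upward
decaying wave with the same value `c` differ by a positive definite matrix applied to `c`, in which
the horizontal and the vertical components are decoupled. -/
theorem modeTraction_wave_eq (c : Fin 3 → ℂ) (i : Fin 3) :
    P.modeTraction n (P.wave n c) i P.h = (P.M n).mulVec c i +
      ![2 * P.mu * P.γ₂ n * c 0 + 2 * P.mu * (P.γ₁ n - P.γ₂ n) / P.χr n * P.a₁ n *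
          (P.a₁ n * c 0 + P.a₂ n * c 1),
        2 * P.mu * P.γ₂ n * c 1 + 2 * P.mu * (P.γ₁ n - P.γ₂ n) / P.χr n * P.a₂ n *
          (P.a₁ n * c 0 + P.a₂ n * c 1),
        2 * P.mu * P.γ₂ n * P.kappa₂ ^ 2 / P.χr n * c 2] i := by
  have hχ : (P.χr n : ℂ) ≠ 0 := Complex.ofReal_ne_zero.2 (χr_pos hn).ne'
  have hχ' : (P.χr n : ℂ) = (P.a₁ n : ℂ) ^ 2 + (P.a₂ n : ℂ) ^ 2 - P.γ₁ n * P.γ₂ n := by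
    simp [χr, aSq]
  have h1 : (P.γ₁ n : ℂ) ^ 2 = (P.a₁ n : ℂ) ^ 2 + (P.a₂ n : ℂ) ^ 2 - (P.kappa₁ : ℂ) ^ 2 := by
    exact_mod_cast γ₁_sq hn
  have h2 : (P.γ₂ n : ℂ) ^ 2 = (P.a₁ n : ℂ) ^ 2 + (P.a₂ n : ℂ) ^ 2 - (P.kappa₂ : ℂ) ^ 2 := by
    exact_mod_cast γ₂_sq hn
  have k1 : ((P.lam : ℂ) + 2 * P.mu) * (P.kappa₁ : ℂ) ^ 2 = (P.omega : ℂ) ^ 2 := by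
    exact_mod_cast P.lam_add_two_mu_mul_kappa₁_sq
  have k2 : (P.mu : ℂ) * (P.kappa₂ : ℂ) ^ 2 = (P.omega : ℂ) ^ 2 := by
    exact_mod_cast P.mu_mul_kappa₂_sq
  have hI := Complex.I_sq
  rw [modeTraction, deriv_wave, modeDiv_wave hn]
  simp only [waveDeriv, expAt_h, mul_one]
  fin_cases i
  · simp only [Matrix.mulVec, dotProduct, M, Fin.sum_univ_three, chi_eq hn, beta₁_eq hn,
      beta₂_eq hn, waveVec, waveAmp]
    simp
    field_simp
    linear_combination (P.mu * (P.γ₂ n - P.γ₁ n) * P.a₁ n * (2 * (P.a₁ n * c 0 + P.a₂ n * c 1) +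
      P.γ₂ n * Complex.I * c 2) - P.mu * P.γ₂ n * c 0 * P.χr n) * hI
  · simp only [Matrix.mulVec, dotProduct, M, Fin.sum_univ_three, chi_eq hn, beta₁_eq hn,
      beta₂_eq hn, waveVec, waveAmp]
    simp
    field_simp
    linear_combination (P.mu * (P.γ₂ n - P.γ₁ n) * P.a₂ n * (2 * (P.a₁ n * c 0 + P.a₂ n * c 1) +
      P.γ₂ n * Complex.I * c 2) - P.mu * P.γ₂ n * c 1 * P.χr n) * hI
  · simp only [Matrix.mulVec, dotProduct, M, Fin.sum_univ_three, chi_eq hn, beta₁_eq hn,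
      beta₂_eq hn, waveVec, waveAmp]
    simp
    field_simp
    have hh : ((P.lam : ℂ) + P.mu) * (P.kappa₁ : ℂ) ^ 2 =
        P.mu * ((P.γ₁ n : ℂ) ^ 2 - (P.γ₂ n) ^ 2) := by
      linear_combination k1 - k2 - P.mu * h1 + P.mu * h2
    linear_combination (Complex.I * (P.a₁ n * c 0 + P.a₂ n * c 1) + P.γ₂ n * c 2) * hh +
      P.mu * P.γ₂ n * c 2 * (hχ' - h2) - P.mu * P.γ₂ n * (c 2 * P.kappa₂ ^ 2 -
        Complex.I * (P.γ₁ n - P.γ₂ n) * (P.a₁ n * c 0 + P.a₂ n * c 1)) * hI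

end Evanescent

theorem re_mul_conj_sub (c m : ℂ) :
    (c * (starRingEnd ℂ) m - m * (starRingEnd ℂ) c).re = 0 := by
  simp
  ring

/-- Coercivity of the difference of the conormal derivatives of the downward and the upward
decaying waves. -/
theorem le_norm_traction_sub {n : ℤ × ℤ} (hn : P.kappa₂ ^ 2 < P.aSq n) (c : Fin 3 → ℂ) :
    2 * P.mu * P.γ₂ n * ∑ i, ‖c i‖ ^ 2 ≤
      ‖(∑ i, c i * (starRingEnd ℂ) (P.modeTraction n (P.wave n c) i P.h)) -
        ∑ i, (P.M n).mulVec c i * (starRingEnd ℂ) (c i)‖ := by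
  refine le_trans ?_ (Complex.re_le_norm _)
  set r : ℝ := 2 * P.mu * (P.γ₁ n - P.γ₂ n) / P.χr n with hr
  set k : ℝ := 2 * P.mu * P.γ₂ n * P.kappa₂ ^ 2 / P.χr n with hk
  set z : ℂ := P.a₁ n * c 0 + P.a₂ n * c 1 with hz
  set m := (P.M n).mulVec c with hm
  have hμ := P.mu_pos
  have hγ := γ₂_pos hn
  have hχ := χr_pos hn
  have hr0 : 0 ≤ r := div_nonneg
    (mul_nonneg (by positivity) (sub_nonneg.2 (γ₂_le_γ₁ (P := P) (n := n)))) hχ.le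
  have hk0 : 2 * P.mu * P.γ₂ n ≤ k := by
    rw [hk, le_div_iff₀ hχ]
    exact mul_le_mul_of_nonneg_left (χr_le hn) (by positivity)
  have e : ((∑ i, c i * (starRingEnd ℂ) (P.modeTraction n (P.wave n c) i P.h)) -
        ∑ i, m i * (starRingEnd ℂ) (c i)) =
      (∑ i, (c i * (starRingEnd ℂ) (m i) - m i * (starRingEnd ℂ) (c i))) +
        ((2 * P.mu * P.γ₂ n * (‖c 0‖ ^ 2 + ‖c 1‖ ^ 2) + r * ‖z‖ ^ 2 + k * ‖c 2‖ ^ 2 : ℝ) : ℂ) := by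
    simp only [modeTraction_wave_eq hn, ← Complex.normSq_eq_norm_sq, Fin.sum_univ_three]
    push_cast [← Complex.mul_conj, hr, hk]
    simp [← hm, hz, map_ofNat]
    ring
  rw [e, Complex.add_re, Complex.re_sum, Finset.sum_eq_zero fun i _ => re_mul_conj_sub (c i) (m i),
    zero_add, Complex.ofReal_re, Fin.sum_univ_three]
  nlinarith [mul_nonneg hr0 (sq_nonneg ‖z‖), mul_le_mul_of_nonneg_right hk0 (sq_nonneg ‖c 2‖)]

/-! ### Cutting off the wave -/

/-- The commutator of the Navier operator for the `n`-th mode with the multiplication by `η`,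
applied to `ψ`. -/
noncomputable def modeCommutator (n : ℤ × ℤ) (η : ℝ → ℂ) (ψ : Fin 3 → ℝ → ℂ) (i : Fin 3) (t : ℝ) :
    ℂ :=
  P.mu * (2 * deriv η t * deriv (ψ i) t + deriv (deriv η) t * ψ i t) +
    ((P.lam + P.mu : ℝ) : ℂ) *
      ![Complex.I * P.a₁ n * (deriv η t * ψ 2 t), Complex.I * P.a₂ n * (deriv η t * ψ 2 t),
        deriv η t * (Complex.I * P.a₁ n * ψ 0 t + Complex.I * P.a₂ n * ψ 1 t) +
          2 * deriv η t * deriv (ψ 2) t + deriv (deriv η) t * ψ 2 t] i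

theorem modeNavier_mul (n : ℤ × ℤ) {η : ℝ → ℂ} (hη : ContDiff ℝ ∞ η) {ψ : Fin 3 → ℝ → ℂ}
    (hψ : ∀ i, ContDiff ℝ ∞ (ψ i)) (i : Fin 3) (t : ℝ) :
    P.modeNavier n (fun i t => η t * ψ i t) i t =
      η t * P.modeNavier n ψ i t + P.modeCommutator n η ψ i t := by
  have dη : Differentiable ℝ η := hη.differentiable (by simp)
  have dη' : Differentiable ℝ (deriv η) :=
    (contDiff_infty_iff_deriv.1 hη).2.differentiable (by simp)
  have dψ : ∀ i, Differentiable ℝ (ψ i) := fun i => (hψ i).differentiable (by simp)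
  have dψ' : ∀ i, Differentiable ℝ (deriv (ψ i)) := fun i =>
    (contDiff_infty_iff_deriv.1 (hψ i)).2.differentiable (by simp)
  have ddiv : Differentiable ℝ (P.modeDiv n ψ) := (P.contDiff_modeDiv n hψ).differentiable (by simp)
  have d1 : ∀ i, deriv (fun t => η t * ψ i t) = fun t => deriv η t * ψ i t + η t * deriv (ψ i) t :=
    fun i => funext fun t => deriv_fun_mul (dη t) (dψ i t)
  have d2 : deriv (deriv (fun t => η t * ψ i t)) t =
      deriv (deriv η) t * ψ i t + 2 * deriv η t * deriv (ψ i) t + η t * deriv (deriv (ψ i)) t := by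
    rw [d1]
    refine (((dη' t).hasDerivAt.mul (dψ i t).hasDerivAt).add
      ((dη t).hasDerivAt.mul (dψ' i t).hasDerivAt)).deriv.trans ?_
    ring
  have hdiv : ∀ t, P.modeDiv n ψ t =
      Complex.I * P.a₁ n * ψ 0 t + Complex.I * P.a₂ n * ψ 1 t + deriv (ψ 2) t := fun t => by
    rw [modeDiv, Fin.sum_univ_three]; rfl
  have hdivφ : P.modeDiv n (fun i t => η t * ψ i t) =
      fun t => η t * P.modeDiv n ψ t + deriv η t * ψ 2 t := by
    ext t
    rw [hdiv, modeDiv, Fin.sum_univ_three]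
    show Complex.I * P.a₁ n * (η t * ψ 0 t) + Complex.I * P.a₂ n * (η t * ψ 1 t) +
      deriv (fun t => η t * ψ 2 t) t = _
    rw [d1]
    ring
  have lap : (∑ j, P.modeDeriv n j (P.modeDeriv n j (fun t => η t * ψ i t)) t) =
      η t * (∑ j, P.modeDeriv n j (P.modeDeriv n j (ψ i)) t) +
        (deriv (deriv η) t * ψ i t + 2 * deriv η t * deriv (ψ i) t) := by
    rw [Fin.sum_univ_three, Fin.sum_univ_three]
    show Complex.I * P.a₁ n * (Complex.I * P.a₁ n * (η t * ψ i t)) +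
      Complex.I * P.a₂ n * (Complex.I * P.a₂ n * (η t * ψ i t)) +
      deriv (deriv (fun t => η t * ψ i t)) t =
      η t * (Complex.I * P.a₁ n * (Complex.I * P.a₁ n * ψ i t) +
      Complex.I * P.a₂ n * (Complex.I * P.a₂ n * ψ i t) + deriv (deriv (ψ i)) t) + _
    rw [d2]
    ring
  rw [modeNavier, modeNavier, modeCommutator, lap, hdivφ]
  have gd : P.modeDeriv n i (fun t => η t * P.modeDiv n ψ t + deriv η t * ψ 2 t) t =
      η t * P.modeDeriv n i (P.modeDiv n ψ) t +
      ![Complex.I * P.a₁ n * (deriv η t * ψ 2 t), Complex.I * P.a₂ n * (deriv η t * ψ 2 t),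
        deriv η t * (Complex.I * P.a₁ n * ψ 0 t + Complex.I * P.a₂ n * ψ 1 t) +
          2 * deriv η t * deriv (ψ 2) t + deriv (deriv η) t * ψ 2 t] i := by
    fin_cases i
    · show Complex.I * P.a₁ n * (η t * P.modeDiv n ψ t + deriv η t * ψ 2 t) =
        η t * (Complex.I * P.a₁ n * P.modeDiv n ψ t) + Complex.I * P.a₁ n * (deriv η t * ψ 2 t)
      ring
    · show Complex.I * P.a₂ n * (η t * P.modeDiv n ψ t + deriv η t * ψ 2 t) =
        η t * (Complex.I * P.a₂ n * P.modeDiv n ψ t) + Complex.I * P.a₂ n * (deriv η t * ψ 2 t)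
      ring
    · show deriv (fun t => η t * P.modeDiv n ψ t + deriv η t * ψ 2 t) t =
        η t * deriv (P.modeDiv n ψ) t + (deriv η t * (Complex.I * P.a₁ n * ψ 0 t +
          Complex.I * P.a₂ n * ψ 1 t) + 2 * deriv η t * deriv (ψ 2) t +
          deriv (deriv η) t * ψ 2 t)
      refine (((dη t).hasDerivAt.mul (ddiv t).hasDerivAt).add
        ((dη' t).hasDerivAt.mul (dψ 2 t).hasDerivAt)).deriv.trans ?_
      rw [hdiv]
      ring
  rw [gd]
  ring

/-! ### Bounds for the wave at large wave numbers -/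

/-- The length of the horizontal wave vector of the `n`-th mode. -/
noncomputable def waveNum (n : ℤ × ℤ) : ℝ := Real.sqrt (P.aSq n)

theorem aSq_nonneg (n : ℤ × ℤ) : 0 ≤ P.aSq n := by unfold aSq; positivity

theorem waveNum_sq (n : ℤ × ℤ) : P.waveNum n ^ 2 = P.aSq n := Real.sq_sqrt (P.aSq_nonneg n)

theorem abs_a₁_le (n : ℤ × ℤ) : |P.a₁ n| ≤ P.waveNum n :=
  Real.abs_le_sqrt (by rw [aSq]; nlinarith [sq_nonneg (P.a₂ n)])

theorem abs_a₂_le (n : ℤ × ℤ) : |P.a₂ n| ≤ P.waveNum n :=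
  Real.abs_le_sqrt (by rw [aSq]; nlinarith [sq_nonneg (P.a₁ n)])

section Evanescent

variable {P} {n : ℤ × ℤ} (h1 : 1 ≤ P.waveNum n) (h2 : 2 * P.kappa₂ ≤ P.waveNum n)

include h2 in
theorem kappa₂_sq_lt_aSq : P.kappa₂ ^ 2 < P.aSq n := by
  rw [← waveNum_sq]
  nlinarith [P.kappa₂_pos]

include h2 in
theorem waveNum_le_two_mul_γ₂ : P.waveNum n ≤ 2 * P.γ₂ n := by
  have h := γ₂_sq (kappa₂_sq_lt_aSq h2)
  have hp := γ₂_pos (kappa₂_sq_lt_aSq h2)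
  rw [← waveNum_sq] at h
  have := P.kappa₂_pos
  by_contra! hc
  nlinarith

theorem γ₁_le_waveNum : P.γ₁ n ≤ P.waveNum n :=
  Real.sqrt_le_sqrt (by linarith [sq_nonneg P.kappa₁])

include h2 in
theorem γ₁_sub_γ₂_le : (P.γ₁ n - P.γ₂ n) * P.waveNum n ≤ P.kappa₂ ^ 2 := by
  have hn := kappa₂_sq_lt_aSq h2
  have e1 := γ₁_sq hn
  have e2 := γ₂_sq hn
  have l1 := waveNum_le_two_mul_γ₂ h2
  have l2 := γ₂_le_γ₁ (P := P) (n := n)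
  nlinarith [sq_nonneg P.kappa₁]

include h2 in
theorem norm_waveVec_le (c : Fin 3 → ℂ) (i : Fin 3) :
    ‖P.waveVec n c i‖ * P.kappa₂ ^ 2 ≤ 2 * P.waveNum n ^ 2 * ∑ i, ‖c i‖ := by
  have hn := kappa₂_sq_lt_aSq h2
  have hs : 0 < P.waveNum n := by linarith [P.kappa₂_pos]
  have hχ := χr_pos hn
  have g1 := γ₁_le_waveNum (P := P) (n := n)
  have g2 := γ₂_le_γ₁ (P := P) (n := n)
  have g0 := γ₂_pos hn
  have hp : ‖P.waveAmp n c‖ * P.χr n ≤ P.waveNum n * ∑ i, ‖c i‖ := by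
    rw [waveAmp, norm_div, Complex.norm_real, Real.norm_eq_abs, abs_of_pos hχ,
      div_mul_cancel₀ _ hχ.ne', norm_neg, Fin.sum_univ_three]
    have : ‖(P.γ₂ n : ℂ) * c 2 + Complex.I * (P.a₁ n * c 0 + P.a₂ n * c 1)‖ ≤
        P.γ₂ n * ‖c 2‖ + (|P.a₁ n| * ‖c 0‖ + |P.a₂ n| * ‖c 1‖) := by
      refine (norm_add_le _ _).trans (add_le_add ?_ ?_)
      · rw [norm_mul, Complex.norm_real, Real.norm_eq_abs, abs_of_pos g0]
      · rw [norm_mul, Complex.norm_I, one_mul]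
        refine (norm_add_le _ _).trans ?_
        simp
    refine this.trans ?_
    have b0 := mul_le_mul_of_nonneg_right (P.abs_a₁_le n) (norm_nonneg (c 0))
    have b1 := mul_le_mul_of_nonneg_right (P.abs_a₂_le n) (norm_nonneg (c 1))
    have b2 := mul_le_mul_of_nonneg_right (g2.trans g1) (norm_nonneg (c 2))
    linarith
  have hχ' : P.kappa₂ ^ 2 ≤ 2 * P.χr n := by
    have := χr_ge hn
    nlinarith [sq_nonneg P.kappa₁]
  have hv : ‖P.waveVec n c i‖ ≤ P.waveNum n * ‖P.waveAmp n c‖ := by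
    fin_cases i
    · show ‖Complex.I * P.a₁ n * P.waveAmp n c‖ ≤ _
      rw [norm_mul, norm_mul, Complex.norm_I, one_mul, Complex.norm_real, Real.norm_eq_abs]
      exact mul_le_mul_of_nonneg_right (P.abs_a₁_le n) (norm_nonneg _)
    · show ‖Complex.I * P.a₂ n * P.waveAmp n c‖ ≤ _
      rw [norm_mul, norm_mul, Complex.norm_I, one_mul, Complex.norm_real, Real.norm_eq_abs]
      exact mul_le_mul_of_nonneg_right (P.abs_a₂_le n) (norm_nonneg _)
    · show ‖(P.γ₁ n : ℂ) * P.waveAmp n c‖ ≤ _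
      rw [norm_mul, Complex.norm_real, Real.norm_eq_abs, abs_of_pos (g0.trans_le g2)]
      exact mul_le_mul_of_nonneg_right g1 (norm_nonneg _)
  calc ‖P.waveVec n c i‖ * P.kappa₂ ^ 2
      ≤ (P.waveNum n * ‖P.waveAmp n c‖) * (2 * P.χr n) := by gcongr
    _ = 2 * P.waveNum n * (‖P.waveAmp n c‖ * P.χr n) := by ring
    _ ≤ 2 * P.waveNum n * (P.waveNum n * ∑ i, ‖c i‖) := by gcongr
    _ = _ := by ring

/-- The two exponentials nearly coincide, since their rates differ by `O(1 / |αₙ|)`. -/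
theorem exp_γ₂_sub_exp_γ₁_le (t : ℝ) :
    Real.exp (P.γ₂ n * (t - P.h)) - Real.exp (P.γ₁ n * (t - P.h)) ≤
      (P.γ₁ n - P.γ₂ n) * (P.h - t) * Real.exp (P.γ₂ n * (t - P.h)) := by
  have e : Real.exp (P.γ₁ n * (t - P.h)) = Real.exp (P.γ₂ n * (t - P.h)) *
      Real.exp (-((P.γ₁ n - P.γ₂ n) * (P.h - t))) := by
    rw [← Real.exp_add]; congr 1; ring
  have := Real.add_one_le_exp (-((P.γ₁ n - P.γ₂ n) * (P.h - t)))
  rw [e]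
  nlinarith [Real.exp_pos (P.γ₂ n * (t - P.h))]

include h1 h2

/-- The amplitude `waveVec` is of size `|αₙ|²`, but it only occurs with the difference of the two
exponentials, which gains the factor `1 / |αₙ|`. -/
theorem norm_wave_le (c : Fin 3 → ℂ) (i : Fin 3) {t : ℝ} (ht : t ≤ P.h) (hb : P.fmax ≤ t) :
    ‖P.wave n c i t‖ ≤ (3 + 2 * (P.h - P.fmax)) * P.waveNum n * (∑ i, ‖c i‖) *
      Real.exp (P.γ₂ n * (t - P.h)) := by
  have hA := norm_waveVec_le h2 c i
  have hE := exp_γ₂_sub_exp_γ₁_le (P := P) (n := n) t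
  have hs := γ₁_sub_γ₂_le h2
  have g2 := γ₂_le_γ₁ (P := P) (n := n)
  have hci : ‖c i‖ ≤ ∑ i, ‖c i‖ :=
    Finset.single_le_sum (fun i _ => norm_nonneg (c i)) (Finset.mem_univ i)
  have hE0 : Real.exp (P.γ₁ n * (t - P.h)) ≤ Real.exp (P.γ₂ n * (t - P.h)) :=
    Real.exp_le_exp.2 (mul_le_mul_of_nonpos_right g2 (by linarith))
  set S := ∑ i, ‖c i‖
  set E2 := Real.exp (P.γ₂ n * (t - P.h)) with hE2
  set E1 := Real.exp (P.γ₁ n * (t - P.h)) with hE1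
  set s := P.waveNum n
  set a := ‖P.waveVec n c i‖
  set d := P.γ₁ n - P.γ₂ n
  have hd : 0 ≤ d := sub_nonneg.2 g2
  have hS : 0 ≤ S := (norm_nonneg _).trans hci
  have hE2p : 0 < E2 := Real.exp_pos _
  have had : a * d ≤ 2 * s * S := by
    have hk := pow_pos P.kappa₂_pos 2
    have : (a * d) * (s * P.kappa₂ ^ 2) ≤ (2 * s * S) * (s * P.kappa₂ ^ 2) := by
      calc (a * d) * (s * P.kappa₂ ^ 2) = (a * P.kappa₂ ^ 2) * (d * s) := by ring
        _ ≤ (2 * s ^ 2 * S) * P.kappa₂ ^ 2 := by gcongr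
        _ = _ := by ring
    exact le_of_mul_le_mul_right this (by positivity)
  have hw : P.wave n c i t = c i * (E2 : ℂ) - P.waveVec n c i * ((E2 - E1 : ℝ) : ℂ) := by
    simp only [wave, expAt, hE2, hE1]
    push_cast
    ring
  have hn : ‖P.wave n c i t‖ ≤ ‖c i‖ * E2 + a * (E2 - E1) := by
    rw [hw]
    refine (norm_sub_le _ _).trans (le_of_eq ?_)
    rw [norm_mul, norm_mul, Complex.norm_real, Complex.norm_real, Real.norm_eq_abs,
      Real.norm_eq_abs, abs_of_pos hE2p, abs_of_nonneg (sub_nonneg.2 hE0)]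
  calc ‖P.wave n c i t‖ ≤ ‖c i‖ * E2 + a * (d * (P.h - t) * E2) :=
        hn.trans (by gcongr)
    _ = (‖c i‖ + (a * d) * (P.h - t)) * E2 := by ring
    _ ≤ (S + (2 * s * S) * (P.h - P.fmax)) * E2 := by gcongr
    _ ≤ (3 + 2 * (P.h - P.fmax)) * s * S * E2 := by
        gcongr
        nlinarith [mul_le_mul_of_nonneg_right h1 hS]

theorem norm_waveDeriv_le (c : Fin 3 → ℂ) (i : Fin 3) {t : ℝ} (ht : t ≤ P.h) (hb : P.fmax ≤ t) :
    ‖P.waveDeriv n c i t‖ ≤ (3 + 2 * (P.h - P.fmax)) * P.waveNum n ^ 2 * (∑ i, ‖c i‖) *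
      Real.exp (P.γ₂ n * (t - P.h)) := by
  have hA := norm_waveVec_le h2 c i
  have hE := exp_γ₂_sub_exp_γ₁_le (P := P) (n := n) t
  have hs := γ₁_sub_γ₂_le h2
  have g2 := γ₂_le_γ₁ (P := P) (n := n)
  have g1 := γ₁_le_waveNum (P := P) (n := n)
  have g0 := γ₂_pos (kappa₂_sq_lt_aSq h2)
  have hci : ‖c i‖ ≤ ∑ i, ‖c i‖ :=
    Finset.single_le_sum (fun i _ => norm_nonneg (c i)) (Finset.mem_univ i)
  have hE0 : Real.exp (P.γ₁ n * (t - P.h)) ≤ Real.exp (P.γ₂ n * (t - P.h)) :=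
    Real.exp_le_exp.2 (mul_le_mul_of_nonpos_right g2 (by linarith))
  set S := ∑ i, ‖c i‖
  set E2 := Real.exp (P.γ₂ n * (t - P.h)) with hE2
  set E1 := Real.exp (P.γ₁ n * (t - P.h)) with hE1
  set s := P.waveNum n
  set a := ‖P.waveVec n c i‖
  have ha : 0 ≤ a := norm_nonneg _
  set d := P.γ₁ n - P.γ₂ n with hd_def
  have hd : 0 ≤ d := sub_nonneg.2 g2
  have hS : 0 ≤ S := (norm_nonneg _).trans hci
  have hE2p : 0 < E2 := Real.exp_pos _
  have had : a * d ≤ 2 * s * S := by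
    have hk := pow_pos P.kappa₂_pos 2
    have : (a * d) * (s * P.kappa₂ ^ 2) ≤ (2 * s * S) * (s * P.kappa₂ ^ 2) := by
      calc (a * d) * (s * P.kappa₂ ^ 2) = (a * P.kappa₂ ^ 2) * (d * s) := by ring
        _ ≤ (2 * s ^ 2 * S) * P.kappa₂ ^ 2 := by gcongr
        _ = _ := by ring
    exact le_of_mul_le_mul_right this (by positivity)
  have hw : P.waveDeriv n c i t = ((P.γ₂ n * E2 : ℝ) : ℂ) * c i +
      P.waveVec n c i * ((d * E2 : ℝ) : ℂ) - P.waveVec n c i * ((P.γ₁ n * (E2 - E1) : ℝ) : ℂ) := by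
    simp only [waveDeriv, expAt, hE2, hE1, hd_def]
    push_cast
    ring
  have hg : 0 ≤ P.γ₁ n := g0.le.trans g2
  have hn : ‖P.waveDeriv n c i t‖ ≤ P.γ₂ n * E2 * ‖c i‖ + a * (d * E2) +
      a * (P.γ₁ n * (E2 - E1)) := by
    rw [hw]
    refine (norm_sub_le _ _).trans
      (add_le_add ((norm_add_le _ _).trans (le_of_eq ?_)) (le_of_eq ?_))
    · rw [norm_mul, norm_mul, Complex.norm_real, Complex.norm_real, Real.norm_eq_abs,
        Real.norm_eq_abs, abs_of_nonneg (by positivity), abs_of_nonneg (by positivity)]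
    · rw [norm_mul, Complex.norm_real, Real.norm_eq_abs,
        abs_of_nonneg (mul_nonneg hg (sub_nonneg.2 hE0))]
  calc ‖P.waveDeriv n c i t‖
      ≤ s * E2 * S + a * (d * E2) + a * (s * (d * (P.h - t) * E2)) := by
        refine hn.trans ?_
        have := sub_nonneg.2 hE0
        have := g2.trans g1
        gcongr
    _ = (s * S + (a * d) * (1 + s * (P.h - t))) * E2 := by ring
    _ ≤ (s * S + (2 * s * S) * (1 + s * (P.h - P.fmax))) * E2 := by
        have : 0 ≤ s * (P.h - t) := mul_nonneg (by linarith) (by linarith)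
        gcongr
    _ ≤ (3 + 2 * (P.h - P.fmax)) * s ^ 2 * S * E2 := by
        gcongr
        have : 0 ≤ s * S * (s - 1) := by
          have : 0 ≤ s - 1 := sub_nonneg.2 h1
          positivity
        nlinarith

theorem norm_modeCommutator_wave_le (c : Fin 3 → ℂ) (i : Fin 3) {η : ℝ → ℂ} {K : ℝ} {t : ℝ}
    (ht : t ≤ P.h) (hb : P.fmax ≤ t) (hη1 : ‖deriv η t‖ ≤ K * P.waveNum n)
    (hη2 : ‖deriv (deriv η) t‖ ≤ K * P.waveNum n ^ 2) :
    ‖P.modeCommutator n η (P.wave n c) i t‖ ≤ (3 * P.mu + 5 * (P.lam + P.mu)) * K *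
      (3 + 2 * (P.h - P.fmax)) * P.waveNum n ^ 3 * (∑ i, ‖c i‖) *
        Real.exp (P.γ₂ n * (t - P.h)) := by
  have w0 := fun i => norm_wave_le h1 h2 c i ht hb
  have w1 := fun i => norm_waveDeriv_le h1 h2 c i ht hb
  have m := P.mu_pos
  have l := P.lam_add_mu_pos
  set s := P.waveNum n with hs
  set X := (3 + 2 * (P.h - P.fmax)) * (∑ i, ‖c i‖) * Real.exp (P.γ₂ n * (t - P.h)) with hX
  have hs0 : 0 < s := by linarith
  have hK : 0 ≤ K := by
    by_contra! h
    have := (norm_nonneg _).trans hη1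
    nlinarith
  have w0' : ∀ i, ‖P.wave n c i t‖ ≤ s * X := fun i => (w0 i).trans (le_of_eq (by rw [hX]; ring))
  have w1' : ∀ i, ‖deriv (P.wave n c i) t‖ ≤ s ^ 2 * X := fun i => by
    rw [deriv_wave]; exact (w1 i).trans (le_of_eq (by rw [hX]; ring))
  have hX0 : 0 ≤ X := by
    have := (norm_nonneg _).trans (w0' 0)
    exact nonneg_of_mul_nonneg_right this hs0
  have p1 : ∀ i, ‖2 * deriv η t * deriv (P.wave n c i) t‖ ≤ 2 * K * s ^ 3 * X := fun i => by
    rw [norm_mul, norm_mul, Complex.norm_ofNat]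
    calc 2 * ‖deriv η t‖ * ‖deriv (P.wave n c i) t‖ ≤ 2 * (K * s) * (s ^ 2 * X) := by
          gcongr; exact w1' i
      _ = _ := by ring
  have p2 : ∀ i, ‖deriv (deriv η) t * P.wave n c i t‖ ≤ K * s ^ 3 * X := fun i => by
    rw [norm_mul]
    calc _ ≤ (K * s ^ 2) * (s * X) := by gcongr; exact w0' i
      _ = _ := by ring
  have ia : ∀ a : ℝ, |a| ≤ s → ∀ i, ‖Complex.I * a * P.wave n c i t‖ ≤ s * (s * X) := by
    intro a ha i
    rw [norm_mul, norm_mul, Complex.norm_I, one_mul, Complex.norm_real, Real.norm_eq_abs]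
    gcongr
    exact w0' i
  have p3 : ∀ a : ℝ, |a| ≤ s → ∀ i, ‖Complex.I * a * (deriv η t * P.wave n c i t)‖ ≤
      K * s ^ 3 * X := by
    intro a ha i
    calc _ = ‖deriv η t‖ * ‖Complex.I * a * P.wave n c i t‖ := by rw [← norm_mul]; congr 1; ring
      _ ≤ (K * s) * (s * (s * X)) := by gcongr; exact ia a ha i
      _ = _ := by ring
  have hY : 0 ≤ K * s ^ 3 * X := by positivity
  have hv : ‖(![Complex.I * P.a₁ n * (deriv η t * P.wave n c 2 t),
        Complex.I * P.a₂ n * (deriv η t * P.wave n c 2 t),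
        deriv η t * (Complex.I * P.a₁ n * P.wave n c 0 t + Complex.I * P.a₂ n * P.wave n c 1 t) +
          2 * deriv η t * deriv (P.wave n c 2) t + deriv (deriv η) t * P.wave n c 2 t] :
          Fin 3 → ℂ) i‖ ≤ 5 * (K * s ^ 3 * X) := by
    fin_cases i
    · exact (p3 _ (P.abs_a₁_le n) 2).trans (by linarith)
    · exact (p3 _ (P.abs_a₂_le n) 2).trans (by linarith)
    · refine (norm_add_le _ _).trans ((add_le_add ((norm_add_le _ _).trans
        (add_le_add ?_ (p1 2))) (p2 2)).trans (b := 2 * (K * s ^ 3 * X) + 2 * K * s ^ 3 * X +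
          K * s ^ 3 * X) (by linarith))
      rw [norm_mul]
      calc _ ≤ (K * s) * (s * (s * X) + s * (s * X)) := by
            gcongr
            exact (norm_add_le _ _).trans
              (add_le_add (ia _ (P.abs_a₁_le n) 0) (ia _ (P.abs_a₂_le n) 1))
        _ = _ := by ring
  rw [modeCommutator]
  refine (norm_add_le _ _).trans ?_
  rw [norm_mul, norm_mul, Complex.norm_real, Complex.norm_real, Real.norm_eq_abs, Real.norm_eq_abs,
    abs_of_pos m, abs_of_pos l]
  calc _ ≤ P.mu * (2 * K * s ^ 3 * X + K * s ^ 3 * X) +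
        (P.lam + P.mu) * (5 * (K * s ^ 3 * X)) := by
        gcongr
        exact (norm_add_le _ _).trans (add_le_add (p1 i) (p2 i))
    _ = _ := by rw [hX]; ring

end Evanescent

end BiperiodicScattering

/-! ### Cutoff functions -/

/-- A smooth function which increases from `0` at `b` to `1` at `b + 1 / k`. -/
noncomputable def cutoff (k b t : ℝ) : ℂ := (Real.smoothTransition (k * (t - b)) : ℂ)

theorem contDiff_ofReal_smoothTransition :
    ContDiff ℝ ∞ fun x => (Real.smoothTransition x : ℂ) :=
  Complex.ofRealCLM.contDiff.comp Real.smoothTransition.contDiff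

theorem contDiff_cutoff (k b : ℝ) : ContDiff ℝ ∞ (cutoff k b) :=
  contDiff_ofReal_smoothTransition.comp (contDiff_const.mul (contDiff_id.sub contDiff_const))

theorem cutoff_eq_zero {k b t : ℝ} (hk : 0 ≤ k) (ht : t ≤ b) : cutoff k b t = 0 := by
  rw [cutoff, Real.smoothTransition.zero_of_nonpos, Complex.ofReal_zero]
  exact mul_nonpos_of_nonneg_of_nonpos hk (by linarith)

theorem cutoff_eq_one {k b t : ℝ} (ht : 1 ≤ k * (t - b)) : cutoff k b t = 1 := by
  rw [cutoff, Real.smoothTransition.one_of_one_le ht, Complex.ofReal_one]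

theorem norm_cutoff_le (k b t : ℝ) : ‖cutoff k b t‖ ≤ 1 := by
  rw [cutoff, Complex.norm_real, Real.norm_eq_abs, abs_of_nonneg (Real.smoothTransition.nonneg _)]
  exact Real.smoothTransition.le_one _

theorem cutoff_eventuallyEq_one {k b t : ℝ} (ht : 1 < k * (t - b)) :
    cutoff k b =ᶠ[𝓝 t] fun _ => 1 := by
  have hc : Continuous fun t : ℝ => k * (t - b) := by fun_prop
  filter_upwards [hc.continuousAt.eventually_const_lt ht] with x hx using cutoff_eq_one hx.le

theorem deriv_cutoff_eq_zero {k b t : ℝ} (ht : 1 < k * (t - b)) : deriv (cutoff k b) t = 0 := by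
  rw [(cutoff_eventuallyEq_one ht).deriv_eq]
  simp

theorem deriv_deriv_cutoff_eq_zero {k b t : ℝ} (ht : 1 < k * (t - b)) :
    deriv (deriv (cutoff k b)) t = 0 := by
  rw [(cutoff_eventuallyEq_one ht).deriv.deriv_eq]
  simp

theorem exists_deriv_cutoff_bound : ∃ K : ℝ, 1 ≤ K ∧ ∀ k b t : ℝ, 0 ≤ k →
    ‖deriv (cutoff k b) t‖ ≤ K * k ∧ ‖deriv (deriv (cutoff k b)) t‖ ≤ K * k ^ 2 := by
  set T : ℝ → ℂ := fun x => (Real.smoothTransition x : ℂ)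
  have hT : ContDiff ℝ ∞ T := contDiff_ofReal_smoothTransition
  have hT' : ContDiff ℝ ∞ (deriv T) := (contDiff_infty_iff_deriv.1 hT).2
  have hT'' : ContDiff ℝ ∞ (deriv (deriv T)) := (contDiff_infty_iff_deriv.1 hT').2
  have hsupp : HasCompactSupport (deriv T) := by
    refine HasCompactSupport.intro (isCompact_Icc (a := (0 : ℝ)) (b := 1)) fun x hx => ?_
    rcases not_and_or.1 hx with h | h
    · have : T =ᶠ[𝓝 x] fun _ => 0 := by
        filter_upwards [eventually_lt_nhds (not_le.1 h)] with y hy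
        simp [T, Real.smoothTransition.zero_of_nonpos hy.le]
      rw [this.deriv_eq]
      simp
    · have : T =ᶠ[𝓝 x] fun _ => 1 := by
        filter_upwards [eventually_gt_nhds (not_le.1 h)] with y hy
        simp [T, Real.smoothTransition.one_of_one_le hy.le]
      rw [this.deriv_eq]
      simp
  obtain ⟨K₁, hK₁⟩ := hT'.continuous.bounded_above_of_compact_support hsupp
  obtain ⟨K₂, hK₂⟩ := hT''.continuous.bounded_above_of_compact_support hsupp.deriv
  have lin : ∀ k b t : ℝ, HasDerivAt (fun t : ℝ => k * (t - b)) k t := fun k b t => by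
    simpa using ((hasDerivAt_id t).sub_const b).const_mul k
  have d1 : ∀ k b, deriv (cutoff k b) = fun t => k • deriv T (k * (t - b)) := fun k b =>
    funext fun t => (((hT.differentiable (by simp)) _).hasDerivAt.scomp t (lin k b t)).deriv
  have d2 : ∀ k b t, deriv (deriv (cutoff k b)) t = k • k • deriv (deriv T) (k * (t - b)) := by
    intro k b t
    rw [d1]
    exact ((((hT'.differentiable (by simp)) _).hasDerivAt.scomp t (lin k b t)).const_smul k).deriv
  refine ⟨max 1 (max K₁ K₂), le_max_left _ _, fun k b t hk => ⟨?_, ?_⟩⟩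
  · rw [d1, norm_smul, Real.norm_eq_abs, abs_of_nonneg hk, mul_comm]
    gcongr
    exact (hK₁ _).trans ((le_max_left _ _).trans (le_max_right _ _))
  · rw [d2, norm_smul, norm_smul, Real.norm_eq_abs, abs_of_nonneg hk]
    calc k * (k * ‖deriv (deriv T) (k * (t - b))‖) = ‖deriv (deriv T) (k * (t - b))‖ * k ^ 2 := by
          ring
      _ ≤ _ := by
          gcongr
          exact (hK₂ _).trans ((le_max_right _ _).trans (le_max_right _ _))

theorem integral_norm_sq_le_of_support {g : ℝ → ℂ} (hg : Continuous g) {b h a ℓ M : ℝ}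
    (hℓ : 0 ≤ ℓ) (hM : ∀ t ∈ Set.Ioo b h, ‖g t‖ ≤ M)
    (h0 : ∀ t ∈ Set.Ioo b h, t ∉ Set.Icc a (a + ℓ) → g t = 0) :
    ∫ t in Set.Ioo b h, ‖g t‖ ^ 2 ≤ M ^ 2 * ℓ := by
  have hfin : volume (Set.Icc a (a + ℓ) ∩ Set.Ioo b h) ≤ ENNReal.ofReal ℓ :=
    (measure_mono Set.inter_subset_left).trans (by simp)
  have hint : IntegrableOn (fun _ : ℝ => M ^ 2) (Set.Icc a (a + ℓ) ∩ Set.Ioo b h) :=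
    integrableOn_const (hfin.trans_lt ENNReal.ofReal_lt_top).ne
  calc ∫ t in Set.Ioo b h, ‖g t‖ ^ 2
      ≤ ∫ t in Set.Ioo b h, (Set.Icc a (a + ℓ)).indicator (fun _ => M ^ 2) t := by
        refine setIntegral_mono_on ?_ ?_ measurableSet_Ioo fun t ht => ?_
        · exact ((hg.norm.pow 2).continuousOn.integrableOn_compact (isCompact_Icc (a := b)
            (b := h))).mono_set Set.Ioo_subset_Icc_self
        · rw [integrableOn_indicator_iff measurableSet_Icc]
          exact hint
        · by_cases hm : t ∈ Set.Icc a (a + ℓ)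
          · rw [Set.indicator_of_mem hm]
            have := hM t ht
            gcongr
          · rw [Set.indicator_of_notMem hm, h0 t ht hm]
            simp
    _ = volume.real (Set.Icc a (a + ℓ) ∩ Set.Ioo b h) * M ^ 2 := by
        rw [integral_indicator measurableSet_Icc, Measure.restrict_restrict measurableSet_Icc]
        simp
    _ ≤ ℓ * M ^ 2 := by
        gcongr
        exact ENNReal.toReal_le_of_le_ofReal hℓ hfin
    _ = M ^ 2 * ℓ := mul_comm _ _

namespace BiperiodicScattering

variable (P : BiperiodicScattering)

/-! ### Square-summable bounds for Fourier coefficients -/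

/-- Bessel's inequality for the modes, normalised by upper bounds `ρₙ` of their norms. The case
`ρₙ = 0` is allowed: the quotient is then `0`. -/
theorem sum_norm_modePairing_div_sq_le {F : Space3 → ℂ}
    (hF : MemLp F 2 (volume.restrict P.domain)) {g : ℤ × ℤ → ℝ → ℂ} (hg : ∀ n, Continuous (g n))
    (h0 : ∀ n, ∀ t ≤ P.fmax, g n t = 0) (ρ : ℤ × ℤ → ℝ) (s : Finset (ℤ × ℤ))
    (hρ : ∀ n ∈ s, ∫ t in Set.Ioo P.fmax P.h, ‖g n t‖ ^ 2 ≤ ρ n ^ 2) :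
    ∑ n ∈ s, (‖P.modePairing F n (g n)‖ / ρ n) ^ 2 ≤
      P.L₁ * P.L₂ * ∫ x in P.domain, ‖F x‖ ^ 2 := by
  have := P.sum_norm_modePairing_sq_le hF (g := fun n t => ((ρ n)⁻¹ : ℂ) * g n t)
    (fun n => continuous_const.mul (hg n)) (fun n t ht => by rw [h0 n t ht, mul_zero])
    zero_le_one s (fun n hn => ?_)
  · rw [mul_one] at this
    refine le_trans (Finset.sum_le_sum fun n _ => le_of_eq ?_) this
    rw [modePairing_const_mul, norm_mul, RCLike.norm_conj, norm_inv, Complex.norm_real,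
      Real.norm_eq_abs, mul_pow, inv_pow, sq_abs, div_pow, div_eq_inv_mul]
  · have e : ∀ t, ‖((ρ n)⁻¹ : ℂ) * g n t‖ ^ 2 = (ρ n ^ 2)⁻¹ * ‖g n t‖ ^ 2 := fun t => by
      rw [norm_mul, norm_inv, Complex.norm_real, Real.norm_eq_abs, mul_pow, inv_pow, sq_abs]
    simp_rw [e]
    rw [integral_const_mul]
    exact (mul_le_mul_of_nonneg_left (hρ n hn) (by positivity)).trans inv_mul_le_one

/-- Integration by parts in the horizontal directions trades a factor `|αₙ|` for derivatives
of `u`. -/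
theorem waveNum_sq_mul_norm_modePairing_sq {u : Fin 3 → SobolevH1 P.domain} (hu : P.MemHqp u)
    (n : ℤ × ℤ) (i : Fin 3) {g : ℝ → ℂ} (hg : ContDiff ℝ ∞ g) (h0 : ∀ t ≤ P.fmax, g t = 0) :
    P.waveNum n ^ 2 * ‖P.modePairing (u i).toFun n g‖ ^ 2 =
      ‖P.modePairing ((u i).grad 0) n g‖ ^ 2 + ‖P.modePairing ((u i).grad 1) n g‖ ^ 2 := by
  have e0 : P.modePairing ((u i).grad 0) n g =
      -((starRingEnd ℂ) (Complex.I * P.a₁ n) * P.modePairing (u i).toFun n g) := by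
    rw [← modePairing_const_mul, P.modePairing_grad hu n i 0 hg h0]
    simp
    rfl
  have e1 : P.modePairing ((u i).grad 1) n g =
      -((starRingEnd ℂ) (Complex.I * P.a₂ n) * P.modePairing (u i).toFun n g) := by
    rw [← modePairing_const_mul, P.modePairing_grad hu n i 1 hg h0]
    simp
    rfl
  rw [e0, e1, norm_neg, norm_neg, norm_mul, norm_mul, RCLike.norm_conj, RCLike.norm_conj, norm_mul,
    norm_mul, Complex.norm_I, Complex.norm_real, Complex.norm_real, Real.norm_eq_abs,
    Real.norm_eq_abs, one_mul, one_mul, mul_pow, mul_pow, sq_abs, sq_abs, waveNum_sq, aSq]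
  ring

theorem h1Norm_sq (u : Fin 3 → SobolevH1 P.domain) : h1Norm u ^ 2 =
    ∑ i, ((∫ x in P.domain, ‖(u i).toFun x‖ ^ 2) +
      ∑ j, ∫ x in P.domain, ‖(u i).grad j x‖ ^ 2) := by
  have h0 : ∀ i, 0 ≤ h1NormSq P.domain (u i).toFun (u i).grad := fun i =>
    integral_nonneg fun x => by positivity
  rw [h1Norm, Real.sq_sqrt (Finset.sum_nonneg fun i _ => h0 i)]
  refine Finset.sum_congr rfl fun i _ => ?_
  rw [h1NormSq, integral_add (u i).memLp.integrable_norm_sq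
    (integrable_finsetSum _ fun j _ => ((u i).grad_memLp j).integrable_norm_sq),
    integral_finsetSum _ fun j _ => ((u i).grad_memLp j).integrable_norm_sq]

theorem sum_integral_grad_sq_le (u : Fin 3 → SobolevH1 P.domain) :
    ∑ i, ∑ j, ∫ x in P.domain, ‖(u i).grad j x‖ ^ 2 ≤ h1Norm u ^ 2 := by
  rw [h1Norm_sq]
  refine Finset.sum_le_sum fun i _ => ?_
  have : 0 ≤ ∫ x in P.domain, ‖(u i).toFun x‖ ^ 2 := integral_nonneg fun x => by positivity
  linarith

theorem modeTraction_congr (n : ℤ × ℤ) {φ ψ : Fin 3 → ℝ → ℂ} {t : ℝ}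
    (h : ∀ i, φ i =ᶠ[𝓝 t] ψ i) (i : Fin 3) : P.modeTraction n φ i t = P.modeTraction n ψ i t := by
  have hd : ∀ i j, P.modeDeriv n j (φ i) t = P.modeDeriv n j (ψ i) t := by
    intro i j
    fin_cases j
    · exact congrArg (Complex.I * P.a₁ n * ·) (h i).eq_of_nhds
    · exact congrArg (Complex.I * P.a₂ n * ·) (h i).eq_of_nhds
    · exact (h i).deriv_eq
  simp only [modeTraction, modeDiv, hd, (h i).deriv_eq]

theorem contDiff_modeNavier (n : ℤ × ℤ) {φ : Fin 3 → ℝ → ℂ} (hφ : ∀ i, ContDiff ℝ ∞ (φ i))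
    (i : Fin 3) : ContDiff ℝ ∞ (P.modeNavier n φ i) :=
  ((contDiff_const.mul (ContDiff.sum fun j _ =>
    P.contDiff_modeDeriv n j (P.contDiff_modeDeriv n j (hφ i)))).add
    (contDiff_const.mul (P.contDiff_modeDeriv n i (P.contDiff_modeDiv n hφ)))).add
    (contDiff_const.mul (hφ i))

theorem modeNavier_eq_zero (n : ℤ × ℤ) {φ : Fin 3 → ℝ → ℂ} (hφ : ∀ i, ContDiff ℝ ∞ (φ i))
    {b : ℝ} (h0 : ∀ i, ∀ t ≤ b, φ i t = 0) (i : Fin 3) : ∀ t ≤ b, P.modeNavier n φ i t = 0 := by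
  intro t ht
  have hdiv : ∀ t ≤ b, P.modeDiv n φ t = 0 := fun t ht =>
    Finset.sum_eq_zero fun k _ => P.modeDeriv_eq_zero n k (hφ k) (h0 k) t ht
  rw [modeNavier, h0 i t ht, P.modeDeriv_eq_zero n i (P.contDiff_modeDiv n hφ) hdiv t ht,
    Finset.sum_eq_zero fun j _ => P.modeDeriv_eq_zero n j (P.contDiff_modeDeriv n j (hφ i))
      (P.modeDeriv_eq_zero n j (hφ i) (h0 i)) t ht]
  simp

/-- `Mₙ = O(|αₙ|)`: the entries quadratic in `αₙ` carry the factor `δₙ = O(1 / |αₙ|)`. -/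
theorem norm_M_le {n : ℤ × ℤ} (h2 : 2 * P.kappa₂ ≤ P.waveNum n) (i j : Fin 3) :
    ‖P.M n i j‖ ≤ 4 * P.mu * P.waveNum n := by
  have hn := kappa₂_sq_lt_aSq h2
  have hχ := χr_pos hn
  have hμ := P.mu_pos
  have hs : 0 < P.waveNum n := by linarith [P.kappa₂_pos]
  have hκ := pow_pos P.kappa₂_pos 2
  have g1 := γ₁_le_waveNum (P := P) (n := n)
  have g2 := γ₂_le_γ₁ (P := P) (n := n)
  have g0 := γ₂_pos hn
  have hsub := γ₁_sub_γ₂_le h2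
  have hχ' : P.kappa₂ ^ 2 ≤ 2 * P.χr n := by
    have := χr_ge hn
    nlinarith [sq_nonneg P.kappa₁]
  have hχle := χr_le hn
  set s := P.waveNum n with hs_def
  have na : ‖(P.a₁ n : ℂ)‖ ≤ s := by
    rw [Complex.norm_real, Real.norm_eq_abs]; exact P.abs_a₁_le n
  have nb : ‖(P.a₂ n : ℂ)‖ ≤ s := by
    rw [Complex.norm_real, Real.norm_eq_abs]; exact P.abs_a₂_le n
  have nc : ‖P.beta₂ n‖ ≤ s := by
    rw [beta₂_eq hn, norm_mul, Complex.norm_I, one_mul, Complex.norm_real, Real.norm_eq_abs,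
      abs_of_pos g0]
    exact g2.trans g1
  have nd : ‖P.beta₁ n - P.beta₂ n‖ ≤ P.kappa₂ ^ 2 / s := by
    rw [beta₁_eq hn, beta₂_eq hn, ← mul_sub, norm_mul, Complex.norm_I, one_mul,
      ← Complex.ofReal_sub, Complex.norm_real, Real.norm_eq_abs, abs_of_nonneg (sub_nonneg.2 g2),
      le_div_iff₀ hs]
    exact hsub
  have nχ : ‖P.chi n‖ ≤ P.kappa₂ ^ 2 := by
    rw [chi_eq hn, Complex.norm_real, Real.norm_eq_abs, abs_of_pos hχ]
    exact hχle
  have tri : ∀ x y : ℂ, ‖x‖ ≤ s → ‖y‖ ≤ s →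
      ‖x * y * (P.beta₁ n - P.beta₂ n)‖ ≤ s * P.kappa₂ ^ 2 := by
    intro x y hx hy
    rw [norm_mul, norm_mul]
    calc _ ≤ s * s * (P.kappa₂ ^ 2 / s) := by gcongr
      _ = s * P.kappa₂ ^ 2 := by field_simp
  have cχ : ‖P.beta₂ n * P.chi n‖ ≤ s * P.kappa₂ ^ 2 := by
    rw [norm_mul]; gcongr
  have hpos : 0 ≤ s * P.kappa₂ ^ 2 := by positivity
  have key : ∀ z : ℂ, ‖z‖ ≤ 2 * (s * P.kappa₂ ^ 2) →
      ‖Complex.I * (P.mu : ℂ) / P.chi n * z‖ ≤ 4 * P.mu * s := by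
    intro z hz
    rw [norm_mul, norm_div, norm_mul, Complex.norm_I, one_mul, Complex.norm_real,
      Real.norm_eq_abs, abs_of_pos hμ, chi_eq hn, Complex.norm_real, Real.norm_eq_abs,
      abs_of_pos hχ, div_mul_eq_mul_div, div_le_iff₀ hχ]
    calc P.mu * ‖z‖ ≤ P.mu * (2 * (s * P.kappa₂ ^ 2)) := by gcongr
      _ ≤ P.mu * (2 * (s * (2 * P.χr n))) := by gcongr
      _ = _ := by ring
  have two : ∀ z : ℂ, ‖z‖ ≤ s * P.kappa₂ ^ 2 → ‖z‖ ≤ 2 * (s * P.kappa₂ ^ 2) := fun z h => by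
    linarith
  have diag : ∀ x : ℂ, ‖x‖ ≤ s → ‖x ^ 2 * (P.beta₁ n - P.beta₂ n) + P.beta₂ n * P.chi n‖ ≤
      2 * (s * P.kappa₂ ^ 2) := fun x hx => by
    rw [sq]
    exact (norm_add_le _ _).trans ((add_le_add (tri x x hx hx) cχ).trans (by linarith))
  have last : ‖(P.kappa₂ : ℂ) ^ 2 * P.beta₂ n‖ ≤ s * P.kappa₂ ^ 2 := by
    rw [norm_mul, norm_pow, Complex.norm_real, Real.norm_eq_abs, sq_abs, mul_comm]
    gcongr
  have neg : ∀ z : ℂ, ‖z‖ ≤ s * P.kappa₂ ^ 2 → ‖-z‖ ≤ s * P.kappa₂ ^ 2 := fun z h => by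
    rwa [norm_neg]
  fin_cases i <;> fin_cases j
  · exact key _ (diag _ na)
  · exact key _ (two _ (tri _ _ na nb))
  · exact key _ (two _ (tri _ _ na nc))
  · exact key _ (two _ (tri _ _ na nb))
  · exact key _ (diag _ nb)
  · exact key _ (two _ (tri _ _ nb nc))
  · exact key _ (two _ (neg _ (tri _ _ na nc)))
  · exact key _ (two _ (neg _ (tri _ _ nb nc)))
  · exact key _ (two _ last)

theorem norm_sum_mulVec_mul_conj_le {n : ℤ × ℤ} (h2 : 2 * P.kappa₂ ≤ P.waveNum n)
    (x y : Fin 3 → ℂ) : ‖∑ i, (P.M n).mulVec x i * (starRingEnd ℂ) (y i)‖ ≤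
      4 * P.mu * P.waveNum n * (∑ i, ‖x i‖) * ∑ i, ‖y i‖ := by
  have hs : 0 ≤ 4 * P.mu * P.waveNum n := (norm_nonneg _).trans (P.norm_M_le h2 0 0)
  have hrow : ∀ i, ‖(P.M n).mulVec x i‖ ≤ 4 * P.mu * P.waveNum n * ∑ j, ‖x j‖ := by
    intro i
    show ‖∑ j, P.M n i j * x j‖ ≤ _
    rw [Finset.mul_sum]
    refine (norm_sum_le _ _).trans (Finset.sum_le_sum fun j _ => ?_)
    rw [norm_mul]
    exact mul_le_mul_of_nonneg_right (P.norm_M_le h2 i j) (norm_nonneg _)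
  rw [Finset.mul_sum]
  refine (norm_sum_le _ _).trans (Finset.sum_le_sum fun i _ => ?_)
  rw [norm_mul, RCLike.norm_conj]
  exact mul_le_mul_of_nonneg_right (hrow i) (norm_nonneg _)

/-! ### Decay of the Fourier coefficients of a solution -/

/-- The wave number above which the asymptotic estimates are used. It makes `|αₙ| ≥ 1` and
`|αₙ| ≥ 2 κ₂`, so that the mode is evanescent with `γ₂ ≥ |αₙ| / 2`, and puts the layer of thickness
`1 / |αₙ|` above `fmax` below the level `h`. -/
noncomputable def waveNumBound : ℝ := 1 + 2 * P.kappa₂ + 2 / (P.h - P.fmax)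

section Large

variable {P} {n : ℤ × ℤ} (hs : P.waveNumBound ≤ P.waveNum n)

include hs

theorem one_le_waveNum : 1 ≤ P.waveNum n := by
  have h1 := P.kappa₂_pos
  have h2 : 0 < 2 / (P.h - P.fmax) := div_pos two_pos (sub_pos.2 P.fmax_lt_h)
  unfold waveNumBound at hs
  linarith

theorem two_mul_kappa₂_le_waveNum : 2 * P.kappa₂ ≤ P.waveNum n := by
  have h2 : 0 < 2 / (P.h - P.fmax) := div_pos two_pos (sub_pos.2 P.fmax_lt_h)
  unfold waveNumBound at hs
  linarith

theorem one_lt_waveNum_mul : 1 < P.waveNum n * (P.h - P.fmax) := by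
  have hd := sub_pos.2 P.fmax_lt_h
  have h1 := P.kappa₂_pos
  have h2 : 2 / (P.h - P.fmax) ≤ P.waveNum n := by unfold waveNumBound at hs; linarith
  rw [div_le_iff₀ hd] at h2
  linarith

end Large

/-- The downward decaying wave with value `c` at the level `h`, cut off on a layer of thickness
`1 / |αₙ|` above the level `fmax`. -/
noncomputable def cutWave (n : ℤ × ℤ) (c : Fin 3 → ℂ) (i : Fin 3) (t : ℝ) : ℂ :=
  cutoff (P.waveNum n) P.fmax t * P.wave n c i t

theorem contDiff_cutWave (n : ℤ × ℤ) (c : Fin 3 → ℂ) (i : Fin 3) :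
    ContDiff ℝ ∞ (P.cutWave n c i) :=
  (contDiff_cutoff _ _).mul (P.contDiff_wave n c i)

theorem waveNum_nonneg (n : ℤ × ℤ) : 0 ≤ P.waveNum n := Real.sqrt_nonneg _

theorem cutWave_eq_zero (n : ℤ × ℤ) (c : Fin 3 → ℂ) (i : Fin 3) :
    ∀ t ≤ P.fmax, P.cutWave n c i t = 0 := fun t ht => by
  rw [cutWave, cutoff_eq_zero (P.waveNum_nonneg n) ht, zero_mul]

/-- The Navier operator applied to the cut off wave is the commutator, which is of size
`|αₙ|³ exp(-γ₂ (h - fmax))` and supported in a layer of thickness `1 / |αₙ|`. -/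
theorem exists_integral_modeNavier_cutWave_le : ∃ C : ℝ, 0 < C ∧ ∀ (n : ℤ × ℤ) (c : Fin 3 → ℂ)
    (i : Fin 3), P.waveNumBound ≤ P.waveNum n →
    ∫ t in Set.Ioo P.fmax P.h, ‖P.modeNavier n (P.cutWave n c) i t‖ ^ 2 ≤
      (C * P.waveNum n ^ 2 * Real.sqrt (P.waveNum n) * (∑ i, ‖c i‖) *
        Real.exp (-(P.γ₂ n * (P.h - P.fmax)))) ^ 2 := by
  obtain ⟨K, hK1, hK⟩ := exists_deriv_cutoff_bound
  have hd := sub_pos.2 P.fmax_lt_h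
  have hμ := P.mu_pos
  have hl := P.lam_add_mu_pos
  set C₀ := (3 * P.mu + 5 * (P.lam + P.mu)) * K * (3 + 2 * (P.h - P.fmax)) with hC₀
  have hC₀pos : 0 < C₀ := by positivity
  refine ⟨C₀ * Real.exp 1, by positivity, fun n c i hs => ?_⟩
  have h1 := one_le_waveNum hs
  have h2 := two_mul_kappa₂_le_waveNum hs
  have hn := kappa₂_sq_lt_aSq h2
  have hγ := γ₂_pos hn
  have hγs : P.γ₂ n ≤ P.waveNum n := (γ₂_le_γ₁ (P := P) (n := n)).trans γ₁_le_waveNum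
  set s := P.waveNum n with hs_def
  have hs0 : 0 < s := by linarith
  set S := ∑ i, ‖c i‖
  have hS : 0 ≤ S := Finset.sum_nonneg fun i _ => norm_nonneg _
  set E := Real.exp (-(P.γ₂ n * (P.h - P.fmax))) with hE
  have hcut : ∀ t, P.modeNavier n (P.cutWave n c) i t =
      P.modeCommutator n (cutoff s P.fmax) (P.wave n c) i t := by
    intro t
    have := P.modeNavier_mul n (contDiff_cutoff s P.fmax) (P.contDiff_wave n c) i t
    rw [modeNavier_wave hn, mul_zero, zero_add] at this
    exact this
  have hzero : ∀ t, P.fmax + s⁻¹ < t → P.modeNavier n (P.cutWave n c) i t = 0 := by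
    intro t ht
    have ht' : 1 < s * (t - P.fmax) := by
      have : s⁻¹ < t - P.fmax := by linarith
      calc 1 = s * s⁻¹ := (mul_inv_cancel₀ hs0.ne').symm
        _ < _ := by gcongr
    rw [hcut, modeCommutator, deriv_cutoff_eq_zero ht', deriv_deriv_cutoff_eq_zero ht']
    fin_cases i <;> simp
  have hM0 : 0 ≤ C₀ * Real.exp 1 * s ^ 3 * S * E := by positivity
  refine (integral_norm_sq_le_of_support
    (P.contDiff_modeNavier n (P.contDiff_cutWave n c) i).continuous
    (a := P.fmax) (ℓ := s⁻¹) (M := C₀ * Real.exp 1 * s ^ 3 * S * E) (by positivity) ?_ ?_).trans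
    (le_of_eq ?_)
  · intro t ht
    by_cases hts : P.fmax + s⁻¹ < t
    · rw [hzero t hts, norm_zero]
      exact hM0
    · push Not at hts
      rw [hcut]
      refine (norm_modeCommutator_wave_le h1 h2 c i ht.2.le ht.1.le
        (hK s P.fmax t hs0.le).1 (hK s P.fmax t hs0.le).2).trans ?_
      have hexp : Real.exp (P.γ₂ n * (t - P.h)) ≤ Real.exp 1 * E := by
        -- In the layer, `γ₂ (t - fmax) ≤ |αₙ| / |αₙ| = 1`.
        rw [hE, ← Real.exp_add]
        refine Real.exp_le_exp.2 ?_
        have h3 : P.γ₂ n * (t - P.fmax) ≤ s * s⁻¹ :=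
          mul_le_mul hγs (by linarith) (by linarith [ht.1]) hs0.le
        rw [mul_inv_cancel₀ hs0.ne'] at h3
        linarith
      calc _ = C₀ * s ^ 3 * S * Real.exp (P.γ₂ n * (t - P.h)) := by rw [hC₀]
        _ ≤ C₀ * s ^ 3 * S * (Real.exp 1 * E) := by gcongr
        _ = _ := by ring
  · intro t ht hts
    refine hzero t ?_
    by_contra! h
    exact hts ⟨ht.1.le, h⟩
  · have hsq : Real.sqrt s ^ 2 = s := Real.sq_sqrt hs0.le
    simp only [mul_pow]
    rw [hsq]
    field_simp

/-- The variational equation tested with the cut off wave, combined with coercivity on `Γ_h`. -/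
theorem IsSolution.le_sum_norm_modePairing {P : BiperiodicScattering}
    {u : Fin 3 → SobolevH1 P.domain} (hu : P.IsSolution u) {n : ℤ × ℤ}
    (hs : P.waveNumBound ≤ P.waveNum n) :
    P.L₁ * P.L₂ * (2 * P.mu * P.γ₂ n * ∑ i, ‖P.fourierCoeffTop u n i‖ ^ 2) ≤
      ∑ i, ‖P.modePairing (u i).toFun n
        (P.modeNavier n (P.cutWave n (P.fourierCoeffTop u n)) i)‖ := by
  have hn := kappa₂_sq_lt_aSq (two_mul_kappa₂_le_waveNum hs)
  set c := P.fourierCoeffTop u n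
  have hV : 0 < P.L₁ * P.L₂ := mul_pos P.L₁_pos P.L₂_pos
  have key := hu.sum_modePairing_modeNavier n (P.contDiff_cutWave n c) (P.cutWave_eq_zero n c)
  have hev : ∀ i, P.cutWave n c i =ᶠ[𝓝 P.h] P.wave n c i := fun i => by
    filter_upwards [cutoff_eventuallyEq_one (one_lt_waveNum_mul hs)] with t ht
    rw [cutWave, ht, one_mul]
  have hval : ∀ i, P.cutWave n c i P.h = c i := fun i => by
    rw [(hev i).eq_of_nhds, wave_h]
  simp_rw [P.modeTraction_congr n hev, hval] at key
  have h1 := mul_le_mul_of_nonneg_left (P.le_norm_traction_sub hn c) hV.le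
  refine h1.trans (le_trans (le_of_eq ?_) (norm_sum_le _ _))
  rw [key, norm_mul, Complex.norm_real, Real.norm_eq_abs, abs_of_pos hV]

/-- The Fourier coefficients of a solution decay exponentially, at the rate given by the distance of
`Γ_h` from the scattering surface, relative to a square-summable sequence. -/
theorem exists_fourierCoeffTop_decay : ∃ C : ℝ, 0 < C ∧ ∀ u, P.IsSolution u → ∃ A : ℤ × ℤ → ℝ,
    (∀ n, 0 ≤ A n) ∧
    (∀ F : Finset (ℤ × ℤ), (∀ n ∈ F, P.waveNumBound ≤ P.waveNum n) →
      ∑ n ∈ F, A n ^ 2 ≤ P.L₁ * P.L₂ * h1Norm u ^ 2) ∧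
    ∀ n, P.waveNumBound ≤ P.waveNum n →
      Real.sqrt (P.waveNum n) * ∑ i, ‖P.fourierCoeffTop u n i‖ ≤
        C * P.waveNum n * Real.exp (-(P.γ₂ n * (P.h - P.fmax))) * A n := by
  obtain ⟨C₂, hC₂, hbound⟩ := P.exists_integral_modeNavier_cutWave_le
  have hV : 0 < P.L₁ * P.L₂ := mul_pos P.L₁_pos P.L₂_pos
  have hμ := P.mu_pos
  refine ⟨9 * C₂ / (P.L₁ * P.L₂ * P.mu), by positivity, fun u hu => ?_⟩
  set c := P.fourierCoeffTop u with hc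
  set g : Fin 3 → ℤ × ℤ → ℝ → ℂ := fun i n => P.modeNavier n (P.cutWave n (c n)) i with hg
  have hgs : ∀ i n, ContDiff ℝ ∞ (g i n) := fun i n =>
    P.contDiff_modeNavier n (P.contDiff_cutWave n _) i
  have hg0 : ∀ i n, ∀ t ≤ P.fmax, g i n t = 0 := fun i n =>
    P.modeNavier_eq_zero n (P.contDiff_cutWave n _) (P.cutWave_eq_zero n _) i
  set ρ : ℤ × ℤ → ℝ := fun n => C₂ * P.waveNum n ^ 2 * Real.sqrt (P.waveNum n) * (∑ i, ‖c n i‖) *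
    Real.exp (-(P.γ₂ n * (P.h - P.fmax))) with hρ
  set Q : ℤ × ℤ → ℝ := fun n => ∑ i, ((‖P.modePairing ((u i).grad 0) n (g i n)‖ / ρ n) ^ 2 +
    (‖P.modePairing ((u i).grad 1) n (g i n)‖ / ρ n) ^ 2) with hQ
  have hQ0 : ∀ n, 0 ≤ Q n := fun n => Finset.sum_nonneg fun i _ => by positivity
  refine ⟨fun n => Real.sqrt (Q n), fun n => Real.sqrt_nonneg _, fun F hF => ?_, fun n hs => ?_⟩
  · simp_rw [Real.sq_sqrt (hQ0 _)]
    rw [Finset.sum_comm]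
    refine le_trans ?_ (mul_le_mul_of_nonneg_left (P.sum_integral_grad_sq_le u) hV.le)
    rw [Finset.mul_sum]
    refine Finset.sum_le_sum fun i _ => ?_
    rw [Finset.sum_add_distrib, Fin.sum_univ_three]
    have b := fun j => P.sum_norm_modePairing_div_sq_le ((u i).grad_memLp j)
      (fun n => (hgs i n).continuous) (hg0 i) ρ F (fun n hn => hbound n (c n) i (hF n hn))
    have b2 : 0 ≤ ∫ x in P.domain, ‖(u i).grad 2 x‖ ^ 2 := integral_nonneg fun x => by positivity
    have := mul_nonneg hV.le b2
    linarith [b 0, b 1]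
  · have h1 := one_le_waveNum hs
    have h2 := two_mul_kappa₂_le_waveNum hs
    have hγ := waveNum_le_two_mul_γ₂ h2
    have key := hu.le_sum_norm_modePairing hs
    set s := P.waveNum n with hs_def
    have hs0 : 0 < s := by linarith
    set S := ∑ i, ‖c n i‖ with hS_def
    have hS : 0 ≤ S := Finset.sum_nonneg fun i _ => norm_nonneg _
    set E := Real.exp (-(P.γ₂ n * (P.h - P.fmax)))
    have hE : 0 < E := Real.exp_pos _
    rcases hS.eq_or_lt with h0 | hSpos
    · rw [← h0, mul_zero]
      positivity
    have hρn : ρ n = C₂ * s ^ 2 * Real.sqrt s * S * E := rfl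
    have hsq : 0 < Real.sqrt s := Real.sqrt_pos.2 hs0
    have hρpos : 0 < ρ n := by rw [hρn]; positivity
    have hi : ∀ i, s * ‖P.modePairing (u i).toFun n (g i n)‖ ≤ ρ n * Real.sqrt (Q n) := by
      intro i
      have e := P.waveNum_sq_mul_norm_modePairing_sq hu.1 n i (hgs i n) (hg0 i n)
      have hle : (‖P.modePairing ((u i).grad 0) n (g i n)‖ / ρ n) ^ 2 +
          (‖P.modePairing ((u i).grad 1) n (g i n)‖ / ρ n) ^ 2 ≤ Q n :=
        Finset.single_le_sum (f := fun i => (‖P.modePairing ((u i).grad 0) n (g i n)‖ / ρ n) ^ 2 +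
          (‖P.modePairing ((u i).grad 1) n (g i n)‖ / ρ n) ^ 2) (fun i _ => by positivity)
          (Finset.mem_univ i)
      refine le_of_sq_le_sq ?_ (by positivity)
      rw [mul_pow, mul_pow, e, Real.sq_sqrt (hQ0 n)]
      rw [div_pow, div_pow, ← add_div, div_le_iff₀ (by positivity)] at hle
      linarith
    have hsum : s * ∑ i, ‖P.modePairing (u i).toFun n (g i n)‖ ≤ 3 * (ρ n * Real.sqrt (Q n)) := by
      rw [Fin.sum_univ_three]
      linarith [hi 0, hi 1, hi 2]
    have hS2 : S ^ 2 ≤ 3 * ∑ i, ‖c n i‖ ^ 2 := by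
      rw [hS_def, Fin.sum_univ_three, Fin.sum_univ_three]
      nlinarith [sq_nonneg (‖c n 0‖ - ‖c n 1‖), sq_nonneg (‖c n 0‖ - ‖c n 2‖),
        sq_nonneg (‖c n 1‖ - ‖c n 2‖)]
    set X := Real.sqrt (Q n)
    have hX : 0 ≤ X := Real.sqrt_nonneg _
    set V := P.L₁ * P.L₂
    have hsq0 : 0 ≤ ∑ i, ‖c n i‖ ^ 2 := Finset.sum_nonneg fun i _ => by positivity
    have main : (V * P.mu * s ^ 2 * S) * S ≤ (9 * C₂ * s ^ 2 * Real.sqrt s * E * X) * S := by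
      calc (V * P.mu * s ^ 2 * S) * S = V * P.mu * s ^ 2 * S ^ 2 := by ring
        _ ≤ V * P.mu * s ^ 2 * (3 * ∑ i, ‖c n i‖ ^ 2) := by gcongr
        _ = 3 * (s * (V * (P.mu * s * ∑ i, ‖c n i‖ ^ 2))) := by ring
        _ ≤ 3 * (s * (V * (P.mu * (2 * P.γ₂ n) * ∑ i, ‖c n i‖ ^ 2))) := by gcongr
        _ = 3 * (s * (V * (2 * P.mu * P.γ₂ n * ∑ i, ‖c n i‖ ^ 2))) := by ring
        _ ≤ 3 * (s * ∑ i, ‖P.modePairing (u i).toFun n (g i n)‖) := by gcongr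
        _ ≤ 3 * (3 * (ρ n * X)) := by gcongr
        _ = _ := by rw [hρn]; ring
    have main2 := le_of_mul_le_mul_right main hSpos
    have hs2 : Real.sqrt s * Real.sqrt s = s := Real.mul_self_sqrt hs0.le
    have main3 : V * P.mu * (Real.sqrt s * S) ≤ 9 * C₂ * s * E * X := by
      have : (V * P.mu * (Real.sqrt s * S)) * s ^ 2 ≤ (9 * C₂ * s * E * X) * s ^ 2 := by
        calc _ = Real.sqrt s * (V * P.mu * s ^ 2 * S) := by ring
          _ ≤ Real.sqrt s * (9 * C₂ * s ^ 2 * Real.sqrt s * E * X) := by gcongr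
          _ = 9 * C₂ * (Real.sqrt s * Real.sqrt s) * s ^ 2 * E * X := by ring
          _ = _ := by rw [hs2]; ring
      exact le_of_mul_le_mul_right this (by positivity)
    show Real.sqrt s * S ≤ 9 * C₂ / (V * P.mu) * s * E * X
    rw [div_mul_eq_mul_div, div_mul_eq_mul_div, div_mul_eq_mul_div, le_div_iff₀ (by positivity)]
    linarith

/-! ### The trace theorem in terms of Fourier coefficients -/

/-- The trace of a function in `H¹(Ω)` on `Γ_h` is in `H^{1/2}(Γ_h)`. The proof applies Green's
formula with `gₙ(x₃) exp(i αₙ · r)`, where `gₙ` is `1` at the level `h` and `0` below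
`h - 1 / |αₙ|`. -/
theorem exists_fourierCoeffTop_bound : ∃ C : ℝ, 0 < C ∧ ∀ v, P.MemHqp v → ∃ B : ℤ × ℤ → ℝ,
    (∀ n, 0 ≤ B n) ∧
    (∀ F : Finset (ℤ × ℤ), (∀ n ∈ F, P.waveNumBound ≤ P.waveNum n) →
      ∑ n ∈ F, B n ^ 2 ≤ P.L₁ * P.L₂ * h1Norm v ^ 2) ∧
    ∀ n, P.waveNumBound ≤ P.waveNum n →
      Real.sqrt (P.waveNum n) * ∑ i, ‖P.fourierCoeffTop v n i‖ ≤ C * B n := by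
  obtain ⟨K, hK1, hK⟩ := exists_deriv_cutoff_bound
  have hV : 0 < P.L₁ * P.L₂ := mul_pos P.L₁_pos P.L₂_pos
  have hd := sub_pos.2 P.fmax_lt_h
  refine ⟨3 * (1 + 2 * K) / (P.L₁ * P.L₂), by positivity, fun v hv => ?_⟩
  -- The maximum makes the cutoff vanish up to `fmax` for all `n`; for large `n` it is `|αₙ|`.
  set k : ℤ × ℤ → ℝ := fun n => max (P.waveNum n) (P.h - P.fmax)⁻¹ with hk
  have hkpos : ∀ n, 0 < k n := fun n => lt_max_of_lt_right (inv_pos.2 hd)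
  have hks : ∀ n, P.waveNumBound ≤ P.waveNum n → k n = P.waveNum n := fun n hs =>
    max_eq_left ((inv_le_iff_one_le_mul₀ hd).2 (one_lt_waveNum_mul hs).le)
  set g : ℤ × ℤ → ℝ → ℂ := fun n => cutoff (k n) (P.h - (k n)⁻¹) with hg
  have hgs : ∀ n, ContDiff ℝ ∞ (g n) := fun n => contDiff_cutoff _ _
  have hg's : ∀ n, ContDiff ℝ ∞ (deriv (g n)) := fun n => (contDiff_infty_iff_deriv.1 (hgs n)).2
  have hlow : ∀ n, P.fmax ≤ P.h - (k n)⁻¹ := fun n => by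
    have : (k n)⁻¹ ≤ P.h - P.fmax := inv_le_of_inv_le₀ hd (le_max_right _ _)
    linarith
  have hg0 : ∀ n, ∀ t ≤ P.fmax, g n t = 0 := fun n t ht =>
    cutoff_eq_zero (hkpos n).le (ht.trans (hlow n))
  have hg'0 : ∀ n, ∀ t ≤ P.h - (k n)⁻¹, deriv (g n) t = 0 := fun n =>
    P.modeDeriv_eq_zero n 2 (hgs n) fun t ht => cutoff_eq_zero (hkpos n).le ht
  have hg1 : ∀ n, g n P.h = 1 := fun n => cutoff_eq_one (by
    rw [sub_sub_cancel, mul_inv_cancel₀ (hkpos n).ne'])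
  set ρ₀ : ℤ × ℤ → ℝ := fun n => (Real.sqrt (k n))⁻¹ with hρ₀
  set ρ₁ : ℤ × ℤ → ℝ := fun n => K * Real.sqrt (k n) with hρ₁
  have hsk : ∀ n, Real.sqrt (k n) ^ 2 = k n := fun n => Real.sq_sqrt (hkpos n).le
  have hskp : ∀ n, 0 < Real.sqrt (k n) := fun n => Real.sqrt_pos.2 (hkpos n)
  have hint0 : ∀ n, ∫ t in Set.Ioo P.fmax P.h, ‖g n t‖ ^ 2 ≤ ρ₀ n ^ 2 := by
    intro n
    refine (integral_norm_sq_le_of_support (hgs n).continuous (a := P.h - (k n)⁻¹)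
      (ℓ := (k n)⁻¹) (M := 1) (inv_pos.2 (hkpos n)).le (fun t _ => norm_cutoff_le _ _ _)
      fun t ht hts => ?_).trans (le_of_eq ?_)
    · refine cutoff_eq_zero (hkpos n).le ?_
      by_contra! h
      exact hts ⟨h.le, by linarith [ht.2]⟩
    · simp only [hρ₀]
      rw [inv_pow, hsk, one_pow, one_mul]
  have hint1 : ∀ n, ∫ t in Set.Ioo P.fmax P.h, ‖deriv (g n) t‖ ^ 2 ≤ ρ₁ n ^ 2 := by
    intro n
    refine (integral_norm_sq_le_of_support (hg's n).continuous (a := P.h - (k n)⁻¹)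
      (ℓ := (k n)⁻¹) (M := K * k n) (inv_pos.2 (hkpos n)).le
      (fun t _ => (hK _ _ t (hkpos n).le).1) fun t ht hts => ?_).trans (le_of_eq ?_)
    · refine hg'0 n t ?_
      by_contra! h
      exact hts ⟨h.le, by linarith [ht.2]⟩
    · simp only [hρ₁]
      rw [mul_pow, mul_pow, hsk]
      have := (hkpos n).ne'
      field_simp
  set Q : ℤ × ℤ → ℝ := fun n => ∑ i, ((‖P.modePairing ((v i).grad 2) n (g n)‖ / ρ₀ n) ^ 2 +
    ((‖P.modePairing ((v i).grad 0) n (deriv (g n))‖ / ρ₁ n) ^ 2 +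
    (‖P.modePairing ((v i).grad 1) n (deriv (g n))‖ / ρ₁ n) ^ 2)) with hQ
  have hQ0 : ∀ n, 0 ≤ Q n := fun n => Finset.sum_nonneg fun i _ => by positivity
  refine ⟨fun n => Real.sqrt (Q n), fun n => Real.sqrt_nonneg _, fun F hF => ?_, fun n hs => ?_⟩
  · simp_rw [Real.sq_sqrt (hQ0 _)]
    rw [Finset.sum_comm]
    refine le_trans ?_ (mul_le_mul_of_nonneg_left (P.sum_integral_grad_sq_le v) hV.le)
    rw [Finset.mul_sum]
    refine Finset.sum_le_sum fun i _ => ?_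
    rw [Finset.sum_add_distrib, Finset.sum_add_distrib, Fin.sum_univ_three]
    have b0 := P.sum_norm_modePairing_div_sq_le ((v i).grad_memLp 2)
      (fun n => (hgs n).continuous) hg0 ρ₀ F (fun n _ => hint0 n)
    have b := fun j => P.sum_norm_modePairing_div_sq_le ((v i).grad_memLp j)
      (fun n => (hg's n).continuous) (fun n t ht => hg'0 n t (ht.trans (hlow n))) ρ₁ F
      (fun n _ => hint1 n)
    linarith [b 0, b 1]
  · have hs1 := one_le_waveNum hs
    have hkn := hks n hs
    set s := P.waveNum n with hs_def
    have hs0 : 0 < s := by linarith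
    set X := Real.sqrt (Q n) with hX
    have hXsq : X ^ 2 = Q n := Real.sq_sqrt (hQ0 n)
    have hX0 : 0 ≤ X := Real.sqrt_nonneg _
    have hK0 : 0 < K := by linarith
    have hsp : 0 < Real.sqrt s := Real.sqrt_pos.2 hs0
    have hss : Real.sqrt s ^ 2 = s := Real.sq_sqrt hs0.le
    have hρ₀n : ρ₀ n = (Real.sqrt s)⁻¹ := by simp only [hρ₀, hkn]
    have hρ₁n : ρ₁ n = K * Real.sqrt s := by simp only [hρ₁, hkn]
    have hρ₀p : 0 < ρ₀ n := by rw [hρ₀n]; positivity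
    have hρ₁p : 0 < ρ₁ n := by rw [hρ₁n]; positivity
    have hi : ∀ i, P.L₁ * P.L₂ * (Real.sqrt s * ‖P.fourierCoeffTop v n i‖) ≤ (1 + 2 * K) * X := by
      intro i
      have e := P.waveNum_sq_mul_norm_modePairing_sq hv n i (hg's n)
        (fun t ht => hg'0 n t (ht.trans (hlow n)))
      have green := P.modePairing_grad hv n i 2 (hgs n) (hg0 n)
      rw [if_pos rfl, hg1, map_one, one_mul] at green
      have green' : ((P.L₁ * P.L₂ : ℝ) : ℂ) * P.fourierCoeffTop v n i =
          P.modePairing ((v i).grad 2) n (g n) + P.modePairing (v i).toFun n (deriv (g n)) := by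
        rw [green]
        show _ = -P.modePairing (v i).toFun n (deriv (g n)) + _ + _
        ring
      have hV' : P.L₁ * P.L₂ * ‖P.fourierCoeffTop v n i‖ ≤
          ‖P.modePairing ((v i).grad 2) n (g n)‖ +
            ‖P.modePairing (v i).toFun n (deriv (g n))‖ := by
        refine le_trans (le_of_eq ?_) (norm_add_le _ _)
        rw [← green', norm_mul, Complex.norm_real, Real.norm_eq_abs, abs_of_pos hV]
      set x := ‖P.modePairing ((v i).grad 2) n (g n)‖
      set y := ‖P.modePairing (v i).toFun n (deriv (g n))‖
      set p := ‖P.modePairing ((v i).grad 0) n (deriv (g n))‖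
      set q := ‖P.modePairing ((v i).grad 1) n (deriv (g n))‖
      have hle : (x / ρ₀ n) ^ 2 + ((p / ρ₁ n) ^ 2 + (q / ρ₁ n) ^ 2) ≤ X ^ 2 := by
        rw [hXsq]
        exact Finset.single_le_sum (f := fun i =>
          (‖P.modePairing ((v i).grad 2) n (g n)‖ / ρ₀ n) ^ 2 +
          ((‖P.modePairing ((v i).grad 0) n (deriv (g n))‖ / ρ₁ n) ^ 2 +
          (‖P.modePairing ((v i).grad 1) n (deriv (g n))‖ / ρ₁ n) ^ 2))
          (fun i _ => by positivity) (Finset.mem_univ i)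
      have hx : Real.sqrt s * x ≤ X := by
        have : x / ρ₀ n ≤ X := le_of_sq_le_sq
          (by nlinarith [sq_nonneg (p / ρ₁ n), sq_nonneg (q / ρ₁ n)]) hX0
        rw [hρ₀n, div_inv_eq_mul] at this
        linarith
      have hy : Real.sqrt s * y ≤ K * X := by
        have h3 : p ^ 2 + q ^ 2 ≤ (ρ₁ n * X) ^ 2 := by
          have : (p / ρ₁ n) ^ 2 + (q / ρ₁ n) ^ 2 ≤ X ^ 2 := by nlinarith [sq_nonneg (x / ρ₀ n)]
          rw [div_pow, div_pow, ← add_div, div_le_iff₀ (by positivity)] at this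
          linarith
        have h4 : s * y ≤ ρ₁ n * X := by
          refine le_of_sq_le_sq ?_ (by positivity)
          rw [mul_pow, e]
          exact h3
        rw [hρ₁n] at h4
        have h5 : Real.sqrt s * (Real.sqrt s * y) ≤ Real.sqrt s * (K * X) := by
          calc _ = Real.sqrt s ^ 2 * y := by ring
            _ = s * y := by rw [hss]
            _ ≤ _ := h4.trans (le_of_eq (by ring))
        exact le_of_mul_le_mul_left h5 hsp
      calc P.L₁ * P.L₂ * (Real.sqrt s * ‖P.fourierCoeffTop v n i‖)
          = Real.sqrt s * (P.L₁ * P.L₂ * ‖P.fourierCoeffTop v n i‖) := by ring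
        _ ≤ Real.sqrt s * (x + y) := by gcongr
        _ = Real.sqrt s * x + Real.sqrt s * y := by ring
        _ ≤ X + K * X := add_le_add hx hy
        _ ≤ (1 + 2 * K) * X := by nlinarith [mul_nonneg hK0.le hX0]
    show _ ≤ _ * X
    rw [div_mul_eq_mul_div, le_div_iff₀ hV, Fin.sum_univ_three]
    linarith [hi 0, hi 1, hi 2]

/-! ### Growth of the wave numbers and attainment of the maximum -/

theorem notMem_box_iff (N : ℕ) (n : ℤ × ℤ) :
    n ∉ Finset.Icc (-(N : ℤ)) N ×ˢ Finset.Icc (-(N : ℤ)) N ↔ (N : ℤ) < nMax n := by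
  rw [Finset.mem_product, Finset.mem_Icc, Finset.mem_Icc, ← abs_le, ← abs_le, ← not_le, nMax,
    max_le_iff]

theorem exists_waveNum_le : ∃ D : ℝ, 0 < D ∧ ∀ n, 1 ≤ nMax n → P.waveNum n ≤ D * nMax n := by
  have h1 := P.L₁_pos
  have h2 := P.L₂_pos
  have hπ := Real.pi_pos
  refine ⟨|P.alpha₁| + |P.alpha₂| + 2 * Real.pi / P.L₁ + 2 * Real.pi / P.L₂, by positivity,
    fun n hn => ?_⟩
  have hn' : (1 : ℝ) ≤ nMax n := by exact_mod_cast hn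
  have b1 : |(n.1 : ℝ)| ≤ nMax n := by exact_mod_cast le_max_left |n.1| |n.2|
  have b2 : |(n.2 : ℝ)| ≤ nMax n := by exact_mod_cast le_max_right |n.1| |n.2|
  have e1 : |P.a₁ n| ≤ |P.alpha₁| * nMax n + 2 * Real.pi / P.L₁ * nMax n := by
    rw [a₁]
    refine (abs_add_le _ _).trans (add_le_add (le_mul_of_one_le_right (abs_nonneg _) hn') ?_)
    rw [mul_div_right_comm, abs_mul, abs_of_pos (by positivity : 0 < 2 * Real.pi / P.L₁)]
    gcongr
  have e2 : |P.a₂ n| ≤ |P.alpha₂| * nMax n + 2 * Real.pi / P.L₂ * nMax n := by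
    rw [a₂]
    refine (abs_add_le _ _).trans (add_le_add (le_mul_of_one_le_right (abs_nonneg _) hn') ?_)
    rw [mul_div_right_comm, abs_mul, abs_of_pos (by positivity : 0 < 2 * Real.pi / P.L₂)]
    gcongr
  have : P.waveNum n ≤ |P.a₁ n| + |P.a₂ n| := by
    refine Real.sqrt_le_iff.2 ⟨by positivity, ?_⟩
    rw [aSq, ← sq_abs (P.a₁ n), ← sq_abs (P.a₂ n)]
    nlinarith [mul_nonneg (abs_nonneg (P.a₁ n)) (abs_nonneg (P.a₂ n))]
  linarith

theorem exists_le_waveNum : ∃ c D : ℝ, 0 < c ∧ ∀ n, c * nMax n - D ≤ P.waveNum n := by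
  have h1 := P.L₁_pos
  have h2 := P.L₂_pos
  have hπ := Real.pi_pos
  refine ⟨2 * Real.pi / (P.L₁ + P.L₂), |P.alpha₁| + |P.alpha₂|, by positivity, fun n => ?_⟩
  have low : ∀ (a α L : ℝ) (k : ℤ), 0 < L → L ≤ P.L₁ + P.L₂ → a = α + 2 * Real.pi * k / L →
      2 * Real.pi / (P.L₁ + P.L₂) * |(k : ℝ)| - |α| ≤ |a| := by
    intro a α L k hL hle ha
    have e : 2 * Real.pi / L * |(k : ℝ)| ≤ |a| + |α| := by
      have : 2 * Real.pi / L * k = a - α := by rw [ha]; ring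
      calc 2 * Real.pi / L * |(k : ℝ)| = |2 * Real.pi / L * k| := by
            rw [abs_mul, abs_of_pos (by positivity : 0 < 2 * Real.pi / L)]
        _ ≤ _ := by rw [this]; exact abs_sub _ _
    have : 2 * Real.pi / (P.L₁ + P.L₂) * |(k : ℝ)| ≤ 2 * Real.pi / L * |(k : ℝ)| := by gcongr
    linarith
  rcases max_choice |n.1| |n.2| with h | h
  · have := low _ _ _ n.1 h1 (by linarith) (rfl : P.a₁ n = _)
    rw [nMax, h, Int.cast_abs]
    linarith [P.abs_a₁_le n, abs_nonneg P.alpha₂]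
  · have := low _ _ _ n.2 h2 (by linarith) (rfl : P.a₂ n = _)
    rw [nMax, h, Int.cast_abs]
    linarith [P.abs_a₂_le n, abs_nonneg P.alpha₁]

theorem waveNum_sub_kappa₂_le (n : ℤ × ℤ) : P.waveNum n - P.kappa₂ ≤ ‖P.beta₂ n‖ := by
  have hκ := P.kappa₂_pos
  rcases le_or_gt (P.aSq n) (P.kappa₂ ^ 2) with h | h
  · have : P.waveNum n ≤ P.kappa₂ := Real.sqrt_le_iff.2 ⟨hκ.le, h⟩
    linarith [norm_nonneg (P.beta₂ n)]
  · rw [beta₂_eq h, norm_mul, Complex.norm_I, one_mul, Complex.norm_real, Real.norm_eq_abs,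
      abs_of_pos (γ₂_pos h)]
    refine Real.le_sqrt_of_sq_le ?_
    have : P.kappa₂ ≤ P.waveNum n := Real.le_sqrt_of_sq_le h.le
    rw [← waveNum_sq]
    nlinarith

/-- The maximum is attained, because the values tend to `0` as `|n|_max → ∞` and are positive. -/
theorem exists_isGreatest_tailValues (N : ℕ) {hhat : ℝ} (hh : hhat < P.h) :
    ∃ m, IsGreatest (P.tailValues N hhat) m := by
  obtain ⟨c, D, hc, hlow⟩ := P.exists_le_waveNum
  set d := P.h - hhat with hd_def
  have hd : 0 < d := sub_pos.2 hh
  set F : ℤ × ℤ → ℝ := fun n => (nMax n : ℝ) * Real.exp (-(‖P.beta₂ n‖ * d)) with hF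
  set n₀ : ℤ × ℤ := ((N : ℤ) + 1, 0) with hn₀
  have hn₀max : nMax n₀ = (N : ℤ) + 1 := by
    simp only [nMax, hn₀, abs_zero]
    rw [abs_of_nonneg (by positivity), max_eq_left (by positivity)]
  have hF0 : 0 < F n₀ := by
    have : (0 : ℝ) < nMax n₀ := by rw [hn₀max]; positivity
    positivity
  have hfin : {n : ℤ × ℤ | F n₀ ≤ F n}.Finite := by
    have hlim : Tendsto (fun x : ℝ => x * Real.exp (-(d * (c * x - (D + P.kappa₂))))) atTop
        (𝓝 0) := by
      have h1 := (Real.tendsto_pow_mul_exp_neg_atTop_nhds_zero 1).comp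
        (tendsto_id.const_mul_atTop (mul_pos hd hc))
      have h2 := h1.const_mul ((d * c)⁻¹ * Real.exp (d * (D + P.kappa₂)))
      rw [mul_zero] at h2
      refine h2.congr fun x => ?_
      have e : Real.exp (-(d * (c * x - (D + P.kappa₂)))) =
          Real.exp (d * (D + P.kappa₂)) * Real.exp (-(d * c * x)) := by
        rw [← Real.exp_add]; congr 1; ring
      rw [e]
      simp only [Function.comp, id, pow_one]
      field_simp
    obtain ⟨R, hR⟩ := eventually_atTop.1 (hlim.eventually_lt_const hF0)
    refine (Finset.finite_toSet (Finset.Icc (-(⌈R⌉₊ : ℤ)) ⌈R⌉₊ ×ˢ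
      Finset.Icc (-(⌈R⌉₊ : ℤ)) ⌈R⌉₊)).subset fun n hn => ?_
    by_contra hnot
    have hbig := (notMem_box_iff ⌈R⌉₊ n).1 hnot
    have hRn : R ≤ nMax n := (Nat.le_ceil R).trans (by exact_mod_cast hbig.le)
    have h0 : (0 : ℝ) ≤ nMax n := by exact_mod_cast (abs_nonneg n.1).trans (le_max_left _ _)
    have : F n ≤ (nMax n : ℝ) * Real.exp (-(d * (c * nMax n - (D + P.kappa₂)))) := by
      simp only [hF]
      refine mul_le_mul_of_nonneg_left (Real.exp_le_exp.2 (neg_le_neg ?_)) h0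
      rw [mul_comm d]
      exact mul_le_mul_of_nonneg_right (by linarith [hlow n, P.waveNum_sub_kappa₂_le n]) hd.le
    exact absurd hn (not_le.2 (this.trans_lt (hR _ hRn)))
  have hfin' : ({n : ℤ × ℤ | F n₀ ≤ F n} ∩ {n | (N : ℤ) < nMax n}).Finite := hfin.inter_of_left _
  have hn₀N : (N : ℤ) < nMax n₀ := by rw [hn₀max]; exact lt_add_one _
  obtain ⟨n₁, hn₁, hmax⟩ := Set.exists_max_image _ F hfin' ⟨n₀, le_refl (F n₀), hn₀N⟩
  refine ⟨F n₁, ⟨n₁, hn₁.2, rfl⟩, ?_⟩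
  rintro _ ⟨n, hn, rfl⟩
  show F n ≤ F n₁
  rcases le_total (F n₀) (F n) with h | h
  · exact hmax n ⟨h, hn⟩
  · exact h.trans hn₁.1

theorem fmax_le_of_forall_lt {hhat : ℝ} (h : ∀ r, P.f r < hhat) : P.fmax ≤ hhat :=
  ciSup_le fun r => (h r).le

theorem exists_waveNumBound_le : ∃ N₀ : ℕ, ∀ n, (N₀ : ℤ) < nMax n →
    P.waveNumBound ≤ P.waveNum n := by
  obtain ⟨c, D, hc, hlow⟩ := P.exists_le_waveNum
  refine ⟨⌈(P.waveNumBound + D) / c⌉₊, fun n hn => ?_⟩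
  have h1 : (P.waveNumBound + D) / c ≤ nMax n :=
    (Nat.le_ceil _).trans (by exact_mod_cast hn.le)
  rw [div_le_iff₀ hc] at h1
  linarith [hlow n]

/-! ### The truncation error -/

/-- The bound for finite sections of the tail of the duality pairing. -/
theorem exists_sum_norm_topPairing_le : ∃ C : ℝ, 0 < C ∧ ∃ N₀ : ℕ,
    ∀ hhat : ℝ, (∀ r, P.f r < hhat) → hhat < P.h → ∀ u, P.IsSolution u → ∀ N : ℕ, N₀ ≤ N →
    ∀ m, IsGreatest (P.tailValues N hhat) m → ∀ v, P.MemHqp v →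
    ∀ F : Finset (ℤ × ℤ), (∀ n ∈ F, (N : ℤ) < nMax n) →
      ∑ n ∈ F, ‖P.topPairing (P.dtnMode u n) v‖ ≤ C * m * (h1Norm u * h1Norm v) := by
  obtain ⟨Ca, hCa, hA⟩ := P.exists_fourierCoeffTop_decay
  obtain ⟨Cb, hCb, hB⟩ := P.exists_fourierCoeffTop_bound
  obtain ⟨D, hD, hDn⟩ := P.exists_waveNum_le
  obtain ⟨N₀, hN₀⟩ := P.exists_waveNumBound_le
  have hV : 0 < P.L₁ * P.L₂ := mul_pos P.L₁_pos P.L₂_pos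
  have hμ := P.mu_pos
  refine ⟨P.L₁ * P.L₂ * (4 * P.mu * (Ca * Cb * D)) * (P.L₁ * P.L₂), by positivity, N₀, ?_⟩
  intro hhat hf hh u hu N hN m hm v hv F hF
  obtain ⟨A, hA0, hA2, hAb⟩ := hA u hu
  obtain ⟨B, hB0, hB2, hBb⟩ := hB v hv
  have hbig : ∀ n ∈ F, P.waveNumBound ≤ P.waveNum n := fun n hn =>
    hN₀ n (lt_of_le_of_lt (by exact_mod_cast hN) (hF n hn))
  have hu0 : 0 ≤ h1Norm u := Real.sqrt_nonneg _
  have hv0 : 0 ≤ h1Norm v := Real.sqrt_nonneg _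
  have hm0 : 0 ≤ m := by
    obtain ⟨n, hn, rfl⟩ := hm.1
    have : (0 : ℝ) ≤ nMax n := by exact_mod_cast (abs_nonneg n.1).trans (le_max_left _ _)
    positivity
  set V := P.L₁ * P.L₂ with hV_def
  have hterm : ∀ n ∈ F, ‖P.topPairing (P.dtnMode u n) v‖ ≤
      V * (4 * P.mu * (Ca * Cb * D)) * m * (A n * B n) := by
    intro n hn
    have hs := hbig n hn
    have h1 := one_le_waveNum hs
    have h2 := two_mul_kappa₂_le_waveNum hs
    have hn2 := kappa₂_sq_lt_aSq h2
    have hγ := γ₂_pos hn2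
    have a := hAb n hs
    have b := hBb n hs
    have hn1 : 1 ≤ nMax n := by have := hF n hn; omega
    have hDn' := hDn n hn1
    have hβ : ‖P.beta₂ n‖ = P.γ₂ n := by
      rw [beta₂_eq hn2, norm_mul, Complex.norm_I, one_mul, Complex.norm_real, Real.norm_eq_abs,
        abs_of_pos hγ]
    have hE : Real.exp (-(P.γ₂ n * (P.h - P.fmax))) ≤ Real.exp (-(‖P.beta₂ n‖ * (P.h - hhat))) := by
      rw [hβ]
      have := P.fmax_le_of_forall_lt hf
      gcongr
    have hmn : (nMax n : ℝ) * Real.exp (-(‖P.beta₂ n‖ * (P.h - hhat))) ≤ m :=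
      hm.2 ⟨n, hF n hn, rfl⟩
    rw [P.topPairing_dtnMode hv, norm_mul, Complex.norm_real, Real.norm_eq_abs, abs_of_pos hV]
    set s := P.waveNum n
    set E := Real.exp (-(P.γ₂ n * (P.h - P.fmax)))
    set Su := ∑ i, ‖P.fourierCoeffTop u n i‖
    set Sv := ∑ i, ‖P.fourierCoeffTop v n i‖
    have hs0 : 0 ≤ s := by linarith
    have hSv : 0 ≤ Sv := Finset.sum_nonneg fun i _ => norm_nonneg _
    have hA0n := hA0 n
    have hB0n := hB0 n
    have hsE : s * E ≤ D * m := by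
      calc s * E ≤ (D * nMax n) * Real.exp (-(‖P.beta₂ n‖ * (P.h - hhat))) :=
            mul_le_mul hDn' hE (Real.exp_pos _).le (hs0.trans hDn')
        _ = D * (nMax n * Real.exp (-(‖P.beta₂ n‖ * (P.h - hhat)))) := by ring
        _ ≤ D * m := by gcongr
    have hprod : s * Su * Sv ≤ Ca * Cb * D * m * (A n * B n) := by
      calc s * Su * Sv = (Real.sqrt s * Real.sqrt s) * Su * Sv := by rw [Real.mul_self_sqrt hs0]
        _ = (Real.sqrt s * Su) * (Real.sqrt s * Sv) := by ring
        _ ≤ (Ca * s * E * A n) * (Cb * B n) :=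
            mul_le_mul a b (mul_nonneg (Real.sqrt_nonneg _) hSv) (by positivity)
        _ = Ca * Cb * (s * E) * (A n * B n) := by ring
        _ ≤ Ca * Cb * (D * m) * (A n * B n) := by gcongr
        _ = _ := by ring
    calc _ ≤ V * (4 * P.mu * s * Su * Sv) := by
          gcongr; exact P.norm_sum_mulVec_mul_conj_le h2 _ _
      _ = V * (4 * P.mu * (s * Su * Sv)) := by ring
      _ ≤ V * (4 * P.mu * (Ca * Cb * D * m * (A n * B n))) := by gcongr
      _ = _ := by ring
  have hcs : ∑ n ∈ F, A n * B n ≤ V * (h1Norm u * h1Norm v) := by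
    refine le_of_sq_le_sq ((Finset.sum_mul_sq_le_sq_mul_sq F A B).trans ?_) (by positivity)
    calc _ ≤ (V * h1Norm u ^ 2) * (V * h1Norm v ^ 2) :=
          mul_le_mul (hA2 F hbig) (hB2 F hbig) (Finset.sum_nonneg fun n _ => sq_nonneg _)
            (by positivity)
      _ = _ := by ring
  calc ∑ n ∈ F, ‖P.topPairing (P.dtnMode u n) v‖
      ≤ ∑ n ∈ F, V * (4 * P.mu * (Ca * Cb * D)) * m * (A n * B n) := Finset.sum_le_sum hterm
    _ = V * (4 * P.mu * (Ca * Cb * D)) * m * ∑ n ∈ F, A n * B n := by rw [Finset.mul_sum]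
    _ ≤ V * (4 * P.mu * (Ca * Cb * D)) * m * (V * (h1Norm u * h1Norm v)) := by gcongr
    _ = _ := by ring

end BiperiodicScattering

theorem lemma5p2 (P : BiperiodicScattering) :
    ∃ C : ℝ, 0 < C ∧ ∃ N₀ : ℕ,
      ∀ hhat : ℝ, (∀ r, P.f r < hhat) → hhat < P.h →
      ∀ u : Fin 3 → SobolevH1 P.domain, P.IsSolution u →
      ∀ Cs : ℝ, h1Norm u ≤ Cs * P.uincNorm →
      ∀ N : ℕ, N₀ ≤ N →
      ∃ m : ℝ, IsGreatest (P.tailValues N hhat) m ∧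
        ∀ v : Fin 3 → SobolevH1 P.domain, P.MemHqp v →
          Summable (fun n : ℤ × ℤ => P.topPairing (P.dtnMode u n) v) ∧
          ‖P.dtnForm u v - P.topPairing (P.dtnTrunc N u) v‖
            ≤ C * Cs * m * P.uincNorm * h1Norm v := by
  obtain ⟨C, hC, N₀, hbound⟩ := P.exists_sum_norm_topPairing_le
  refine ⟨C, hC, N₀, fun hhat hf hh u hu Cs hCs N hN => ?_⟩
  obtain ⟨m, hm⟩ := P.exists_isGreatest_tailValues N hh
  refine ⟨m, hm, fun v hv => ?_⟩
  set p : ℤ × ℤ → ℂ := fun n => P.topPairing (P.dtnMode u n) v with hp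
  set box := Finset.Icc (-(N : ℤ)) N ×ˢ Finset.Icc (-(N : ℤ)) N with hbox
  have hpart : ∀ F : Finset {n // n ∉ box}, ∑ n ∈ F, ‖p n‖ ≤ C * m * (h1Norm u * h1Norm v) := by
    intro F
    have := hbound hhat hf hh u hu N hN m hm v hv (F.map (Function.Embedding.subtype _)) (by
      intro n hn
      obtain ⟨n', -, rfl⟩ := Finset.mem_map.1 hn
      exact (BiperiodicScattering.notMem_box_iff N n').1 n'.2)
    rwa [Finset.sum_map] at this
  have hsn : Summable fun n : {n // n ∉ box} => ‖p n‖ :=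
    summable_of_sum_le (fun n => norm_nonneg _) hpart
  have hs : Summable p := (Finset.summable_compl_iff box).1 hsn.of_norm
  refine ⟨hs, ?_⟩
  have hm0 : 0 ≤ m := by
    obtain ⟨n, hn, rfl⟩ := hm.1
    have : (0 : ℝ) ≤ BiperiodicScattering.nMax n := by
      exact_mod_cast (abs_nonneg n.1).trans (le_max_left _ _)
    positivity
  have hv0 : 0 ≤ h1Norm v := Real.sqrt_nonneg _
  rw [P.topPairing_dtnTrunc hv, BiperiodicScattering.dtnForm, ← hs.sum_add_tsum_subtype_compl box,
    add_sub_cancel_left]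
  calc ‖∑' n : {n // n ∉ box}, p n‖ ≤ ∑' n : {n // n ∉ box}, ‖p n‖ := norm_tsum_le_tsum_norm hsn
    _ ≤ C * m * (h1Norm u * h1Norm v) := Real.tsum_le_of_sum_le (fun n => norm_nonneg _) hpart
    _ ≤ C * m * (Cs * P.uincNorm * h1Norm v) := by gcongr
    _ = _ := by ring
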